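/- Let $L=E(5,10)$ be the Lie superalgebra over $\mathbb C$ with even part $L_{\bar 0}=S_5$, the divergence-free formal vector fields in $x_1,\dots,x_5$, and odd part $L_{\bar 1}=\Omega^2_{cl}(5)$, the closed formal $2$-forms; $S_5$ acts on $2$-forms by the Lie derivative, and $[f\,d_{jk},g\,d_{lm}]=\epsilon_{ijklm}\,fg\,\partial_i$, where $d_{ij}=dx_i\wedge dx_j$, $\partial_i=\partial/\partial x_i$ and $i$ is the remaining index (the bracket is $0$ if $j,k,l,m$ are not distinct). Grade $L$ by $\deg x_i=2=-\deg\partial_i$, $\deg d_{ij}=-1$, with components $\mathfrak g_j$; then $\mathfrak g_0\cong\mathfrak{sl}_5$ via $\sum A_{ij}x_i\partial_j\leftrightarrow (A_{ij})$. Let $L_0$ (resp. $L_+$) be the subalgebra of elements all of whose components have degree $\ge 0$ (resp. $>0$), let $L_-=\mathfrak g_{-2}\oplus\mathfrak g_{-1}$, and let $U\supset U_0,U_-$ be the universal enveloping algebras of $L\supset L_0,L_-$. For a $\mathfrak g_0$-module $V$, let $M(V)=U\otimes_{U_0}V$, where $L_+$ acts on $V$ by $0$. A morphism $\varphi:M(V)\to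 M(W)$ is a $U$-linear map; it has degree $k$ if $\varphi(1\otimes v)=\sum_r u_r\otimes\ell_r(v)$ for all $v\in V$, with finitely many linear maps $\ell_r:V\to W$ and elements $u_r\in U_-$ of degree $-k$. Let $F(n_1,n_2,n_3,n_4)$ be the irreducible finite-dimensional $\mathfrak g_0$-module with highest weight $(n_1,n_2,n_3,n_4)$ with respect to the Borel subalgebra spanned by the $x_i\partial_j$, $i<j$, and the $h_i=x_i\partial_i-x_{i+1}\partial_{i+1}$, and put $M(n_1,n_2,n_3,n_4)=M(F(n_1,n_2,n_3,n_4))$. Let $z_i$, $x_{ij}=-x_{ji}$ be the standard bases of $\mathbb C^5$, $\Lambda^2\mathbb C^5$, and $z_i^*$, $x_{ij}^*=-x^*_{ji}$ the dual bases. Let $S_A=S(\mathbb C^5\oplus\Lambda^2\mathbb C^5)$, $S_B=S(\mathbb C^5\oplus\mathbb C^{5*})$, $S_C=S(\Lambda^2\mathbb C^{5*}\oplus\mathbb C^{5*})$ be the polynomial algebras in these variables, with $\mathfrak g_0$ acting by derivations. For $X=A,B,C$ and $m,n\ge 0$, the bihomogeneous component of $S_X$ of bidegree $(m,n)$ (in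 the two groups of variables, in the order written) contains the highest irreducible component $S_{X,high}^{m,n}$, generated by $z_1^m x_{12}^n$, $z_1^m (z_5^*)^n$, $(x_{45}^*)^m(z_5^*)^n$ respectively; let $S_{X,low}^{m,n}$ be its invariant complement in this component, and let $S_{X,high}$, $S_{X,low}$ be the sums of these over all $m,n$. Put $V_A=S_{A,high}$, $V_B=S_B/S_{B,low}$, $V_C=S_C/S_{C,low}$, and let $V_X^{m,n}\subset V_X$ be (the image of) $S_{X,high}^{m,n}$. Put $$\theta^A_{ij}=\frac{d}{dx_{ij}},\qquad \theta^B_{ij}=z_i^*\frac{d}{dz_j}-z_j^*\frac{d}{dz_i},\qquad \theta^C_{ij}=x^*_{ij}\ (\text{multiplication}),\qquad \nabla_X=\sum_{i,j=1}^5 d_{ij}\otimes\theta^X_{ij}.$$ Theorem. One has $$V_A=\bigoplus_{m,n\ge0}V_A^{m,n},\ V_A^{m,n}\cong F(m,n,0,0);\quad V_B=\bigoplus_{m,n\ge0}V_B^{m,n},\ V_B^{m,n}\cong F(m,0,0,n);\quad V_C=\bigoplus_{m,n\ge0}V_C^{m,n},\ V_C^{m,n}\cong F(0,0,m,n),$$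 the operators $\theta^X_{ij}$ induce operators on $V_X$, and: (a) for $X=A,B,C$ there is an $E(5,10)$-morphism $\nabla_X:M(V_X)\to M(V_X)$ with $\nabla_X(1\otimes v)=\sum_{i,j}d_{ij}\otimes\theta^X_{ij}v$ for all $v\in V_X$; (b) the restriction of $\nabla_X$ to $M(V_X^{m,n})$ is zero if and only if $X=A$ and $n=0$ (that is, on $M(m,0,0,0)$), or $X=B$ and $m=0$ (that is, on $M(0,0,0,n)$); in particular it is never zero for $X=C$; (c) the morphisms $\nabla_X$, and their non-zero restrictions to the $M(V_X^{m,n})$, are morphisms of degree $1$. -/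

import Mathlib

open scoped TensorProduct

namespace E510

noncomputable section

/-! ### Formal vector fields, formal two-forms and the Lie superalgebra `E(5,10)` -/

/-- Formal power series in `x₁, …, x₅` over `ℂ`. -/
abbrev FPS : Type := MvPowerSeries (Fin 5) ℂ

/-- The partial derivative `∂ᵢ = ∂ / ∂xᵢ` of formal power series. -/
abbrev pd (i : Fin 5) : Derivation ℂ FPS FPS := MvPowerSeries.pderiv ℂ i

/-- The Lie algebra `S₅` of formal vector fields `∑ Xᵢ ∂ᵢ` with zero divergence. -/
def S5 : Submodule ℂ (Fin 5 → FPS) where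
  carrier := {X | ∑ i, pd i (X i) = 0}
  add_mem' {X Y} hX hY := by
    simp only [Set.mem_ofPred_eq] at *
    simp [Finset.sum_add_distrib, hX, hY]
  zero_mem' := by simp
  smul_mem' c X hX := by
    simp only [Set.mem_ofPred_eq] at *
    simp [← Finset.smul_sum, hX]

/-- Closed formal two-forms. A two-form `∑_{i<j} ωᵢⱼ dxᵢ ∧ dxⱼ` is given by its
skew-symmetric coefficient matrix `ωᵢⱼ`. -/
def Omega2cl : Submodule ℂ (Fin 5 → Fin 5 → FPS) where
  carrier := {w | (∀ i j, w i j = -w j i) ∧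
    ∀ i j k, pd i (w j k) + pd j (w k i) + pd k (w i j) = 0}
  add_mem' {v w} hv hw := by
    refine ⟨fun i j => ?_, fun i j k => ?_⟩
    · simp only [Pi.add_apply]; rw [hv.1 i j, hw.1 i j]; ring
    · simp only [Pi.add_apply, map_add]; linear_combination hv.2 i j k + hw.2 i j k
  zero_mem' := by simp
  smul_mem' c w hw := by
    refine ⟨fun i j => ?_, fun i j k => ?_⟩
    · simp only [Pi.smul_apply]; rw [hw.1 i j]; simp
    · simp only [Pi.smul_apply, Derivation.map_smul, ← smul_add, hw.2 i j k, smul_zero]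

/-- The underlying space of `E(5,10)`: the even part `S₅` plus the odd part `Ω²_cl(5)`. -/
abbrev L : Type := S5 × Omega2cl

/-- The sign of the permutation `i j k l m` if the indices are distinct, and `0` otherwise. -/
def eps (i j k l m : Fin 5) : ℤ :=
  if h : Function.Bijective ![i, j, k, l, m] then
    (Equiv.Perm.sign (Equiv.ofBijective ![i, j, k, l, m] h) : ℤ) else 0

/-- The bracket of two vector fields. -/
def vfBracket (X Y : Fin 5 → FPS) : Fin 5 → FPS := fun i =>
  ∑ j, (X j * pd j (Y i) - Y j * pd j (X i))

/-- The Lie derivative of a two-form along a vector field. -/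
def lieDeriv (X : Fin 5 → FPS) (w : Fin 5 → Fin 5 → FPS) : Fin 5 → Fin 5 → FPS := fun i j =>
  ∑ k, (X k * pd k (w i j) + pd i (X k) * w k j + pd j (X k) * w i k)

/-- The vector field corresponding to the four-form `v ∧ w`: the bilinear extension of
`[f dⱼₖ, g dₗₘ] = ε_{ijklm} f g ∂ᵢ` (the factor `1/4` accounts for `dⱼₖ = -dₖⱼ`). -/
def wedge (v w : Fin 5 → Fin 5 → FPS) : Fin 5 → FPS := fun i =>
  (1 / 4 : ℂ) • ∑ j, ∑ k, ∑ l, ∑ m, eps i j k l m • (v j k * w l m)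

theorem pd_comm (i j : Fin 5) (f : FPS) : pd i (pd j f) = pd j (pd i f) := by
  ext n
  rcases eq_or_ne i j with rfl | h
  · rfl
  · simp only [pd, MvPowerSeries.coeff_pderiv, Finsupp.add_apply, Finsupp.single_apply, h, h.symm,
      if_false, add_zero, add_right_comm n]
    ring

theorem vfBracket_mem (X Y : S5) : vfBracket X.1 Y.1 ∈ S5 := by
  have hX : ∑ i, pd i (X.1 i) = 0 := X.2
  have hY : ∑ i, pd i (Y.1 i) = 0 := Y.2
  change ∑ i, pd i (∑ j, (X.1 j * pd j (Y.1 i) - Y.1 j * pd j (X.1 i))) = 0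
  simp only [map_sum, map_sub, Derivation.leibniz, smul_eq_mul]
  have key : ∀ U V : Fin 5 → FPS, ∑ i, pd i (V i) = 0 →
      ∑ i, ∑ j, U j * pd i (pd j (V i)) = 0 := by
    intro U V hV
    rw [Finset.sum_comm]
    refine Finset.sum_eq_zero fun j _ => ?_
    simp only [pd_comm _ j]
    rw [← Finset.mul_sum, ← map_sum, hV, map_zero, mul_zero]
  have h1 := key X.1 Y.1 hY
  have h2 := key Y.1 X.1 hX
  have h3 : ∑ i, ∑ j, pd j (Y.1 i) * pd i (X.1 j) =
      ∑ i, ∑ j, pd j (X.1 i) * pd i (Y.1 j) := by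
    rw [Finset.sum_comm]
    exact Finset.sum_congr rfl fun i _ => Finset.sum_congr rfl fun j _ => mul_comm _ _
  simp only [Finset.sum_sub_distrib, Finset.sum_add_distrib]
  rw [h1, h2, h3]
  ring

theorem lieDeriv_mem (X : S5) (w : Omega2cl) : lieDeriv X.1 w.1 ∈ Omega2cl := by
  obtain ⟨X, -⟩ := X
  obtain ⟨w, hw, hc⟩ := w
  refine ⟨fun i j => ?_, fun a b c => ?_⟩
  · simp only [lieDeriv, ← Finset.sum_neg_distrib]
    refine Finset.sum_congr rfl fun k _ => ?_
    rw [hw i j, hw k j, hw i k, map_neg]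
    ring
  · simp only [lieDeriv, map_sum, ← Finset.sum_add_distrib]
    refine Finset.sum_eq_zero fun k _ => ?_
    have e' : ∀ p r, pd p (w r k) = -pd p (w k r) := by
      intro p r; rw [hw r k]; simp
    have hd := congrArg (pd k) (hc a b c)
    have h1 := hc a b k
    have h2 := hc b c k
    have h3 := hc c a k
    simp only [map_add, Derivation.leibniz, smul_eq_mul, map_zero] at hd ⊢
    rw [pd_comm a k, pd_comm b k, pd_comm c k, pd_comm b a, pd_comm c b, pd_comm c a,
      hw a k, hw b k, hw c k]
    simp only [e', map_neg] at h1 h2 h3 ⊢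
    linear_combination X k * hd + pd c (X k) * h1 + pd a (X k) * h2 + pd b (X k) * h3

theorem eps_perm (i j k l m : Fin 5) (s : Equiv.Perm (Fin 5)) (hs : Equiv.Perm.sign s = 1)
    (i' j' k' l' m' : Fin 5) (h : ![i', j', k', l', m'] = ![i, j, k, l, m] ∘ s) :
    eps i' j' k' l' m' = eps i j k l m := by
  unfold eps
  by_cases hb : Function.Bijective ![i, j, k, l, m]
  · have hb' : Function.Bijective ![i', j', k', l', m'] := h ▸ hb.comp s.bijective
    rw [dif_pos hb, dif_pos hb']
    have : Equiv.ofBijective _ hb' = s.trans (Equiv.ofBijective _ hb) := by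
      ext x
      simp [h]
    rw [this, Equiv.Perm.sign_trans, hs, mul_one]
  · have hb' : ¬ Function.Bijective ![i', j', k', l', m'] := by
      rw [h]
      exact fun h' => hb ((Function.Bijective.of_comp_iff _ s.bijective).1 h')
    rw [dif_neg hb, dif_neg hb']

theorem eps_rotate (i j k l m : Fin 5) : eps j k i l m = eps i j k l m :=
  eps_perm i j k l m (Equiv.swap 0 1 * Equiv.swap 1 2) (by decide) _ _ _ _ _
    (by ext x; fin_cases x <;> rfl)

theorem eps_swap (i j k l m : Fin 5) : eps i l m j k = eps i j k l m :=
  eps_perm i j k l m (Equiv.swap 1 3 * Equiv.swap 2 4) (by decide) _ _ _ _ _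
    (by ext x; fin_cases x <;> rfl)

theorem wedge_mem_aux (v w : Omega2cl) :
    ∑ i, ∑ j, ∑ k, ∑ l, ∑ m, eps i j k l m • (pd i (v.1 j k) * w.1 l m) = 0 := by
  obtain ⟨v, -, hc⟩ := v
  obtain ⟨w, -⟩ := w
  set F : Fin 5 → Fin 5 → Fin 5 → FPS := fun i j k =>
    ∑ l, ∑ m, eps i j k l m • (pd i (v j k) * w l m) with hF
  have h0 : ∀ i j k, F i j k + F j k i + F k i j = 0 := by
    intro i j k
    simp only [hF, ← Finset.sum_add_distrib]
    refine Finset.sum_eq_zero fun l _ => Finset.sum_eq_zero fun m _ => ?_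
    rw [← eps_rotate i j k, ← eps_rotate j k i]
    rw [← smul_add, ← smul_add, ← add_mul, ← add_mul, hc i j k, zero_mul, smul_zero]
  have r1 : ∑ i, ∑ j, ∑ k, F j k i = ∑ i, ∑ j, ∑ k, F i j k := by
    rw [Finset.sum_comm]
    exact Finset.sum_congr rfl fun i _ => Finset.sum_comm
  have r2 : ∑ i, ∑ j, ∑ k, F k i j = ∑ i, ∑ j, ∑ k, F j k i := by
    rw [Finset.sum_comm]
    exact Finset.sum_congr rfl fun i _ => Finset.sum_comm
  have h3 : ∑ i, ∑ j, ∑ k, (F i j k + F j k i + F k i j) = 0 := by simp [h0]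
  simp only [Finset.sum_add_distrib] at h3
  rw [r2, r1] at h3
  have h4 : (3 : ℂ) • ∑ i, ∑ j, ∑ k, F i j k = 0 := by
    rw [← h3]
    module
  exact (smul_eq_zero.1 h4).resolve_left (by norm_num)

theorem wedge_mem (v w : Omega2cl) : wedge v.1 w.1 ∈ S5 := by
  change ∑ i, pd i ((1 / 4 : ℂ) • ∑ j, ∑ k, ∑ l, ∑ m, eps i j k l m • (v.1 j k * w.1 l m)) = 0
  simp only [Derivation.map_smul, ← Finset.smul_sum, map_sum, map_zsmul, Derivation.leibniz,
    smul_eq_mul, smul_add, Finset.sum_add_distrib]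
  have h1 := wedge_mem_aux v w
  have h2 := wedge_mem_aux w v
  have h3 : ∑ i, ∑ j, ∑ k, ∑ l, ∑ m, eps i j k l m • (v.1 j k * pd i (w.1 l m)) = 0 := by
    rw [← h2]
    refine Finset.sum_congr rfl fun i _ => ?_
    simp only [← Fintype.sum_prod_type']
    refine Fintype.sum_equiv ⟨fun p => (p.2.2.1, p.2.2.2, p.1, p.2.1),
      fun p => (p.2.2.1, p.2.2.2, p.1, p.2.1), fun _ => rfl, fun _ => rfl⟩ _ _ fun p => ?_
    simp [eps_swap i p.1 p.2.1, mul_comm]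
  have h4 : ∑ i, ∑ j, ∑ k, ∑ l, ∑ m, eps i j k l m • (w.1 l m * pd i (v.1 j k)) = 0 := by
    rw [← h1]
    simp only [mul_comm]
  rw [h3, h4, smul_zero, add_zero]

/-- The bracket `[X, Y]` of even elements. -/
def brEE (X Y : S5) : S5 := ⟨vfBracket X.1 Y.1, vfBracket_mem X Y⟩

/-- The bracket `[X, w]` of an even and an odd element. -/
def brEO (X : S5) (w : Omega2cl) : Omega2cl := ⟨lieDeriv X.1 w.1, lieDeriv_mem X w⟩

/-- The bracket `[v, w]` of odd elements. -/
def brOO (v w : Omega2cl) : S5 := ⟨wedge v.1 w.1, wedge_mem v w⟩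

/-- The defining relations of the universal enveloping algebra: `x y - (-1)^{|x||y|} y x = [x, y]`
for homogeneous `x`, `y`. -/
inductive EnvRel : TensorAlgebra ℂ L → TensorAlgebra ℂ L → Prop
  | ee (X Y : S5) : EnvRel
      (TensorAlgebra.ι ℂ ((X, 0) : L) * TensorAlgebra.ι ℂ ((Y, 0) : L)
        - TensorAlgebra.ι ℂ ((Y, 0) : L) * TensorAlgebra.ι ℂ ((X, 0) : L))
      (TensorAlgebra.ι ℂ ((brEE X Y, 0) : L))
  | eo (X : S5) (w : Omega2cl) : EnvRel
      (TensorAlgebra.ι ℂ ((X, 0) : L) * TensorAlgebra.ι ℂ ((0, w) : L)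
        - TensorAlgebra.ι ℂ ((0, w) : L) * TensorAlgebra.ι ℂ ((X, 0) : L))
      (TensorAlgebra.ι ℂ ((0, brEO X w) : L))
  | oo (v w : Omega2cl) : EnvRel
      (TensorAlgebra.ι ℂ ((0, v) : L) * TensorAlgebra.ι ℂ ((0, w) : L)
        + TensorAlgebra.ι ℂ ((0, w) : L) * TensorAlgebra.ι ℂ ((0, v) : L))
      (TensorAlgebra.ι ℂ ((brOO v w, 0) : L))

/-- The universal enveloping algebra `U(L)` of the Lie superalgebra `L = E(5,10)`. -/
def U : Type := RingQuot EnvRel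

instance : Ring U := inferInstanceAs (Ring (RingQuot EnvRel))

instance : Algebra ℂ U := inferInstanceAs (Algebra ℂ (RingQuot EnvRel))

/-- The canonical map `L → U(L)`. -/
def toU : L →ₗ[ℂ] U := (RingQuot.mkAlgHom ℂ EnvRel : TensorAlgebra ℂ L →ₐ[ℂ] U).toLinearMap ∘ₗ TensorAlgebra.ι ℂ

/-! ### The grading -/

/-- The elements of `L` all of whose homogeneous components have a degree satisfying `p`, for the
grading with `deg xᵢ = 2 = -deg ∂ᵢ` and `deg dᵢⱼ = -1`. -/
def degPart (p : ℤ → Prop) : Submodule ℂ L where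
  carrier := {x | (∀ i n, MvPowerSeries.coeff n (x.1.1 i) ≠ 0 → p (2 * (n.degree : ℤ) - 2)) ∧
    ∀ i j n, MvPowerSeries.coeff n (x.2.1 i j) ≠ 0 → p (2 * (n.degree : ℤ) - 1)}
  add_mem' {x y} hx hy := by
    refine ⟨fun i n h => ?_, fun i k n h => ?_⟩
    · by_contra hj
      refine h ?_
      have h1 := not_imp_comm.1 (hx.1 i n) hj
      have h2 := not_imp_comm.1 (hy.1 i n) hj
      simp [h1, h2]
    · by_contra hj
      refine h ?_
      have h1 := not_imp_comm.1 (hx.2 i k n) hj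
      have h2 := not_imp_comm.1 (hy.2 i k n) hj
      simp [h1, h2]
  zero_mem' := by simp
  smul_mem' c x hx := by
    refine ⟨fun i n h => hx.1 i n ?_, fun i k n h => hx.2 i k n ?_⟩
    · rintro h0
      exact h (by simp [h0])
    · rintro h0
      exact h (by simp [h0])

/-- The graded component `𝔤ⱼ` of `L`. -/
abbrev gr (j : ℤ) : Submodule ℂ L := degPart (· = j)

/-- The subalgebra `L₀ = 𝔤₀ + L₊` of `L`. -/
abbrev L0 : Submodule ℂ L := degPart (0 ≤ ·)

/-- The Lie algebra `sl₅(ℂ)`, identified with `𝔤₀` through `A ↦ ∑ Aᵢⱼ xᵢ ∂ⱼ`. -/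
abbrev sl5 : Type := LieAlgebra.SpecialLinear.sl (Fin 5) ℂ

/-- The projection `L → 𝔤₀ = sl₅`: the matrix `A` such that the degree `0` component of `x` is
`∑ Aᵢⱼ xᵢ ∂ⱼ`. -/
def toG0 : L →ₗ[ℂ] sl5 where
  toFun x := ⟨Matrix.of fun i j => MvPowerSeries.coeff (Finsupp.single i 1) (x.1.1 j), by
    have h : ∑ i, pd i (x.1.1 i) = 0 := x.1.2
    have h' := congrArg (MvPowerSeries.coeff 0) h
    simp only [map_sum, pd, MvPowerSeries.coeff_pderiv] at h'
    change Matrix.trace (Matrix.of _ : Matrix (Fin 5) (Fin 5) ℂ) = 0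
    simpa [Matrix.trace] using h'⟩
  map_add' x y := by
    ext i j; simp
  map_smul' c x := by
    ext i j; simp

/-- The degree `k` component of `U₋ = U(L₋)` for its natural grading: the span of the products of
homogeneous elements of `L₋` whose degrees add up to `-k`. -/
def UMinus (k : ℕ) : Submodule ℂ U :=
  Submodule.span ℂ {u | ∃ l : List (ℕ × L), (∀ p ∈ l, 0 < p.1 ∧ p.2 ∈ gr (-(p.1 : ℤ))) ∧
    (l.map Prod.fst).sum = k ∧ u = (l.map fun p => toU p.2).prod}

/-- The odd element `dᵢⱼ = dxᵢ ∧ dxⱼ` of `L`. -/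
def d (i j : Fin 5) : L :=
  (0, ⟨fun a b => MvPowerSeries.C ((if a = i ∧ b = j then 1 else 0) -
    (if a = j ∧ b = i then 1 else 0) : ℂ), by
      refine ⟨fun a b => ?_, fun a b c => by simp only [pd, MvPowerSeries.pderiv_C, add_zero]⟩
      rw [← map_neg, neg_sub]
      simp only [and_comm]⟩)

/-! ### Generalized Verma modules and their morphisms -/

section Verma

variable (V : Type) [AddCommGroup V] [Module ℂ V] [LieRingModule sl5 V]

/-- The relations `u x ⊗ v = u ⊗ x v` for `u ∈ U`, `x ∈ L₀`, `v ∈ V`, where `V` is extended to an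
`L₀`-module by letting `L₊` act trivially. -/
def vermaRel : Submodule U (U ⊗[ℂ] V) :=
  Submodule.span U {t | ∃ x ∈ L0, ∃ v : V, t = toU x ⊗ₜ[ℂ] v - (1 : U) ⊗ₜ[ℂ] ⁅toG0 x, v⁆}

/-- The generalized Verma module `M(V) = U ⊗_{U₀} V`, a left `U`-module (`U₀ = U(L₀)` is generated
by `L₀`). -/
abbrev Verma : Type := (U ⊗[ℂ] V) ⧸ vermaRel V

variable {V}

/-- The element `u ⊗ v` of `M(V)`. -/
def tens (u : U) (v : V) : Verma V := (vermaRel V).mkQ (u ⊗ₜ[ℂ] v)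

variable {W : Type} [AddCommGroup W] [Module ℂ W] [LieRingModule sl5 W]

/-- The morphism `M(V) → M(W)`, `u ⊗ v ↦ u ⊗ f v`, induced by a morphism of `𝔤₀`-modules. -/
def Verma.map (f : V →ₗ⁅ℂ, sl5⁆ W) : Verma V →ₗ[U] Verma W :=
  (vermaRel V).mapQ (vermaRel W)
    (TensorProduct.AlgebraTensorModule.lTensor U U (f : V →ₗ[ℂ] W)) (by
      refine Submodule.span_le.2 ?_
      rintro _ ⟨x, hx, v, rfl⟩
      refine Submodule.subset_span ⟨x, hx, f v, ?_⟩
      simp)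

/-- A morphism `φ : M(V) → M(W)` has degree `k` if `φ (1 ⊗ v) = ∑ uᵢ ⊗ ℓᵢ(v)` for finitely many
`uᵢ ∈ U₋` of degree `k` and linear maps `ℓᵢ : V → W`. -/
def HasDegree (φ : Verma V →ₗ[U] Verma W) (k : ℕ) : Prop :=
  ∃ (r : ℕ) (u : Fin r → U) (l : Fin r → V →ₗ[ℂ] W), (∀ i, u i ∈ UMinus k) ∧
    ∀ v, φ (tens 1 v) = ∑ i, tens (u i) (l i v)

/-- The morphism `φ` of `M(V)` is given by the operator `∑ dᵢⱼ ⊗ θᵢⱼ`. -/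
def IsNabla (θ : Fin 5 → Fin 5 → V →ₗ[ℂ] V) (φ : Verma V →ₗ[U] Verma V) : Prop :=
  ∀ v, φ (tens 1 v) = ∑ i, ∑ j, tens (toU (d i j)) (θ i j v)

variable (V) in
/-- `V` is (isomorphic to) `F(n₁,n₂,n₃,n₄)`: it is a finite-dimensional irreducible `sl₅`-module
with a highest weight vector of weight `n` for the Borel subalgebra spanned by the `xᵢ ∂ⱼ`, `i < j`,
and the `hᵢ = xᵢ ∂ᵢ - xᵢ₊₁ ∂ᵢ₊₁`. -/
structure IsF [LieModule ℂ sl5 V] (n : Fin 4 → ℕ) : Prop where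
  finite : FiniteDimensional ℂ V
  irreducible : LieModule.IsIrreducible ℂ sl5 V
  highest : ∃ v : V, v ≠ 0 ∧
    (∀ (i j : Fin 5) (h : i < j), ⁅LieAlgebra.SpecialLinear.single i j h.ne (1 : ℂ), v⁆ = 0) ∧
    ∀ i : Fin 4, ⁅LieAlgebra.SpecialLinear.singleSubSingle i.castSucc i.succ (1 : ℂ), v⁆ =
      (n i : ℂ) • v

end Verma

/-! ### The `sl₅`-modules `S_A`, `S_B`, `S_C` -/

/-- Indices of the basis of `Λ²`. -/
abbrev Pair : Type := {p : Fin 5 × Fin 5 // p.1 < p.2}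

/-- Extension of a family indexed by `i < j` to a skew-symmetric family. -/
def skew {M : Type*} [AddCommGroup M] (f : Pair → M) (i j : Fin 5) : M :=
  if h : i < j then f ⟨(i, j), h⟩ else if h : j < i then -f ⟨(j, i), h⟩ else 0

/-- `S_A = S(ℂ⁵ + Λ²ℂ⁵)`, the polynomials in `zᵢ` and `xᵢⱼ`, `i < j`. -/
abbrev SA : Type := MvPolynomial (Fin 5 ⊕ Pair) ℂ

/-- `S_B = S(ℂ⁵ + ℂ⁵*)`, the polynomials in `zᵢ` and `zᵢ*`. -/
abbrev SB : Type := MvPolynomial (Fin 5 ⊕ Fin 5) ℂ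

/-- `S_C = S(Λ²ℂ⁵* + ℂ⁵*)`, the polynomials in `xᵢⱼ*`, `i < j`, and `zᵢ*`. -/
abbrev SC : Type := MvPolynomial (Pair ⊕ Fin 5) ℂ

/-- The variables `xᵢⱼ = -xⱼᵢ` of `S_A`. -/
def xA (i j : Fin 5) : SA := skew (fun p => MvPolynomial.X (Sum.inr p)) i j

/-- The variables `xᵢⱼ* = -xⱼᵢ*` of `S_C`. -/
def xC (i j : Fin 5) : SC := skew (fun p => MvPolynomial.X (Sum.inl p)) i j

theorem skew_symm {M : Type*} [AddCommGroup M] (f : Pair → M) (i j : Fin 5) :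
    skew f i j = -skew f j i := by
  unfold skew
  rcases lt_trichotomy i j with h | rfl | h
  · simp [h, h.not_gt]
  · simp
  · simp [h, h.not_gt]

/-- The action of a matrix on a basis `zₖ`: `M zₖ = ∑ᵢ Mᵢₖ zᵢ`. -/
def act1 {P : Type} [AddCommGroup P] [Module ℂ P] (z : Fin 5 → P)
    (M : Matrix (Fin 5) (Fin 5) ℂ) (k : Fin 5) : P :=
  ∑ i, M i k • z i

/-- The induced action on `xₖₗ = zₖ ∧ zₗ`: `M xₖₗ = ∑ᵢ (Mᵢₖ xᵢₗ + Mᵢₗ xₖᵢ)`. -/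
def act2 {P : Type} [AddCommGroup P] [Module ℂ P] (x : Fin 5 → Fin 5 → P)
    (M : Matrix (Fin 5) (Fin 5) ℂ) (k l : Fin 5) : P :=
  ∑ i, (M i k • x i l + M i l • x k i)

theorem act1_lie {P : Type} [AddCommGroup P] [Module ℂ P] (z : Fin 5 → P)
    (M N : Matrix (Fin 5) (Fin 5) ℂ) (D E : P →ₗ[ℂ] P) (hD : ∀ k, D (z k) = act1 z M k)
    (hE : ∀ k, E (z k) = act1 z N k) (k : Fin 5) :
    act1 z (M * N - N * M) k = D (act1 z N k) - E (act1 z M k) := by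
  have h : ∀ (M N : Matrix (Fin 5) (Fin 5) ℂ) (D : P →ₗ[ℂ] P),
      (∀ k, D (z k) = act1 z M k) → D (act1 z N k) = act1 z (M * N) k := by
    intro M N D hD
    simp only [act1, map_sum, map_smul, hD, Matrix.mul_apply, Finset.smul_sum, smul_smul,
      Finset.sum_smul]
    rw [Finset.sum_comm]
    simp only [mul_comm]
  rw [h M N D hD, h N M E hE]
  simp [act1, sub_smul]

theorem act2_lie {P : Type} [AddCommGroup P] [Module ℂ P] (x : Fin 5 → Fin 5 → P)
    (M N : Matrix (Fin 5) (Fin 5) ℂ) (D E : P →ₗ[ℂ] P) (hD : ∀ k l, D (x k l) = act2 x M k l)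
    (hE : ∀ k l, E (x k l) = act2 x N k l) (k l : Fin 5) :
    act2 x (M * N - N * M) k l = D (act2 x N k l) - E (act2 x M k l) := by
  have h : ∀ (M N : Matrix (Fin 5) (Fin 5) ℂ) (D : P →ₗ[ℂ] P),
      (∀ k l, D (x k l) = act2 x M k l) → D (act2 x N k l) = act2 x (M * N) k l +
        ∑ i, ∑ j, ((N i k * M j l) • x i j + (N j l * M i k) • x i j) := by
    intro M N D hD
    simp only [act2, map_sum, map_add, map_smul, hD, Matrix.mul_apply, Finset.smul_sum, smul_smul,
      Finset.sum_smul, smul_add, Finset.sum_add_distrib]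
    rw [Finset.sum_comm (f := fun i j => (N i k * M j i) • x j l),
      Finset.sum_comm (f := fun i j => (N i l * M j k) • x j i),
      Finset.sum_comm (f := fun i j => (N i l * M j i) • x k j)]
    simp only [mul_comm]
    abel
  rw [h M N D hD, h N M E hE]
  have h2 : ∑ i, ∑ j, ((N i k * M j l) • x i j + (N j l * M i k) • x i j) =
      ∑ i, ∑ j, ((M i k * N j l) • x i j + (M j l * N i k) • x i j) :=
    Finset.sum_congr rfl fun i _ => Finset.sum_congr rfl fun j _ => by
      rw [add_comm, mul_comm (N i k), mul_comm (N j l)]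
  rw [h2, add_sub_add_right_eq_sub]
  simp only [act2, Matrix.sub_apply, sub_smul, ← Finset.sum_sub_distrib]
  exact Finset.sum_congr rfl fun i _ => by abel

theorem act2_skew {P : Type} [AddCommGroup P] [Module ℂ P] (f : Pair → P)
    (M : Matrix (Fin 5) (Fin 5) ℂ) (D : P →ₗ[ℂ] P)
    (hD : ∀ p : Pair, D (f p) = act2 (skew f) M p.1.1 p.1.2) (k l : Fin 5) :
    D (skew f k l) = act2 (skew f) M k l := by
  have key : ∀ k l, act2 (skew f) M l k = -act2 (skew f) M k l := by
    intro k l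
    simp only [act2, ← Finset.sum_neg_distrib]
    refine Finset.sum_congr rfl fun i _ => ?_
    rw [skew_symm f i k, skew_symm f l i, smul_neg, smul_neg, neg_add, add_comm]
  rcases lt_trichotomy k l with h | rfl | h
  · rw [show skew f k l = f ⟨(k, l), h⟩ by simp [skew, h], hD]
  · have h0 : act2 (skew f) M k k = 0 := by
      have h1 : (2 : ℂ) • act2 (skew f) M k k = 0 := by
        rw [two_smul]
        exact add_eq_zero_iff_eq_neg.2 (key k k)
      exact (smul_eq_zero.1 h1).resolve_left two_ne_zero
    simp [h0, skew]
  · rw [show skew f k l = -f ⟨(l, k), h⟩ by simp [skew, h, h.not_gt], map_neg, hD, key l k]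

/-- The action of `sl₅` on polynomials by derivations which extends the action `g` on the variables. -/
abbrev polyLieRingModule {ι : Type} (g : sl5 →ₗ[ℂ] (ι → MvPolynomial ι ℂ))
    (hg : ∀ A B s, g ⁅A, B⁆ s =
      MvPolynomial.mkDerivation ℂ (g A) (g B s) - MvPolynomial.mkDerivation ℂ (g B) (g A s)) :
    LieRingModule sl5 (MvPolynomial ι ℂ) where
  bracket A f := MvPolynomial.mkDerivation ℂ (g A) f
  add_lie A B f := by
    have : MvPolynomial.mkDerivation ℂ (g (A + B)) =
        MvPolynomial.mkDerivation ℂ (g A) + MvPolynomial.mkDerivation ℂ (g B) :=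
      MvPolynomial.derivation_ext fun s => by simp
    change MvPolynomial.mkDerivation ℂ (g (A + B)) f = _
    rw [this]; rfl
  lie_add A f h := map_add _ f h
  leibniz_lie A B f := by
    have : MvPolynomial.mkDerivation ℂ (g ⁅A, B⁆) =
        ⁅MvPolynomial.mkDerivation ℂ (g A), MvPolynomial.mkDerivation ℂ (g B)⁆ :=
      MvPolynomial.derivation_ext fun s => by
        simp [Derivation.commutator_apply, hg]
    change _ = MvPolynomial.mkDerivation ℂ (g ⁅A, B⁆) f + _
    rw [this, Derivation.commutator_apply]
    exact (sub_add_cancel _ _).symm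


/-- The action of `A` on the variables of `S_A`. -/
def genA : sl5 →ₗ[ℂ] (Fin 5 ⊕ Pair → SA) where
  toFun A := Sum.elim (act1 (fun i => MvPolynomial.X (Sum.inl i)) A.1)
    (fun p => act2 xA A.1 p.1.1 p.1.2)
  map_add' A B := by
    ext1 s
    rcases s with k | p <;> simp only [Sum.elim_inl, Sum.elim_inr, act1, act2, Pi.add_apply,
      ← Finset.sum_add_distrib] <;> refine Finset.sum_congr rfl fun i _ => ?_
    · exact add_smul _ _ _
    · change (A.1 _ _ + B.1 _ _) • _ + (A.1 _ _ + B.1 _ _) • _ = _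
      rw [add_smul, add_smul]; abel
  map_smul' c A := by
    ext1 s
    rcases s with k | p <;> simp only [Sum.elim_inl, Sum.elim_inr, act1, act2, Pi.smul_apply,
      Finset.smul_sum, RingHom.id_apply, smul_add] <;> refine Finset.sum_congr rfl fun i _ => ?_
    · exact mul_smul _ _ _
    · exact congrArg₂ (· + ·) (mul_smul _ _ _) (mul_smul _ _ _)

/-- The action of `A` on the variables of `S_B`: `A` acts on the dual basis by `-Aᵀ`. -/
def genB : sl5 →ₗ[ℂ] (Fin 5 ⊕ Fin 5 → SB) where
  toFun A := Sum.elim (act1 (fun i => MvPolynomial.X (Sum.inl i)) A.1)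
    (act1 (fun i => MvPolynomial.X (Sum.inr i)) (-A.1.transpose))
  map_add' A B := by
    ext1 s
    rcases s with k | k <;> simp only [Sum.elim_inl, Sum.elim_inr, act1, Pi.add_apply,
      ← Finset.sum_add_distrib] <;> refine Finset.sum_congr rfl fun i _ => ?_
    · exact add_smul _ _ _
    · change (-(A.1 _ _ + B.1 _ _)) • _ = (-A.1 _ _) • _ + (-B.1 _ _) • _
      rw [neg_add, add_smul]
  map_smul' c A := by
    ext1 s
    rcases s with k | k <;> simp only [Sum.elim_inl, Sum.elim_inr, act1, Pi.smul_apply,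
      Finset.smul_sum, RingHom.id_apply] <;> refine Finset.sum_congr rfl fun i _ => ?_
    · exact mul_smul _ _ _
    · change (-(c * A.1 _ _)) • _ = c • (-A.1 _ _) • _
      rw [smul_smul, mul_neg]

/-- The action of `A` on the variables of `S_C`, through `-Aᵀ`. -/
def genC : sl5 →ₗ[ℂ] (Pair ⊕ Fin 5 → SC) where
  toFun A := Sum.elim (fun p => act2 xC (-A.1.transpose) p.1.1 p.1.2)
    (act1 (fun i => MvPolynomial.X (Sum.inr i)) (-A.1.transpose))
  map_add' A B := by
    ext1 s
    rcases s with k | k <;> simp only [Sum.elim_inl, Sum.elim_inr, act1, act2, Pi.add_apply,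
      ← Finset.sum_add_distrib] <;> refine Finset.sum_congr rfl fun i _ => ?_
    · change (-(A.1 _ _ + B.1 _ _)) • _ + (-(A.1 _ _ + B.1 _ _)) • _ =
        (-A.1 _ _) • _ + (-A.1 _ _) • _ + ((-B.1 _ _) • _ + (-B.1 _ _) • _)
      rw [neg_add, add_smul, neg_add, add_smul]; abel
    · change (-(A.1 _ _ + B.1 _ _)) • _ = (-A.1 _ _) • _ + (-B.1 _ _) • _
      rw [neg_add, add_smul]
  map_smul' c A := by
    ext1 s
    rcases s with k | k <;> simp only [Sum.elim_inl, Sum.elim_inr, act1, act2, Pi.smul_apply,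
      Finset.smul_sum, RingHom.id_apply, smul_add] <;> refine Finset.sum_congr rfl fun i _ => ?_
    · change (-(c * A.1 _ _)) • _ + (-(c * A.1 _ _)) • _ =
        c • (-A.1 _ _) • _ + c • (-A.1 _ _) • _
      rw [smul_smul, smul_smul, mul_neg, mul_neg]
    · change (-(c * A.1 _ _)) • _ = c • (-A.1 _ _) • _
      rw [smul_smul, mul_neg]

theorem neg_transpose_lie (A B : sl5) : -(⁅A, B⁆ : sl5).1.transpose =
    (-A.1.transpose) * (-B.1.transpose) - (-B.1.transpose) * (-A.1.transpose) := by
  rw [LieAlgebra.SpecialLinear.sl_bracket]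
  simp [Matrix.transpose_sub, Matrix.transpose_mul]

theorem genA_lie (A B : sl5) (s : Fin 5 ⊕ Pair) : genA ⁅A, B⁆ s =
    MvPolynomial.mkDerivation ℂ (genA A) (genA B s) -
      MvPolynomial.mkDerivation ℂ (genA B) (genA A s) := by
  have h1 : ∀ (A : sl5) k, genA A (Sum.inl k) = act1 (fun i => MvPolynomial.X (Sum.inl i)) A.1 k :=
    fun _ _ => rfl
  have h2 : ∀ (A : sl5) (p : Pair), genA A (Sum.inr p) = act2 xA A.1 p.1.1 p.1.2 := fun _ _ => rfl
  have h3 : ∀ (A : sl5) k l, (MvPolynomial.mkDerivation ℂ (genA A)).toLinearMap (xA k l) =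
      act2 xA A.1 k l := fun A => act2_skew _ _ _ fun p => by
    rw [Derivation.coeFn_coe, MvPolynomial.mkDerivation_X, h2]; rfl
  have h4 : ∀ (A : sl5) k, (MvPolynomial.mkDerivation ℂ (genA A)).toLinearMap
      (MvPolynomial.X (Sum.inl k)) = act1 (fun i => MvPolynomial.X (Sum.inl i)) A.1 k :=
    fun A k => by
      rw [Derivation.coeFn_coe, MvPolynomial.mkDerivation_X, h1]
  rcases s with k | p
  · rw [h1, h1, h1, LieAlgebra.SpecialLinear.sl_bracket]
    exact act1_lie _ _ _ _ _ (h4 A) (h4 B) k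
  · rw [h2, h2, h2, LieAlgebra.SpecialLinear.sl_bracket]
    exact act2_lie _ _ _ _ _ (h3 A) (h3 B) _ _

theorem genB_lie (A B : sl5) (s : Fin 5 ⊕ Fin 5) : genB ⁅A, B⁆ s =
    MvPolynomial.mkDerivation ℂ (genB A) (genB B s) -
      MvPolynomial.mkDerivation ℂ (genB B) (genB A s) := by
  have h1 : ∀ (A : sl5) k, genB A (Sum.inl k) = act1 (fun i => MvPolynomial.X (Sum.inl i)) A.1 k :=
    fun _ _ => rfl
  have h2 : ∀ (A : sl5) k, genB A (Sum.inr k) =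
      act1 (fun i => MvPolynomial.X (Sum.inr i)) (-A.1.transpose) k := fun _ _ => rfl
  have h3 : ∀ (A : sl5) k, (MvPolynomial.mkDerivation ℂ (genB A)).toLinearMap
      (MvPolynomial.X (Sum.inr k)) =
        act1 (fun i => MvPolynomial.X (Sum.inr i)) (-A.1.transpose) k := fun A k => by
    rw [Derivation.coeFn_coe, MvPolynomial.mkDerivation_X, h2]
  have h4 : ∀ (A : sl5) k, (MvPolynomial.mkDerivation ℂ (genB A)).toLinearMap
      (MvPolynomial.X (Sum.inl k)) = act1 (fun i => MvPolynomial.X (Sum.inl i)) A.1 k :=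
    fun A k => by
      rw [Derivation.coeFn_coe, MvPolynomial.mkDerivation_X, h1]
  rcases s with k | k
  · rw [h1, h1, h1, LieAlgebra.SpecialLinear.sl_bracket]
    exact act1_lie _ _ _ _ _ (h4 A) (h4 B) k
  · rw [h2, h2, h2, neg_transpose_lie]
    exact act1_lie _ _ _ _ _ (h3 A) (h3 B) k

theorem genC_lie (A B : sl5) (s : Pair ⊕ Fin 5) : genC ⁅A, B⁆ s =
    MvPolynomial.mkDerivation ℂ (genC A) (genC B s) -
      MvPolynomial.mkDerivation ℂ (genC B) (genC A s) := by
  have h1 : ∀ (A : sl5) k, genC A (Sum.inr k) =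
      act1 (fun i => MvPolynomial.X (Sum.inr i)) (-A.1.transpose) k := fun _ _ => rfl
  have h2 : ∀ (A : sl5) (p : Pair), genC A (Sum.inl p) =
      act2 xC (-A.1.transpose) p.1.1 p.1.2 := fun _ _ => rfl
  have h3 : ∀ (A : sl5) k l, (MvPolynomial.mkDerivation ℂ (genC A)).toLinearMap (xC k l) =
      act2 xC (-A.1.transpose) k l := fun A => act2_skew _ _ _ fun p => by
    rw [Derivation.coeFn_coe, MvPolynomial.mkDerivation_X, h2]; rfl
  have h4 : ∀ (A : sl5) k, (MvPolynomial.mkDerivation ℂ (genC A)).toLinearMap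
      (MvPolynomial.X (Sum.inr k)) =
        act1 (fun i => MvPolynomial.X (Sum.inr i)) (-A.1.transpose) k := fun A k => by
    rw [Derivation.coeFn_coe, MvPolynomial.mkDerivation_X, h1]
  rcases s with p | k
  · rw [h2, h2, h2, neg_transpose_lie]
    exact act2_lie _ _ _ _ _ (h3 A) (h3 B) _ _
  · rw [h1, h1, h1, neg_transpose_lie]
    exact act1_lie _ _ _ _ _ (h4 A) (h4 B) k

instance : LieRingModule sl5 SA := polyLieRingModule genA genA_lie

instance : LieRingModule sl5 SB := polyLieRingModule genB genB_lie

instance : LieRingModule sl5 SC := polyLieRingModule genC genC_lie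

theorem mkDerivation_smul {ι : Type} (g : sl5 →ₗ[ℂ] (ι → MvPolynomial ι ℂ)) (c : ℂ) (A : sl5)
    (f : MvPolynomial ι ℂ) : MvPolynomial.mkDerivation ℂ (g (c • A)) f =
      c • MvPolynomial.mkDerivation ℂ (g A) f := by
  have : MvPolynomial.mkDerivation ℂ (g (c • A)) = c • MvPolynomial.mkDerivation ℂ (g A) :=
    MvPolynomial.derivation_ext fun s => by simp
  rw [this]; rfl

instance : LieModule ℂ sl5 SA where
  smul_lie c A f := mkDerivation_smul genA c A f
  lie_smul c A f := Derivation.map_smul (MvPolynomial.mkDerivation ℂ (genA A)) c f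

instance : LieModule ℂ sl5 SB where
  smul_lie c A f := mkDerivation_smul genB c A f
  lie_smul c A f := Derivation.map_smul (MvPolynomial.mkDerivation ℂ (genB A)) c f

instance : LieModule ℂ sl5 SC where
  smul_lie c A f := mkDerivation_smul genC c A f
  lie_smul c A f := Derivation.map_smul (MvPolynomial.mkDerivation ℂ (genC A)) c f

/-! ### The modules `V_A`, `V_B`, `V_C` and the operators `θᵢⱼ` -/

/-- In a polynomial ring in two groups of variables, the polynomials which are homogeneous of
degree `m` in the first group and of degree `n` in the second one, i.e. `SᵐE ⊗ SⁿF`. -/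
def bihom {σ τ : Type} (m n : ℕ) : Submodule ℂ (MvPolynomial (σ ⊕ τ) ℂ) :=
  MvPolynomial.weightedHomogeneousSubmodule ℂ
    (Sum.elim (fun _ => ((1 : ℕ), (0 : ℕ))) (fun _ => ((0 : ℕ), (1 : ℕ)))) (m, n)

/-- Given the submodule `H` of `SᵐE ⊗ SⁿF`, the sum of all submodules of `SᵐE ⊗ SⁿF` meeting `H`
trivially. For `H` the highest component, which has multiplicity one, this is the invariant
complement of `H`. -/
def lowPart {σ τ : Type} [LieRingModule sl5 (MvPolynomial (σ ⊕ τ) ℂ)] (m n : ℕ)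
    (H : LieSubmodule ℂ sl5 (MvPolynomial (σ ⊕ τ) ℂ)) :
    LieSubmodule ℂ sl5 (MvPolynomial (σ ⊕ τ) ℂ) :=
  sSup {N | N.toSubmodule ≤ bihom m n ∧ Disjoint N H}

/-- The highest component of `Sᵐ(ℂ⁵) ⊗ Sⁿ(Λ²ℂ⁵)`: the submodule generated by the highest weight
vector `z₁ᵐ x₁₂ⁿ` of the tensor product. -/
def highA (m n : ℕ) : LieSubmodule ℂ sl5 SA :=
  LieSubmodule.lieSpan ℂ sl5 {MvPolynomial.X (Sum.inl 0) ^ m * xA 0 1 ^ n}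

/-- The highest component of `Sᵐ(ℂ⁵) ⊗ Sⁿ(ℂ⁵*)`, generated by `z₁ᵐ (z₅*)ⁿ`. -/
def highB (m n : ℕ) : LieSubmodule ℂ sl5 SB :=
  LieSubmodule.lieSpan ℂ sl5 {MvPolynomial.X (Sum.inl 0) ^ m * MvPolynomial.X (Sum.inr 4) ^ n}

/-- The highest component of `Sᵐ(Λ²ℂ⁵*) ⊗ Sⁿ(ℂ⁵*)`, generated by `(x₄₅*)ᵐ (z₅*)ⁿ`. -/
def highC (m n : ℕ) : LieSubmodule ℂ sl5 SC :=
  LieSubmodule.lieSpan ℂ sl5 {xC 3 4 ^ m * MvPolynomial.X (Sum.inr 4) ^ n}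

/-- `S_{B,low}`, the invariant complement of `S_{B,high}` in `S_B`. -/
def lowB : LieSubmodule ℂ sl5 SB := ⨆ m, ⨆ n, lowPart m n (highB m n)

/-- `S_{C,low}`, the invariant complement of `S_{C,high}` in `S_C`. -/
def lowC : LieSubmodule ℂ sl5 SC := ⨆ m, ⨆ n, lowPart m n (highC m n)

/-- `V_A = S_{A,high}`. -/
def VA : LieSubmodule ℂ sl5 SA := ⨆ m, ⨆ n, highA m n

/-- `V_B = S_B / S_{B,low}`. -/
abbrev VB : Type := SB ⧸ lowB

/-- `V_C = S_C / S_{C,low}`. -/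
abbrev VC : Type := SC ⧸ lowC

/-- The summand `F(m,n,0,0)` of `V_A`. -/
def partA (m n : ℕ) : LieSubmodule ℂ sl5 VA := (highA m n).comap VA.incl

/-- The summand `F(m,0,0,n)` of `V_B`. -/
def partB (m n : ℕ) : LieSubmodule ℂ sl5 VB := (highB m n).map (LieSubmodule.Quotient.mk' lowB)

/-- The summand `F(0,0,m,n)` of `V_C`. -/
def partC (m n : ℕ) : LieSubmodule ℂ sl5 VC := (highC m n).map (LieSubmodule.Quotient.mk' lowC)

/-- `θᴬᵢⱼ = d/dxᵢⱼ`, where `d/dxⱼᵢ = -d/dxᵢⱼ`. -/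
def thetaA (i j : Fin 5) : SA →ₗ[ℂ] SA :=
  skew (fun p => (MvPolynomial.pderiv (Sum.inr p) : Derivation ℂ SA SA).toLinearMap) i j

/-- `θᴮᵢⱼ = zᵢ* d/dzⱼ - zⱼ* d/dzᵢ`. -/
def thetaB (i j : Fin 5) : SB →ₗ[ℂ] SB :=
  LinearMap.mulLeft ℂ (MvPolynomial.X (Sum.inr i)) ∘ₗ
      (MvPolynomial.pderiv (Sum.inl j) : Derivation ℂ SB SB).toLinearMap -
    LinearMap.mulLeft ℂ (MvPolynomial.X (Sum.inr j)) ∘ₗ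
      (MvPolynomial.pderiv (Sum.inl i) : Derivation ℂ SB SB).toLinearMap

/-- `θᶜᵢⱼ` is the multiplication by `xᵢⱼ*`. -/
def thetaC (i j : Fin 5) : SC →ₗ[ℂ] SC := LinearMap.mulLeft ℂ (xC i j)

end

end E510

/-!
A linear map `v ↦ ∑ dᵢⱼ ⊗ θᵢⱼ v` from `V` to `M(V)` extends to a morphism `∇` of `M(V)` as soon as
the subalgebra `L₀` acts on these elements as it acts on `1 ⊗ v`. For the even part of `L₀` this
is the `sl₅`-equivariance of the family `θ`. For an odd element `w` of `L₀`, whose degree is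
positive, it is the relation `∑ [w, dᵢⱼ]₀ θᵢⱼ = 0`, where only the part of degree zero of the
bracket matters, hence only the linear part of `w`. This is `exists_isNabla`. The relation is
checked against the closedness of `w` in `sum_lie_mem`.

Whether `∇` vanishes on a summand is decided by the operators `θᵢⱼ` alone
(`isNabla_comp_eq_zero_iff`), because the elements `dᵢⱼ ⊗ v` with `i < j` are as independent in
`M(V)` as they look (`eq_of_sum_tens_eq_zero`). Instead of the Poincaré-Birkhoff-Witt theorem,
this uses a realization of `L` on `U(L₋) ⊗ V`: the action of `x ∈ L` on `u ⊗ v` is defined by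
commuting `x` past the factors of `u`, i.e. by making `Hom(L, U(L₋) ⊗ V)` an `L₋`-module, and the
Jacobi identity shows that it is an action (`indHom_indHom`). The coefficient of `dᵢⱼ` is then
read off by a homomorphism from `U(L₋)` to the dual numbers.

The three polynomial rings are treated alike through `UnitaryAction`. The Fischer inner product
makes the action unitary, so that orthogonal complements are submodules, and the highest monomial
is determined, among the monomials of its bidegree, by its weight. A submodule of one bidegree
therefore contains the highest component or is orthogonal to it (`high_le_or_le_orth`). This gives
the irreducibility of the highest components, the identification of their complements with
orthogonal complements, and the direct sum decompositions.

For `X = B` the odd relation holds in `S_B`. For `X = A` and `X = C` it holds because of the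
Plücker relations: the substitution `zₖ ↦ pₖ`, `xₖₗ ↦ pₖ qₗ - pₗ qₖ` is equivariant and does not
kill the highest monomials, so that its kernel, which contains these relations, is orthogonal to
the highest components. In the quotient `V_C` the relations become zero, and on `V_A` the adjoint
differential operators are zero. That `θᴮ` and `θᶜ` preserve the complements follows from the fact
that their adjoints preserve the sum of the highest components, which by equivariance has to be
verified on the highest monomials only.
-/

namespace E510

noncomputable section

/-! ### The sign `ε` and the product of two-forms -/

theorem eps_perm_sign (i j k l m : Fin 5) (s : Equiv.Perm (Fin 5))
    (i' j' k' l' m' : Fin 5) (h : ![i', j', k', l', m'] = ![i, j, k, l, m] ∘ s) :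
    eps i' j' k' l' m' = (Equiv.Perm.sign s : ℤ) * eps i j k l m := by
  unfold eps
  by_cases hb : Function.Bijective ![i, j, k, l, m]
  · have hb' : Function.Bijective ![i', j', k', l', m'] := h ▸ hb.comp s.bijective
    rw [dif_pos hb, dif_pos hb']
    have : Equiv.ofBijective _ hb' = s.trans (Equiv.ofBijective _ hb) := by
      ext x
      simp [h]
    rw [this, Equiv.Perm.sign_trans, mul_comm]
    push_cast
    ring
  · have hb' : ¬ Function.Bijective ![i', j', k', l', m'] := by
      rw [h]
      exact fun h' => hb ((Function.Bijective.of_comp_iff _ s.bijective).1 h')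
    rw [dif_neg hb, dif_neg hb', mul_zero]

theorem eps_eq_zero (i j k l m : Fin 5) (h : ¬ Function.Injective ![i, j, k, l, m]) :
    eps i j k l m = 0 := dif_neg fun hb => h hb.1

/-- Translation of the indices modulo `5` is a power of a `5`-cycle, hence even. -/
theorem eps_translate (a i j k l m : Fin 5) :
    eps (a + i) (a + j) (a + k) (a + l) (a + m) = eps i j k l m := by
  have hs : ∀ a : Fin 5, Equiv.Perm.sign (Equiv.addLeft a) = 1 := by decide
  have e : ![a + i, a + j, a + k, a + l, a + m] = Equiv.addLeft a ∘ ![i, j, k, l, m] := by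
    ext x; fin_cases x <;> rfl
  unfold eps
  by_cases hb : Function.Bijective ![i, j, k, l, m]
  · have hb' : Function.Bijective ![a + i, a + j, a + k, a + l, a + m] :=
      e ▸ (Equiv.addLeft a).bijective.comp hb
    rw [dif_pos hb, dif_pos hb']
    have : Equiv.ofBijective _ hb' = (Equiv.ofBijective _ hb).trans (Equiv.addLeft a) := by
      ext x
      simp [e]
    rw [this, Equiv.Perm.sign_trans, hs, one_mul]
  · have hb' : ¬ Function.Bijective ![a + i, a + j, a + k, a + l, a + m] := by
      rw [e]
      exact fun h' => hb ((Function.Bijective.of_comp_iff' (Equiv.addLeft a).bijective _).1 h')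
    rw [dif_neg hb, dif_neg hb']

/-- The sign `ε` in terms of the number of inversions, a form suited to evaluation. -/
def epsTab (i j k l m : Fin 5) : ℤ :=
  if [i, j, k, l, m].Nodup then
    (∏ a, ∏ b ∈ Finset.Ioi a, if ![i, j, k, l, m] a < ![i, j, k, l, m] b then 1 else -1) else 0

theorem eps_eq (i j k l m : Fin 5) : eps i j k l m = epsTab i j k l m := by
  have hn : [i, j, k, l, m].Nodup ↔ Function.Injective ![i, j, k, l, m] := by
    rw [← List.nodup_ofFn]; simp [List.ofFn_succ]
  unfold epsTab
  split_ifs with h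
  · have hb : Function.Bijective ![i, j, k, l, m] := Finite.injective_iff_bijective.1 (hn.1 h)
    rw [eps, dif_pos hb, Equiv.Perm.sign_eq_prod_prod_Ioi]
    simp only [Units.coe_prod, apply_ite Units.val, Units.val_one, Units.val_neg]
    rfl
  · exact eps_eq_zero _ _ _ _ _ (fun h' => h (hn.2 h'))

/-- The even permutations of `1, 2, 3, 4`. -/
def epsPos : Finset (Fin 5 × Fin 5 × Fin 5 × Fin 5) :=
  {(1, 2, 3, 4), (1, 3, 4, 2), (1, 4, 2, 3), (2, 1, 4, 3), (2, 3, 1, 4), (2, 4, 3, 1),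
   (3, 1, 2, 4), (3, 2, 4, 1), (3, 4, 1, 2), (4, 1, 3, 2), (4, 2, 1, 3), (4, 3, 2, 1)}

/-- The odd permutations of `1, 2, 3, 4`. -/
def epsNeg : Finset (Fin 5 × Fin 5 × Fin 5 × Fin 5) :=
  {(1, 2, 4, 3), (1, 3, 2, 4), (1, 4, 3, 2), (2, 1, 3, 4), (2, 3, 4, 1), (2, 4, 1, 3),
   (3, 1, 4, 2), (3, 2, 1, 4), (3, 4, 2, 1), (4, 1, 2, 3), (4, 2, 3, 1), (4, 3, 1, 2)}

/-- Contraction with `ε` as a signed sum over the permutations of `1, 2, 3, 4`. Translating the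
indices by the free index `i` gives one formula for all `i`. -/
theorem sum_eps {M : Type*} [AddCommGroup M] (i : Fin 5)
    (F : Fin 5 → Fin 5 → Fin 5 → Fin 5 → M) :
    ∑ j, ∑ k, ∑ l, ∑ m, eps i j k l m • F j k l m =
      ∑ p ∈ epsPos, F (i + p.1) (i + p.2.1) (i + p.2.2.1) (i + p.2.2.2) -
      ∑ p ∈ epsNeg, F (i + p.1) (i + p.2.1) (i + p.2.2.1) (i + p.2.2.2) := by
  have h : ∀ p : Fin 5 × Fin 5 × Fin 5 × Fin 5, epsTab 0 p.1 p.2.1 p.2.2.1 p.2.2.2 =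
      (if p ∈ epsPos then 1 else 0) - (if p ∈ epsNeg then 1 else 0) := by decide +kernel
  have h2 : ∑ j, ∑ k, ∑ l, ∑ m, eps i j k l m • F j k l m =
      ∑ j, ∑ k, ∑ l, ∑ m, eps 0 j k l m • F (i + j) (i + k) (i + l) (i + m) := by
    rw [← Equiv.sum_comp (Equiv.addLeft i)]
    refine Finset.sum_congr rfl fun j _ => ?_
    rw [← Equiv.sum_comp (Equiv.addLeft i)]
    refine Finset.sum_congr rfl fun k _ => ?_
    rw [← Equiv.sum_comp (Equiv.addLeft i)]
    refine Finset.sum_congr rfl fun l _ => ?_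
    rw [← Equiv.sum_comp (Equiv.addLeft i)]
    refine Finset.sum_congr rfl fun m _ => ?_
    simp only [Equiv.coe_addLeft]
    rw [← eps_translate i 0, add_zero]
  rw [h2]
  simp only [← Fintype.sum_prod_type', eps_eq, h, sub_smul, ite_smul, one_smul, zero_smul,
    Finset.sum_sub_distrib, Finset.sum_ite_mem, Finset.univ_inter]

/-- The components of `v ∧ w`. Indices are modulo `5`, so that one formula covers all components. -/
theorem wedge_apply (v w : Omega2cl) (i : Fin 5) :
    wedge v.1 w.1 i = v.1 (i + 1) (i + 2) * w.1 (i + 3) (i + 4)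
      - v.1 (i + 1) (i + 3) * w.1 (i + 2) (i + 4) + v.1 (i + 1) (i + 4) * w.1 (i + 2) (i + 3)
      + v.1 (i + 3) (i + 4) * w.1 (i + 1) (i + 2)
      - v.1 (i + 2) (i + 4) * w.1 (i + 1) (i + 3) + v.1 (i + 2) (i + 3) * w.1 (i + 1) (i + 4) := by
  have hv := v.2.1
  have hw := w.2.1
  rw [wedge, sum_eps]
  simp only [epsPos, epsNeg]
  repeat rw [Finset.sum_insert (by decide)]
  rw [Finset.sum_singleton, Finset.sum_singleton]
  dsimp only
  rw [hv (i + 2) (i + 1), hv (i + 3) (i + 1), hv (i + 3) (i + 2), hv (i + 4) (i + 1),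
    hv (i + 4) (i + 2), hv (i + 4) (i + 3), hw (i + 2) (i + 1), hw (i + 3) (i + 1),
    hw (i + 3) (i + 2), hw (i + 4) (i + 1), hw (i + 4) (i + 2), hw (i + 4) (i + 3)]
  refine (smul_right_injective FPS (by norm_num : (4 : ℂ) ≠ 0)) ?_
  dsimp only
  rw [smul_smul, mul_one_div_cancel (by norm_num), one_smul]
  rw [show (4 : ℂ) = ((4 : ℕ) : ℂ) by norm_num, Nat.cast_smul_eq_nsmul, nsmul_eq_mul]
  push_cast
  ring

theorem omega_self (w : Omega2cl) (i : Fin 5) : w.1 i i = 0 := by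
  have h : (2 : ℂ) • w.1 i i = 0 := by
    rw [two_smul]
    exact add_eq_zero_iff_eq_neg.2 (w.2.1 i i)
  exact (smul_eq_zero.1 h).resolve_left two_ne_zero

/-- The cyclic sum of the contractions of `w` with the vector field `u ∧ v` vanishes: it is dual to the
contraction of the six-form `u ∧ v ∧ w`, which is zero in dimension `5`, with `∂ⱼ`. -/
theorem wedge_contract (u v w : Omega2cl) (j : Fin 5) :
    ∑ k, (wedge u.1 v.1 k * w.1 k j + wedge v.1 w.1 k * u.1 k j +
      wedge w.1 u.1 k * v.1 k j) = 0 := by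
  simp only [wedge_apply]
  rw [← Equiv.sum_comp (Equiv.addLeft j), Fin.sum_univ_five]
  simp only [Equiv.coe_addLeft, add_assoc, Fin.reduceAdd, add_zero]
  have e : ∀ (w : Omega2cl), w.1 (j + 1) j = - w.1 j (j + 1) ∧ w.1 (j + 2) j = - w.1 j (j + 2) ∧
    w.1 (j + 3) j = - w.1 j (j + 3) ∧ w.1 (j + 4) j = - w.1 j (j + 4) ∧
    w.1 (j + 2) (j + 1) = - w.1 (j + 1) (j + 2) ∧ w.1 (j + 3) (j + 1) = - w.1 (j + 1) (j + 3) ∧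
    w.1 (j + 4) (j + 1) = - w.1 (j + 1) (j + 4) ∧ w.1 (j + 3) (j + 2) = - w.1 (j + 2) (j + 3) ∧
    w.1 (j + 4) (j + 2) = - w.1 (j + 2) (j + 4) ∧ w.1 (j + 4) (j + 3) = - w.1 (j + 3) (j + 4) :=
    fun w => ⟨w.2.1 _ _, w.2.1 _ _, w.2.1 _ _, w.2.1 _ _, w.2.1 _ _, w.2.1 _ _, w.2.1 _ _,
      w.2.1 _ _, w.2.1 _ _, w.2.1 _ _⟩
  simp only [e, omega_self]
  ring

/-! ### Lie derivatives and the Jacobi identities -/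

/-- The derivation `f ↦ ∑ Xⱼ ∂ⱼ f` given by a vector field. -/
def along (X : Fin 5 → FPS) : Derivation ℂ FPS FPS := ∑ j, X j • pd j

theorem along_apply (X : Fin 5 → FPS) (f : FPS) : along X f = ∑ j, X j * pd j f := by
  have h := congrFun (map_sum (Derivation.coeFnAddMonoidHom (R := ℂ) (A := FPS) (M := FPS))
    (fun j => X j • pd j) Finset.univ) f
  rw [Finset.sum_apply] at h
  exact h

theorem vfBracket_apply (X Y : Fin 5 → FPS) (i : Fin 5) :
    vfBracket X Y i = along X (Y i) - along Y (X i) := by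
  simp only [vfBracket, along_apply, Finset.sum_sub_distrib]

theorem lieDeriv_apply (X : Fin 5 → FPS) (w : Fin 5 → Fin 5 → FPS) (i j : Fin 5) :
    lieDeriv X w i j =
      along X (w i j) + ∑ k, (pd i (X k) * w k j + pd j (X k) * w i k) := by
  simp only [lieDeriv, along_apply, ← Finset.sum_add_distrib, add_assoc]

theorem pd_along (i : Fin 5) (X : Fin 5 → FPS) (f : FPS) :
    pd i (along X f) = along X (pd i f) + ∑ k, pd i (X k) * pd k f := by
  simp only [along_apply, map_sum, Derivation.leibniz, smul_eq_mul, ← Finset.sum_add_distrib]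
  refine Finset.sum_congr rfl fun k _ => ?_
  rw [pd_comm i k]; ring

theorem along_vfBracket (X Y : Fin 5 → FPS) (f : FPS) :
    along (vfBracket X Y) f = along X (along Y f) - along Y (along X f) := by
  have h : ∀ X Y : Fin 5 → FPS, along X (along Y f) =
      ∑ j, along X (Y j) * pd j f + ∑ j, Y j * along X (pd j f) := by
    intro X Y
    rw [along_apply Y, map_sum, ← Finset.sum_add_distrib]
    refine Finset.sum_congr rfl fun j _ => ?_
    rw [Derivation.leibniz, smul_eq_mul, smul_eq_mul]; ring
  have h2 : ∑ j, Y j * along X (pd j f) = ∑ j, X j * along Y (pd j f) := by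
    simp only [along_apply, Finset.mul_sum]
    rw [Finset.sum_comm]
    refine Finset.sum_congr rfl fun j _ => Finset.sum_congr rfl fun k _ => ?_
    rw [pd_comm]; ring
  rw [h X Y, h Y X, h2, along_apply]
  simp only [vfBracket_apply, sub_mul, Finset.sum_sub_distrib]
  ring

theorem vfBracket_jacobi (X Y Z : Fin 5 → FPS) :
    vfBracket X (vfBracket Y Z) = vfBracket (vfBracket X Y) Z + vfBracket Y (vfBracket X Z) := by
  ext1 i
  simp only [Pi.add_apply, vfBracket_apply _ _ i, along_vfBracket, map_sub]
  ring

theorem lieDeriv_vfBracket (X Y : Fin 5 → FPS) (w : Fin 5 → Fin 5 → FPS) :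
    lieDeriv X (lieDeriv Y w) = lieDeriv (vfBracket X Y) w + lieDeriv Y (lieDeriv X w) := by
  ext1 i; ext1 j
  simp only [Pi.add_apply, lieDeriv_apply _ _, along_vfBracket, map_add, map_sub,
    Derivation.leibniz, smul_eq_mul, vfBracket_apply, pd_along, Fin.sum_univ_five]
  ring

/-- The Lie derivative is a derivation of the product of two-forms. The identification of four-forms
with vector fields is equivariant because `X` has divergence zero. -/
theorem vfBracket_wedge (X : S5) (v w : Omega2cl) :
    vfBracket X.1 (wedge v.1 w.1) =
      wedge (lieDeriv X.1 v.1) w.1 + wedge v.1 (lieDeriv X.1 w.1) := by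
  have hX : ∑ i, pd i (X.1 i) = 0 := X.2
  ext1 i
  have h1 := wedge_apply (brEO X v) w i
  have h2 := wedge_apply v (brEO X w) i
  change wedge (lieDeriv X.1 v.1) w.1 i = _ at h1
  change wedge v.1 (lieDeriv X.1 w.1) i = _ at h2
  rw [Pi.add_apply, h1, h2, vfBracket_apply]
  have e : ∀ (w : Omega2cl), w.1 (i + 1) i = - w.1 i (i + 1) ∧ w.1 (i + 2) i = - w.1 i (i + 2) ∧
    w.1 (i + 3) i = - w.1 i (i + 3) ∧ w.1 (i + 4) i = - w.1 i (i + 4) ∧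
    w.1 (i + 2) (i + 1) = - w.1 (i + 1) (i + 2) ∧ w.1 (i + 3) (i + 1) = - w.1 (i + 1) (i + 3) ∧
    w.1 (i + 4) (i + 1) = - w.1 (i + 1) (i + 4) ∧ w.1 (i + 3) (i + 2) = - w.1 (i + 2) (i + 3) ∧
    w.1 (i + 4) (i + 2) = - w.1 (i + 2) (i + 4) ∧ w.1 (i + 4) (i + 3) = - w.1 (i + 3) (i + 4) :=
    fun w => ⟨w.2.1 _ _, w.2.1 _ _, w.2.1 _ _, w.2.1 _ _, w.2.1 _ _, w.2.1 _ _, w.2.1 _ _,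
      w.2.1 _ _, w.2.1 _ _, w.2.1 _ _⟩
  have hs : ∀ F : Fin 5 → FPS, ∑ k, F k = F i + F (i + 1) + F (i + 2) + F (i + 3) + F (i + 4) := by
    intro F
    rw [← Equiv.sum_comp (Equiv.addLeft i), Fin.sum_univ_five]
    simp
  rw [along_apply (wedge v.1 w.1)]
  simp only [brEO, lieDeriv_apply, wedge_apply, map_add, map_sub, Derivation.leibniz, smul_eq_mul]
  rw [hs] at hX
  simp only [hs]
  simp only [add_assoc, Fin.reduceAdd, add_zero]
  simp only [e, omega_self]
  linear_combination (-wedge v.1 w.1 i) * hX + (pd i (X.1 i) + pd (i + 1) (X.1 (i + 1)) +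
    pd (i + 2) (X.1 (i + 2)) + pd (i + 3) (X.1 (i + 3)) + pd (i + 4) (X.1 (i + 4))) *
    wedge_apply v w i

/-- The Jacobi identity for three odd elements. -/
theorem lieDeriv_wedge (u v w : Omega2cl) :
    lieDeriv (wedge u.1 v.1) w.1 + lieDeriv (wedge v.1 w.1) u.1 +
      lieDeriv (wedge w.1 u.1) v.1 = 0 := by
  -- Cartan's formula `L_Z ω = d (i_Z ω)` for closed `ω`
  have hc : ∀ (Z : Fin 5 → FPS) (w : Omega2cl) i j, lieDeriv Z w.1 i j =
      pd i (∑ k, Z k * w.1 k j) - pd j (∑ k, Z k * w.1 k i) := by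
    intro Z w i j
    simp only [lieDeriv, map_sum, Derivation.leibniz, smul_eq_mul, ← Finset.sum_sub_distrib]
    refine Finset.sum_congr rfl fun k _ => ?_
    have h := w.2.2 i j k
    rw [w.2.1 j k, map_neg] at h
    rw [w.2.1 i k]
    linear_combination Z k * h
  ext1 i; ext1 j
  have h1 := congrArg (pd i) (wedge_contract u v w j)
  have h2 := congrArg (pd j) (wedge_contract u v w i)
  simp only [Finset.sum_add_distrib, map_add, map_zero] at h1 h2
  simp only [Pi.add_apply, hc, Pi.zero_apply]
  linear_combination h1 - h2

/-! ### The super bracket of `L` -/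

theorem vfBracket_skew (X Y : Fin 5 → FPS) : vfBracket X Y = -vfBracket Y X := by
  ext1 i
  rw [Pi.neg_apply, vfBracket_apply, vfBracket_apply, neg_sub]

theorem along_add (X Y : Fin 5 → FPS) (f : FPS) : along (X + Y) f = along X f + along Y f := by
  simp [along_apply, add_mul, Finset.sum_add_distrib]

theorem along_smul (c : ℂ) (X : Fin 5 → FPS) (f : FPS) : along (c • X) f = c • along X f := by
  simp [along_apply, Finset.smul_sum]

theorem wedge_comm (v w : Omega2cl) : wedge v.1 w.1 = wedge w.1 v.1 := by
  ext1 i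
  rw [wedge_apply, wedge_apply]
  ring

/-- The super bracket of `L` as a bilinear map. -/
def brL : L →ₗ[ℂ] L →ₗ[ℂ] L :=
  LinearMap.mk₂ ℂ (fun x y => (brEE x.1 y.1 + brOO x.2 y.2, brEO x.1 y.2 - brEO y.1 x.2))
    (fun x x' y => by
      refine Prod.ext (Subtype.ext (funext fun i => ?_))
        (Subtype.ext (funext fun i => funext fun j => ?_))
      · have h := wedge_apply (x.2 + x'.2) y.2 i
        change vfBracket (x.1.1 + x'.1.1) y.1.1 i + wedge (x.2.1 + x'.2.1) y.2.1 i =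
          (vfBracket x.1.1 y.1.1 i + wedge x.2.1 y.2.1 i) +
            (vfBracket x'.1.1 y.1.1 i + wedge x'.2.1 y.2.1 i)
        change wedge (x.2.1 + x'.2.1) y.2.1 i = _ at h
        rw [h]
        simp only [wedge_apply, vfBracket_apply, along_add, Pi.add_apply, map_add,
          Submodule.coe_add]
        ring
      · change lieDeriv (x.1.1 + x'.1.1) y.2.1 i j - lieDeriv y.1.1 (x.2.1 + x'.2.1) i j =
          (lieDeriv x.1.1 y.2.1 i j - lieDeriv y.1.1 x.2.1 i j) +
            (lieDeriv x'.1.1 y.2.1 i j - lieDeriv y.1.1 x'.2.1 i j)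
        simp only [lieDeriv, Pi.add_apply, map_add, add_mul, mul_add, Finset.sum_add_distrib]
        ring)
    (fun c x y => by
      refine Prod.ext (Subtype.ext (funext fun i => ?_))
        (Subtype.ext (funext fun i => funext fun j => ?_))
      · have h := wedge_apply (c • x.2) y.2 i
        change vfBracket (c • x.1.1) y.1.1 i + wedge (c • x.2.1) y.2.1 i =
          c • (vfBracket x.1.1 y.1.1 i + wedge x.2.1 y.2.1 i)
        change wedge (c • x.2.1) y.2.1 i = _ at h
        rw [h]
        simp only [wedge_apply, vfBracket_apply, along_smul, Pi.smul_apply, Derivation.map_smul,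
          Submodule.coe_smul, smul_mul_assoc, smul_add, smul_sub]
      · change lieDeriv (c • x.1.1) y.2.1 i j - lieDeriv y.1.1 (c • x.2.1) i j =
          c • (lieDeriv x.1.1 y.2.1 i j - lieDeriv y.1.1 x.2.1 i j)
        simp only [lieDeriv, Pi.smul_apply, Derivation.map_smul, smul_mul_assoc, mul_smul_comm,
          smul_sub, smul_add, Finset.smul_sum])
    (fun x y y' => by
      refine Prod.ext (Subtype.ext (funext fun i => ?_))
        (Subtype.ext (funext fun i => funext fun j => ?_))
      · have h := wedge_apply x.2 (y.2 + y'.2) i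
        change vfBracket x.1.1 (y.1.1 + y'.1.1) i + wedge x.2.1 (y.2.1 + y'.2.1) i =
          (vfBracket x.1.1 y.1.1 i + wedge x.2.1 y.2.1 i) +
            (vfBracket x.1.1 y'.1.1 i + wedge x.2.1 y'.2.1 i)
        change wedge x.2.1 (y.2.1 + y'.2.1) i = _ at h
        rw [h]
        simp only [wedge_apply, vfBracket_apply, along_add, Pi.add_apply, map_add,
          Submodule.coe_add]
        ring
      · change lieDeriv x.1.1 (y.2.1 + y'.2.1) i j - lieDeriv (y.1.1 + y'.1.1) x.2.1 i j =
          (lieDeriv x.1.1 y.2.1 i j - lieDeriv y.1.1 x.2.1 i j) +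
            (lieDeriv x.1.1 y'.2.1 i j - lieDeriv y'.1.1 x.2.1 i j)
        simp only [lieDeriv, Pi.add_apply, map_add, add_mul, mul_add, Finset.sum_add_distrib]
        ring)
    (fun c x y => by
      refine Prod.ext (Subtype.ext (funext fun i => ?_))
        (Subtype.ext (funext fun i => funext fun j => ?_))
      · have h := wedge_apply x.2 (c • y.2) i
        change vfBracket x.1.1 (c • y.1.1) i + wedge x.2.1 (c • y.2.1) i =
          c • (vfBracket x.1.1 y.1.1 i + wedge x.2.1 y.2.1 i)
        change wedge x.2.1 (c • y.2.1) i = _ at h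
        rw [h]
        simp only [wedge_apply, vfBracket_apply, along_smul, Pi.smul_apply, Derivation.map_smul,
          Submodule.coe_smul, mul_smul_comm, smul_add, smul_sub]
      · change lieDeriv x.1.1 (c • y.2.1) i j - lieDeriv (c • y.1.1) x.2.1 i j =
          c • (lieDeriv x.1.1 y.2.1 i j - lieDeriv y.1.1 x.2.1 i j)
        simp only [lieDeriv, Pi.smul_apply, Derivation.map_smul, smul_mul_assoc, mul_smul_comm,
          smul_sub, smul_add, Finset.smul_sum])

/-- The parity involution of `L`. -/
def parity : L →ₗ[ℂ] L := LinearMap.prodMap LinearMap.id (-LinearMap.id)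

@[simp] theorem parity_fst (x : L) : (parity x).1 = x.1 := rfl
@[simp] theorem parity_snd (x : L) : (parity x).2 = -x.2 := rfl

theorem brL_apply (x y : L) :
    brL x y = (brEE x.1 y.1 + brOO x.2 y.2, brEO x.1 y.2 - brEO y.1 x.2) := rfl

theorem brOO_zero_left (w : Omega2cl) : brOO 0 w = 0 :=
  Subtype.ext (funext fun i => by simp [brOO, wedge])

theorem brOO_zero_right (w : Omega2cl) : brOO w 0 = 0 :=
  Subtype.ext (funext fun i => by simp [brOO, wedge])

theorem brEO_zero_left (w : Omega2cl) : brEO 0 w = 0 :=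
  Subtype.ext (funext fun i => funext fun j => by simp [brEO, lieDeriv])

theorem brEO_zero_right (X : S5) : brEO X 0 = 0 :=
  Subtype.ext (funext fun i => funext fun j => by simp [brEO, lieDeriv])

theorem brEE_zero_left (X : S5) : brEE 0 X = 0 :=
  Subtype.ext (funext fun i => by simp [brEE, vfBracket])

theorem brEE_zero_right (X : S5) : brEE X 0 = 0 :=
  Subtype.ext (funext fun i => by simp [brEE, vfBracket])

theorem brL_ee (X Y : S5) : brL (X, 0) (Y, 0) = (brEE X Y, 0) := by
  simp [brL_apply, brOO_zero_left, brEO_zero_right]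

theorem brL_eo (X : S5) (w : Omega2cl) : brL (X, 0) (0, w) = (0, brEO X w) := by
  simp [brL_apply, brOO_zero_left, brEE_zero_right, brEO_zero_left]

theorem brL_oe (w : Omega2cl) (X : S5) : brL (0, w) (X, 0) = -(0, brEO X w) := by
  simp [brL_apply, brOO_zero_right, brEE_zero_left, brEO_zero_left]

theorem brL_oo (v w : Omega2cl) : brL (0, v) (0, w) = (brOO v w, 0) := by
  simp [brL_apply, brEE_zero_left, brEO_zero_left]

theorem brEE_skew (X Y : S5) : brEE X Y = -brEE Y X := Subtype.ext (vfBracket_skew _ _)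

theorem brOO_comm (v w : Omega2cl) : brOO v w = brOO w v := Subtype.ext (wedge_comm _ _)

theorem jacobi_eee (X Y Z : S5) :
    brEE X (brEE Y Z) = brEE (brEE X Y) Z + brEE Y (brEE X Z) :=
  Subtype.ext (vfBracket_jacobi _ _ _)

theorem jacobi_eeo (X Y : S5) (w : Omega2cl) :
    brEO X (brEO Y w) = brEO (brEE X Y) w + brEO Y (brEO X w) :=
  Subtype.ext (lieDeriv_vfBracket _ _ _)

theorem jacobi_eoo (X : S5) (v w : Omega2cl) :
    brEE X (brOO v w) = brOO (brEO X v) w + brOO v (brEO X w) :=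
  Subtype.ext (vfBracket_wedge _ _ _)

theorem jacobi_ooo (u v w : Omega2cl) :
    brEO (brOO u v) w + brEO (brOO v w) u + brEO (brOO w u) v = 0 :=
  Subtype.ext (lieDeriv_wedge _ _ _)

theorem L_eq_add (x : L) : x = (x.1, 0) + (0, x.2) := by ext1 <;> simp

theorem pair_even (X Y : S5) : ((X + Y, 0) : L) = (X, 0) + (Y, 0) := by simp
theorem pair_odd (v w : Omega2cl) : ((0, v + w) : L) = (0, v) + (0, w) := by simp

theorem parity_even (X : S5) : parity (X, 0) = (X, 0) := by
  ext1 <;> simp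

theorem parity_odd (w : Omega2cl) : parity (0, w) = -(0, w) := by
  ext1 <;> simp

theorem parity_parity (x : L) : parity (parity x) = x := by
  ext1 <;> simp

/-- The super Jacobi identity with an even third entry. -/
theorem brL_jacobi_even (x y : L) (Z : S5) :
    brL (brL x y) (Z, 0) = brL x (brL y (Z, 0)) + brL (brL x (Z, 0)) y := by
  obtain ⟨X, v⟩ := x
  obtain ⟨Y, w⟩ := y
  rw [L_eq_add (X, v), L_eq_add (Y, w)]
  simp only [map_add, LinearMap.add_apply, brL_ee, brL_eo, brL_oe, brL_oo, map_neg,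
    LinearMap.neg_apply]
  have h1 : ((brEE (brEE X Y) Z, 0) : L) = (brEE X (brEE Y Z), 0) + (brEE (brEE X Z) Y, 0) := by
    have h := jacobi_eee X Y Z
    rw [brEE_skew Y (brEE X Z)] at h
    rw [h, ← pair_even]
    simp
  have h2 : ((0, brEO X (brEO Z w)) : L) = (0, brEO (brEE X Z) w) + (0, brEO Z (brEO X w)) := by
    rw [jacobi_eeo, pair_odd]
  have h3 : ((0, brEO Z (brEO Y v)) : L) = (0, brEO Y (brEO Z v)) - (0, brEO (brEE Y Z) v) := by
    rw [jacobi_eeo Y Z, pair_odd, add_sub_cancel_left]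
  have h4 : ((brEE (brOO v w) Z, 0) : L) = - (brOO (brEO Z v) w, 0) - (brOO v (brEO Z w), 0) := by
    rw [brEE_skew, jacobi_eoo, neg_add_rev, sub_eq_add_neg]
    ext1 <;> simp [add_comm]
  rw [h1, h2, h3, h4]
  abel

/-- The super Jacobi identity with an odd third entry. -/
theorem brL_jacobi_odd (x y : L) (u : Omega2cl) :
    brL (brL x y) (0, u) = brL x (brL y (0, u)) + brL (brL x (0, u)) (parity y) := by
  obtain ⟨X, v⟩ := x
  obtain ⟨Y, w⟩ := y
  rw [L_eq_add (X, v), L_eq_add (Y, w)]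
  simp only [map_add, LinearMap.add_apply, brL_ee, brL_eo, brL_oe, brL_oo, map_neg,
    LinearMap.neg_apply, parity_even, parity_odd]
  have h1 : ((0, brEO X (brEO Y u)) : L) = (0, brEO (brEE X Y) u) + (0, brEO Y (brEO X u)) := by
    rw [jacobi_eeo, pair_odd]
  have h2 : ((brEE X (brOO w u), 0) : L) = (brOO (brEO X w) u, 0) + (brOO (brEO X u) w, 0) := by
    rw [jacobi_eoo, brOO_comm w, pair_even]
  have h3 : ((brEE (brOO v u) Y, 0) : L) = - (brOO (brEO Y v) u, 0) - (brOO v (brEO Y u), 0) := by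
    rw [brEE_skew, jacobi_eoo, neg_add_rev, sub_eq_add_neg]
    ext1 <;> simp [add_comm]
  have h4 : ((0, brEO (brOO v w) u) : L) = - (0, brEO (brOO w u) v) - (0, brEO (brOO v u) w) := by
    have h := jacobi_ooo u v w
    rw [brOO_comm w u, brOO_comm u v] at h
    have h' : brEO (brOO v w) u = -brEO (brOO u w) v - brEO (brOO v u) w := by
      rw [eq_sub_iff_add_eq, eq_neg_iff_add_eq_zero, ← h]
      abel
    rw [h', brOO_comm w u]
    ext1 <;> simp
  rw [h1, h2, h3, h4]
  abel

theorem brL_skew_even (x : L) (Y : S5) : brL x (Y, 0) = - brL (Y, 0) x := by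
  obtain ⟨X, v⟩ := x
  rw [L_eq_add (X, v)]
  simp only [map_add, LinearMap.add_apply, brL_ee, brL_eo, brL_oe, neg_add]
  rw [brEE_skew X Y]
  ext1 <;> simp

/-- Super skew-symmetry: the parity involution produces the sign. -/
theorem brL_skew_odd (x : L) (w : Omega2cl) : brL x (0, w) = - brL (0, w) (parity x) := by
  obtain ⟨X, v⟩ := x
  rw [L_eq_add (X, v)]
  simp only [map_add, map_neg, LinearMap.add_apply, brL_eo, brL_oe, brL_oo, neg_add,
    parity_even, parity_odd, neg_neg, brOO_comm v w]

theorem parity_brL (x y : L) : parity (brL x y) = brL (parity x) (parity y) := by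
  obtain ⟨X, v⟩ := x
  obtain ⟨Y, w⟩ := y
  rw [L_eq_add (X, v), L_eq_add (Y, w)]
  simp only [map_add, map_neg, LinearMap.add_apply, LinearMap.neg_apply, brL_ee, brL_eo, brL_oe,
    brL_oo, parity_even, parity_odd, neg_neg]
  abel

/-! ### The projections to `L₋` and to `𝔤₀` -/

/-- The projection of `L` onto `L₋`, which takes the constant terms of the coefficients. -/
def proj : L →ₗ[ℂ] L where
  toFun x := (⟨fun i => MvPowerSeries.C (MvPowerSeries.coeff 0 (x.1.1 i)), by
      change ∑ i, pd i _ = 0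
      simp [pd]⟩,
    ⟨fun i j => MvPowerSeries.C (MvPowerSeries.coeff 0 (x.2.1 i j)), by
      refine ⟨fun i j => ?_, fun i j k => by simp [pd]⟩
      have h : x.2.1 i j = -x.2.1 j i := x.2.2.1 i j
      simp only [h, map_neg]⟩)
  map_add' x y := by
    refine Prod.ext (Subtype.ext (funext fun i => ?_))
        (Subtype.ext (funext fun i => funext fun j => ?_)) <;> simp
  map_smul' c x := by
    refine Prod.ext (Subtype.ext (funext fun i => ?_))
        (Subtype.ext (funext fun i => funext fun j => ?_)) <;> simp [MvPowerSeries.smul_eq_C_mul]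

theorem proj_proj (x : L) : proj (proj x) = proj x := by
  refine Prod.ext (Subtype.ext (funext fun i => ?_))
        (Subtype.ext (funext fun i => funext fun j => ?_)) <;> simp [proj]

theorem proj_parity (x : L) : proj (parity x) = parity (proj x) := by
  refine Prod.ext (Subtype.ext (funext fun i => ?_))
        (Subtype.ext (funext fun i => funext fun j => ?_)) <;> simp [proj]

/-- `L₋` is a subalgebra. -/
theorem proj_brL_proj (x y : L) : proj (brL (proj x) (proj y)) = brL (proj x) (proj y) := by
  refine Prod.ext (Subtype.ext (funext fun i => ?_))
        (Subtype.ext (funext fun i => funext fun j => ?_))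
  · change MvPowerSeries.C (MvPowerSeries.coeff 0 (vfBracket _ _ i + wedge _ _ i)) =
      vfBracket _ _ i + wedge _ _ i
    rw [wedge_apply]
    simp [vfBracket, proj, pd]
  · simp [brL_apply, brEO, lieDeriv, proj, pd]

theorem toG0_proj (x : L) : toG0 (proj x) = 0 := by
  ext i j
  simp [toG0, proj, MvPowerSeries.coeff_C]

theorem toG0_brL_proj (x y : L) : toG0 (brL (proj x) (proj y)) = 0 := by
  rw [← proj_brL_proj, toG0_proj]

theorem proj_eq_zero_iff (x : L) : proj x = 0 ↔
    (∀ i, MvPowerSeries.constantCoeff (x.1.1 i) = 0) ∧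
      ∀ i j, MvPowerSeries.constantCoeff (x.2.1 i j) = 0 := by
  have hC : ∀ c : ℂ, (MvPowerSeries.C c : FPS) = 0 ↔ c = 0 := fun c =>
    ⟨fun h => by simpa using congrArg MvPowerSeries.constantCoeff h, fun h => by rw [h, map_zero]⟩
  rw [Prod.ext_iff, Subtype.ext_iff, Subtype.ext_iff, funext_iff, funext_iff]
  simp only [funext_iff]
  exact and_congr (forall_congr' fun i => hC _) (forall_congr' fun i => forall_congr' fun j => hC _)

/-- `L₀` is the kernel of the projection to `L₋`. -/
theorem mem_L0_iff (x : L) : x ∈ L0 ↔ proj x = 0 := by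
  rw [proj_eq_zero_iff]
  have h0 : ∀ n : Fin 5 →₀ ℕ, n ≠ 0 → 1 ≤ n.degree := fun n hn =>
    Nat.one_le_iff_ne_zero.2 fun h => hn ((Finsupp.degree_eq_zero_iff n).1 h)
  constructor
  · rintro ⟨h1, h2⟩
    refine ⟨fun i => ?_, fun i j => ?_⟩ <;> by_contra h
    · have := h1 i 0 h
      simp at this
    · have := h2 i j 0 h
      simp at this
  · rintro ⟨h1, h2⟩
    refine ⟨fun i n h => ?_, fun i j n h => ?_⟩
    · have := h0 n (by rintro rfl; exact h (h1 i))
      dsimp only; omega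
    · have := h0 n (by rintro rfl; exact h (h2 i j))
      dsimp only; omega

theorem toG0_parity (x : L) : toG0 (parity x) = toG0 x := rfl

/-- `L₀` is a subalgebra. -/
theorem proj_brL_L0 (x y : L) (hx : proj x = 0) (hy : proj y = 0) : proj (brL x y) = 0 := by
  rw [proj_eq_zero_iff] at *
  refine ⟨fun i => ?_, fun i j => ?_⟩
  · change MvPowerSeries.constantCoeff (vfBracket _ _ i + wedge _ _ i) = 0
    simp [wedge_apply, vfBracket, hx.1, hx.2, hy.1]
  · change MvPowerSeries.constantCoeff (lieDeriv _ _ i j - lieDeriv _ _ i j) = 0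
    simp [lieDeriv, hx.1, hx.2, hy.1, hy.2]

theorem coeff_single_eq (a : Fin 5) (f : FPS) :
    MvPowerSeries.coeff (Finsupp.single a 1) f = MvPowerSeries.constantCoeff (pd a f) := by
  rw [← MvPowerSeries.coeff_zero_eq_constantCoeff_apply, pd, MvPowerSeries.coeff_pderiv]
  simp

theorem toG0_apply (x : L) (a k : Fin 5) :
    (toG0 x).1 a k = MvPowerSeries.constantCoeff (pd a (x.1.1 k)) := coeff_single_eq _ _

/-- On `L₀` the degree zero part is a homomorphism to `sl₅`. -/
theorem toG0_brL_L0 (x y : L) (hx : proj x = 0) (hy : proj y = 0) :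
    toG0 (brL x y) = ⁅toG0 x, toG0 y⁆ := by
  rw [proj_eq_zero_iff] at *
  refine Subtype.ext (Matrix.ext fun a k => ?_)
  rw [LieAlgebra.SpecialLinear.sl_bracket, Matrix.sub_apply, Matrix.mul_apply, Matrix.mul_apply]
  simp only [toG0_apply]
  change MvPowerSeries.constantCoeff (pd a (vfBracket _ _ k + wedge _ _ k)) = _
  rw [wedge_apply]
  simp only [vfBracket, map_add, map_sub, map_sum, Derivation.leibniz, smul_eq_mul, map_mul,
    hx.1, hx.2, hy.1, hy.2, zero_mul, add_zero, zero_add, sub_zero,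
    Finset.sum_sub_distrib]
  simp only [mul_comm]

/-! ### The enveloping algebra of `L₋` -/

/-- The defining relations of `U(L₋)`, on generators `ι x` for `x ∈ L` which depend only on the
projection of `x` to `L₋`. -/
inductive MinusRel : TensorAlgebra ℂ L → TensorAlgebra ℂ L → Prop
  | proj (x : L) : MinusRel (TensorAlgebra.ι ℂ (proj x)) (TensorAlgebra.ι ℂ x)
  | even (x : L) (Y : S5) : MinusRel
      (TensorAlgebra.ι ℂ x * TensorAlgebra.ι ℂ ((Y, 0) : L))
      (TensorAlgebra.ι ℂ (brL (proj x) (proj (Y, 0)))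
        + TensorAlgebra.ι ℂ ((Y, 0) : L) * TensorAlgebra.ι ℂ x)
  | odd (x : L) (w : Omega2cl) : MinusRel
      (TensorAlgebra.ι ℂ x * TensorAlgebra.ι ℂ ((0, w) : L))
      (TensorAlgebra.ι ℂ (brL (proj x) (proj (0, w)))
        + TensorAlgebra.ι ℂ ((0, w) : L) * TensorAlgebra.ι ℂ (parity x))

/-- The universal enveloping algebra of `L₋ = 𝔤₋₂ ⊕ 𝔤₋₁`. -/
def UNeg : Type := RingQuot MinusRel

instance : Ring UNeg := inferInstanceAs (Ring (RingQuot MinusRel))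

instance : Algebra ℂ UNeg := inferInstanceAs (Algebra ℂ (RingQuot MinusRel))

/-- The quotient map onto `U(L₋)`. -/
def UNeg.mk : TensorAlgebra ℂ L →ₐ[ℂ] UNeg := RingQuot.mkAlgHom ℂ MinusRel

/-- The map `L → L₋ → U(L₋)`. -/
def toUNeg : L →ₗ[ℂ] UNeg := UNeg.mk.toLinearMap ∘ₗ TensorAlgebra.ι ℂ

theorem UNeg.mk_eq {s t : TensorAlgebra ℂ L} (h : MinusRel s t) : UNeg.mk s = UNeg.mk t :=
  RingQuot.mkAlgHom_rel ℂ h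

theorem UNeg.mk_ι (x : L) : UNeg.mk (TensorAlgebra.ι ℂ x) = toUNeg x := rfl

theorem toUNeg_proj (x : L) : toUNeg (proj x) = toUNeg x := UNeg.mk_eq (MinusRel.proj x)

theorem toUNeg_even (x : L) (Y : S5) : toUNeg x * toUNeg (Y, 0) =
    toUNeg (brL (proj x) (proj (Y, 0))) + toUNeg (Y, 0) * toUNeg x := by
  simpa only [map_add, map_mul, UNeg.mk_ι] using UNeg.mk_eq (MinusRel.even x Y)

theorem toUNeg_odd (x : L) (w : Omega2cl) : toUNeg x * toUNeg (0, w) =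
    toUNeg (brL (proj x) (proj (0, w))) + toUNeg (0, w) * toUNeg (parity x) := by
  simpa only [map_add, map_mul, UNeg.mk_ι] using UNeg.mk_eq (MinusRel.odd x w)

/-- Algebra homomorphisms out of `U(L₋)`. -/
def UNeg.lift {B : Type*} [Ring B] [Algebra ℂ B] (f : L →ₗ[ℂ] B) (hp : ∀ x, f (proj x) = f x)
    (he : ∀ x Y, f x * f (Y, 0) = f (brL (proj x) (proj (Y, 0))) + f (Y, 0) * f x)
    (ho : ∀ x w, f x * f (0, w) = f (brL (proj x) (proj (0, w))) + f (0, w) * f (parity x)) :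
    UNeg →ₐ[ℂ] B :=
  RingQuot.liftAlgHom ℂ ⟨TensorAlgebra.lift ℂ f, fun a b h => by
    cases h with
    | proj x => simp [hp]
    | even x Y => simp [he]
    | odd x w => simp [ho]⟩

theorem UNeg.lift_apply {B : Type*} [Ring B] [Algebra ℂ B] (f : L →ₗ[ℂ] B)
    (hp : ∀ x, f (proj x) = f x)
    (he : ∀ x Y, f x * f (Y, 0) = f (brL (proj x) (proj (Y, 0))) + f (Y, 0) * f x)
    (ho : ∀ x w, f x * f (0, w) = f (brL (proj x) (proj (0, w))) + f (0, w) * f (parity x))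
    (x : L) :
    UNeg.lift f hp he ho (toUNeg x) = f x := by
  change RingQuot.liftAlgHom ℂ _ (RingQuot.mkAlgHom ℂ MinusRel (TensorAlgebra.ι ℂ x)) = _
  rw [RingQuot.liftAlgHom_mkAlgHom_apply, TensorAlgebra.lift_ι_apply]

/-- `U(L₋)` is spanned by products of elements of `L₋`. -/
theorem UNeg.induction (S : Submodule ℂ UNeg) (h1 : 1 ∈ S)
    (hS : ∀ x u, u ∈ S → toUNeg x * u ∈ S) (u : UNeg) : u ∈ S := by
  obtain ⟨t, rfl⟩ : ∃ t, UNeg.mk t = u := RingQuot.mkAlgHom_surjective ℂ MinusRel u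
  suffices h : ∀ t : TensorAlgebra ℂ L, ∀ u ∈ S, UNeg.mk t * u ∈ S by
    have := h t 1 h1
    rwa [mul_one] at this
  intro t
  induction t using TensorAlgebra.induction with
  | algebraMap r =>
    intro u hu
    rw [AlgHom.commutes, ← Algebra.smul_def]
    exact S.smul_mem r hu
  | ι x => exact fun u hu => hS x u hu
  | mul a b ha hb =>
    intro u hu
    rw [map_mul, mul_assoc]
    exact ha _ (hb _ hu)
  | add a b ha hb =>
    intro u hu
    rw [map_add, add_mul]
    exact S.add_mem (ha _ hu) (hb _ hu)

/-! ### The coinduced action on `Hom(L, K)` -/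

section Induced

variable {K : Type*} [AddCommGroup K] [Module ℂ K] [Module UNeg K] [IsScalarTower ℂ UNeg K]

/-- The action of `a ∈ L₋` on `Hom(L, K)`, for a `U(L₋)`-module `K`. It is chosen so that
`t ↦ (x ↦ x t)` would be `L₋`-equivariant if `K` were an `L`-module:
`x (a t) = [x, a] t ± a (x t)`. -/
def homAct : L →ₗ[ℂ] Module.End ℂ (L →ₗ[ℂ] K) :=
  LinearMap.mk₂ ℂ (fun a f => f ∘ₗ brL.flip (proj a)
      + Algebra.lsmul ℂ ℂ K (toUNeg (a.1, 0)) ∘ₗ f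
      + Algebra.lsmul ℂ ℂ K (toUNeg (0, a.2)) ∘ₗ f ∘ₗ parity)
    (fun a b f => by
      rw [Prod.fst_add, Prod.snd_add, pair_even, pair_odd]
      simp only [map_add, LinearMap.comp_add, LinearMap.add_comp]
      abel)
    (fun c a f => by
      rw [Prod.smul_fst, Prod.smul_snd, show ((c • a.1, 0) : L) = c • (a.1, 0) by simp,
        show ((0, c • a.2) : L) = c • (0, a.2) by simp]
      simp only [map_smul, LinearMap.comp_smul, LinearMap.smul_comp, smul_add])
    (fun a f g => by
      simp only [LinearMap.comp_add, LinearMap.add_comp]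
      abel)
    (fun c a f => by
      simp only [LinearMap.comp_smul, LinearMap.smul_comp, smul_add])

theorem homAct_apply (a : L) (f : L →ₗ[ℂ] K) (x : L) : homAct a f x =
    f (brL x (proj a)) + toUNeg (a.1, 0) • f x + toUNeg (0, a.2) • f (parity x) := rfl

theorem proj_even (Y : S5) : proj (Y, 0) = ((proj (Y, 0)).1, 0) := by
  ext1
  · rfl
  · ext i j; simp [proj]

theorem proj_odd (w : Omega2cl) : proj (0, w) = (0, (proj (0, w)).2) := by
  ext1
  · ext i j; simp [proj]
  · rfl

theorem homAct_proj (a : L) : homAct (K := K) (proj a) = homAct a := by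
  have h1 : toUNeg ((proj a).1, 0) = toUNeg (a.1, 0) := by
    rw [← toUNeg_proj (a.1, 0), proj_even]; rfl
  have h2 : toUNeg (0, (proj a).2) = toUNeg (0, a.2) := by
    rw [← toUNeg_proj (0, a.2), proj_odd]; rfl
  refine LinearMap.ext fun f => LinearMap.ext fun x => ?_
  rw [homAct_apply, homAct_apply, proj_proj, h1, h2]

theorem homAct_even_apply (Y : S5) (f : L →ₗ[ℂ] K) (z : L) : homAct (Y, 0) f z =
    f (brL z (proj (Y, 0))) + toUNeg (Y, 0) • f z := by
  rw [homAct_apply, show ((0, 0) : L) = 0 from rfl, map_zero, zero_smul, add_zero]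

theorem homAct_odd_apply (w : Omega2cl) (f : L →ₗ[ℂ] K) (z : L) : homAct (0, w) f z =
    f (brL z (proj (0, w))) + toUNeg (0, w) • f (parity z) := by
  rw [homAct_apply, show ((0, 0) : L) = 0 from rfl, map_zero, zero_smul, add_zero]

theorem parity_brL_even (z : L) (Y : S5) :
    parity (brL z (proj (Y, 0))) = brL (parity z) (proj (Y, 0)) := by
  rw [parity_brL, proj_even, parity_even]

theorem parity_brL_odd (z : L) (w : Omega2cl) :
    parity (brL z (proj (0, w))) = -brL (parity z) (proj (0, w)) := by
  rw [parity_brL, proj_odd, parity_odd, map_neg]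

/-- The relation of `U(L₋)` for a commutator with an even element, from the Jacobi identity. -/
theorem homAct_even (x : L) (Y : S5) : homAct (K := K) x * homAct (Y, 0) =
    homAct (brL (proj x) (proj (Y, 0))) + homAct (Y, 0) * homAct x := by
  have j := fun z x => brL_jacobi_even z (proj x) (proj (Y, 0)).1
  simp only [← proj_even] at j
  have key : ∀ b, brL (proj b) (proj (Y, 0)) = proj (brL (proj b) (proj (Y, 0))) :=
    fun b => (proj_brL_proj _ _).symm
  rw [L_eq_add x]
  simp only [map_add, add_mul, mul_add, LinearMap.add_apply]
  have h1 : homAct (K := K) (x.1, 0) * homAct (Y, 0) =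
      homAct (brL (proj (x.1, 0)) (proj (Y, 0))) + homAct (Y, 0) * homAct (x.1, 0) := by
    have e := toUNeg_even (x.1, 0) Y
    have hb : brL (proj (x.1, 0)) (proj (Y, 0)) = (brEE (proj (x.1, 0)).1 (proj (Y, 0)).1, 0) := by
      rw [proj_even x.1, proj_even Y, brL_ee]
    refine LinearMap.ext fun f => LinearMap.ext fun z => ?_
    simp only [Module.End.mul_apply, LinearMap.add_apply, homAct_even_apply]
    rw [hb, homAct_even_apply, ← hb, proj_brL_proj, j, map_add]
    simp only [smul_add, smul_smul, e, add_smul]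
    abel
  have h2 : homAct (K := K) (0, x.2) * homAct (Y, 0) =
      homAct (brL (proj (0, x.2)) (proj (Y, 0))) + homAct (Y, 0) * homAct (0, x.2) := by
    have e := toUNeg_even (0, x.2) Y
    have hb : brL (proj (0, x.2)) (proj (Y, 0)) =
        (0, -brEO (proj (Y, 0)).1 (proj (0, x.2)).2) := by
      rw [proj_odd x.2, proj_even Y, brL_oe]; simp
    refine LinearMap.ext fun f => LinearMap.ext fun z => ?_
    simp only [Module.End.mul_apply, LinearMap.add_apply, homAct_even_apply, homAct_odd_apply]
    rw [hb, homAct_odd_apply, ← hb, proj_brL_proj, j, map_add, parity_brL_even]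
    simp only [smul_add, smul_smul, e, add_smul]
    abel
  rw [h1, h2]
  abel

/-- The relation of `U(L₋)` for a commutator with an odd element, from the Jacobi identity. -/
theorem homAct_odd (x : L) (w : Omega2cl) : homAct (K := K) x * homAct (0, w) =
    homAct (brL (proj x) (proj (0, w))) + homAct (0, w) * homAct (parity x) := by
  have j := fun z x => brL_jacobi_odd z (proj x) (proj (0, w)).2
  simp only [← proj_odd, ← proj_parity] at j
  rw [L_eq_add x]
  simp only [map_add, add_mul, mul_add, LinearMap.add_apply]
  have h1 : homAct (K := K) (x.1, 0) * homAct (0, w) =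
      homAct (brL (proj (x.1, 0)) (proj (0, w))) + homAct (0, w) * homAct (parity (x.1, 0)) := by
    have e := toUNeg_odd (x.1, 0) w
    have hb : brL (proj (x.1, 0)) (proj (0, w)) = (0, brEO (proj (x.1, 0)).1 (proj (0, w)).2) := by
      rw [proj_even x.1, proj_odd w, brL_eo]
    rw [parity_even] at e ⊢
    refine LinearMap.ext fun f => LinearMap.ext fun z => ?_
    simp only [Module.End.mul_apply, LinearMap.add_apply, homAct_even_apply, homAct_odd_apply]
    rw [hb, homAct_odd_apply, ← hb, proj_brL_proj, j, map_add, parity_even, parity_brL_even]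
    simp only [smul_add, smul_smul, e, add_smul]
    abel
  have h2 : homAct (K := K) (0, x.2) * homAct (0, w) =
      homAct (brL (proj (0, x.2)) (proj (0, w))) + homAct (0, w) * homAct (parity (0, x.2)) := by
    have e := toUNeg_odd (0, x.2) w
    have hb : brL (proj (0, x.2)) (proj (0, w)) = (brOO (proj (0, x.2)).2 (proj (0, w)).2, 0) := by
      rw [proj_odd x.2, proj_odd w, brL_oo]
    rw [parity_odd] at e ⊢
    refine LinearMap.ext fun f => LinearMap.ext fun z => ?_
    simp only [Module.End.mul_apply, LinearMap.add_apply, LinearMap.neg_apply, map_neg,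
      homAct_odd_apply]
    rw [hb, homAct_even_apply, ← hb, proj_brL_proj, j, map_add, parity_odd, parity_brL_odd,
      parity_brL_odd, parity_parity]
    simp only [smul_add, smul_smul, e, add_smul, map_neg, smul_neg, neg_smul, mul_neg]
    abel
  rw [h1, h2]
  abel

variable (K) in
/-- `Hom(L, K)` as a `U(L₋)`-module. -/
def homRep : UNeg →ₐ[ℂ] Module.End ℂ (L →ₗ[ℂ] K) :=
  UNeg.lift homAct homAct_proj homAct_even homAct_odd

theorem homRep_toUNeg (x : L) : homRep K (toUNeg x) = homAct x := UNeg.lift_apply _ _ _ _ _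

end Induced

/-! ### The induced module -/

/-- The underlying space `U(L₋) ⊗ V` of the induced module. -/
abbrev Ind (V : Type) [AddCommGroup V] [Module ℂ V] : Type := UNeg ⊗[ℂ] V

/-- Induction over the elements of `U(L₋) ⊗ V`. -/
theorem Ind.induction {V : Type} [AddCommGroup V] [Module ℂ V] {p : Ind V → Prop}
    (h1 : ∀ v, p (1 ⊗ₜ v))
    (hadd : ∀ s t, p s → p t → p (s + t)) (hs : ∀ (c : ℂ) t, p t → p (c • t))
    (he : ∀ Y t, p t → p (toUNeg (Y, 0) • t)) (ho : ∀ w t, p t → p (toUNeg (0, w) • t))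
    (t : Ind V) : p t := by
  have h0 : p 0 := by
    have := hs 0 _ (h1 0)
    rwa [zero_smul] at this
  induction t using TensorProduct.induction_on with
  | zero => exact h0
  | add s t hs ht => exact hadd s t hs ht
  | tmul u v =>
    refine UNeg.induction ⟨⟨⟨{u | p (u ⊗ₜ v)}, ?_⟩, ?_⟩, ?_⟩ (h1 v) ?_ u
    · intro a b ha hb
      change p ((a + b) ⊗ₜ v)
      rw [TensorProduct.add_tmul]
      exact hadd _ _ ha hb
    · change p (0 ⊗ₜ v)
      rwa [TensorProduct.zero_tmul]
    · intro c a ha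
      exact hs c _ ha
    · intro x u hu
      change p ((toUNeg x * u) ⊗ₜ v)
      rw [L_eq_add x, map_add, add_mul, TensorProduct.add_tmul]
      exact hadd _ _ (he x.1 _ hu) (ho x.2 _ hu)

section InducedModule

variable (V : Type) [AddCommGroup V] [Module ℂ V] [LieRingModule sl5 V] [LieModule ℂ sl5 V]

/-- The action of `L` on `1 ⊗ V`, as a map to `Hom(L, U(L₋) ⊗ V)`. -/
def indBase : V →ₗ[ℂ] L →ₗ[ℂ] Ind V :=
  LinearMap.mk₂ ℂ (fun v x => toUNeg x ⊗ₜ v + 1 ⊗ₜ ⁅toG0 x, v⁆)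
    (fun v v' x => by rw [lie_add, TensorProduct.tmul_add, TensorProduct.tmul_add]; abel)
    (fun c v x => by rw [lie_smul, TensorProduct.tmul_smul, TensorProduct.tmul_smul, smul_add])
    (fun v x y => by
      rw [map_add, map_add, add_lie, TensorProduct.tmul_add, TensorProduct.add_tmul]; abel)
    (fun c v x => by
      rw [map_smul, map_smul, smul_lie, TensorProduct.tmul_smul, ← TensorProduct.smul_tmul',
        smul_add])

/-- The action of `L` on `U(L₋) ⊗ V`: the extension of `indBase` to the `L₋`-equivariant map
`U(L₋) ⊗ V → Hom(L, U(L₋) ⊗ V)`. -/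
def indHom : Ind V →ₗ[ℂ] L →ₗ[ℂ] Ind V :=
  TensorProduct.lift (LinearMap.mk₂ ℂ (fun u v => homRep (Ind V) u (indBase V v))
    (fun u u' v => by rw [map_add, LinearMap.add_apply])
    (fun c u v => by rw [map_smul, LinearMap.smul_apply])
    (fun u v v' => by rw [map_add, map_add])
    (fun c u v => by rw [map_smul, map_smul]))

variable {V}

theorem indHom_one (v : V) (x : L) :
    indHom V (1 ⊗ₜ v) x = toUNeg x ⊗ₜ v + 1 ⊗ₜ ⁅toG0 x, v⁆ := by
  change homRep (Ind V) 1 (indBase V v) x = _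
  rw [map_one]; rfl

theorem indHom_smul (u : UNeg) (t : Ind V) : indHom V (u • t) = homRep (Ind V) u (indHom V t) := by
  induction t using TensorProduct.induction_on with
  | zero => simp
  | tmul u' v =>
    change homRep (Ind V) (u * u') (indBase V v) =
      homRep (Ind V) u (homRep (Ind V) u' (indBase V v))
    rw [map_mul]; rfl
  | add s t hs ht => rw [smul_add, map_add, map_add, map_add, hs, ht]

theorem indHom_even (Y : S5) (t : Ind V) (x : L) : indHom V (toUNeg (Y, 0) • t) x =
    indHom V t (brL x (proj (Y, 0))) + toUNeg (Y, 0) • indHom V t x := by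
  rw [indHom_smul, homRep_toUNeg, homAct_even_apply]

theorem indHom_odd (w : Omega2cl) (t : Ind V) (x : L) : indHom V (toUNeg (0, w) • t) x =
    indHom V t (brL x (proj (0, w))) + toUNeg (0, w) • indHom V t (parity x) := by
  rw [indHom_smul, homRep_toUNeg, homAct_odd_apply]

theorem toUNeg_even_add_odd (x : L) : toUNeg (x.1, 0) + toUNeg (0, x.2) = toUNeg x := by
  rw [← map_add, ← L_eq_add]

theorem indHom_toUNeg_smul (x y : L) (t : Ind V) : indHom V (toUNeg x • t) y =
    indHom V t (brL y (proj x)) + toUNeg (x.1, 0) • indHom V t y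
      + toUNeg (0, x.2) • indHom V t (parity y) := by
  rw [indHom_smul, homRep_toUNeg, homAct_apply]

/-- The action of a bracket on `1 ⊗ v`, after splitting both entries along `L = L₋ ⊕ L₀`. -/
theorem indHom_brL_one (x y : L) (v : V) : indHom V (1 ⊗ₜ v) (brL x y) =
    indHom V (1 ⊗ₜ v) (brL x (proj y)) + indHom V (1 ⊗ₜ v) (brL (proj x) y)
      - toUNeg (brL (proj x) (proj y)) ⊗ₜ v + 1 ⊗ₜ ⁅⁅toG0 x, toG0 y⁆, v⁆ := by
  have hx : proj (x - proj x) = 0 := by rw [map_sub, proj_proj, sub_self]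
  have hy : proj (y - proj y) = 0 := by rw [map_sub, proj_proj, sub_self]
  have h : brL x y = brL x (proj y) + brL (proj x) y - brL (proj x) (proj y)
      + brL (x - proj x) (y - proj y) := by
    simp only [map_sub, LinearMap.sub_apply]; abel
  rw [h, map_add, map_sub, map_add, indHom_one v (brL (proj x) (proj y)), toG0_brL_proj,
    indHom_one v (brL (x - proj x) (y - proj y)), toG0_brL_L0 _ _ hx hy,
    ← toUNeg_proj (brL (x - proj x) _), proj_brL_L0 _ _ hx hy]
  simp only [map_sub, toG0_proj, sub_zero, zero_lie, TensorProduct.tmul_zero, add_zero, map_zero,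
    TensorProduct.zero_tmul, zero_add]

theorem indHom_even_one (x : L) (Y : S5) (v : V) :
    indHom V (indHom V (1 ⊗ₜ v) (Y, 0)) x = indHom V (1 ⊗ₜ v) (brL x (Y, 0))
      + indHom V (indHom V (1 ⊗ₜ v) x) (Y, 0) := by
  have e : ∀ u : UNeg, u ⊗ₜ[ℂ] v = u • ((1 : UNeg) ⊗ₜ[ℂ] v) := fun u => by
    rw [TensorProduct.smul_tmul', smul_eq_mul, mul_one]
  have hs : brL (Y, 0) (proj x) = - brL (proj x) (Y, 0) := by rw [brL_skew_even, neg_neg]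
  have h1 : indHom V (indHom V (1 ⊗ₜ v) (Y, 0)) x = indHom V (1 ⊗ₜ v) (brL x (proj (Y, 0)))
      + toUNeg (Y, 0) • indHom V (1 ⊗ₜ v) x + indHom V (1 ⊗ₜ ⁅toG0 (Y, 0), v⁆) x := by
    rw [indHom_one v (Y, 0), map_add, e, LinearMap.add_apply, indHom_even]
  have h2 : indHom V (indHom V (1 ⊗ₜ v) x) (Y, 0) = -indHom V (1 ⊗ₜ v) (brL (proj x) (Y, 0))
      + toUNeg x • indHom V (1 ⊗ₜ v) (Y, 0) + indHom V (1 ⊗ₜ ⁅toG0 x, v⁆) (Y, 0) := by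
    rw [indHom_one v x, map_add, e, LinearMap.add_apply, indHom_toUNeg_smul, parity_even, hs,
      add_assoc (indHom V _ _) (toUNeg (x.1, 0) • _), ← add_smul, toUNeg_even_add_odd, map_neg]
  rw [h1, h2, indHom_brL_one x (Y, 0), indHom_one v x, indHom_one v (Y, 0), indHom_one _ x,
    indHom_one _ (Y, 0)]
  simp only [smul_add, TensorProduct.smul_tmul', smul_eq_mul, toUNeg_even x Y, mul_one, lie_lie,
    TensorProduct.tmul_sub, TensorProduct.add_tmul]
  abel

theorem indHom_odd_one (x : L) (w : Omega2cl) (v : V) :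
    indHom V (indHom V (1 ⊗ₜ v) (0, w)) x = indHom V (1 ⊗ₜ v) (brL x (0, w))
      + indHom V (indHom V (1 ⊗ₜ v) (parity x)) (0, w) := by
  have e : ∀ u : UNeg, u ⊗ₜ[ℂ] v = u • ((1 : UNeg) ⊗ₜ[ℂ] v) := fun u => by
    rw [TensorProduct.smul_tmul', smul_eq_mul, mul_one]
  have hs : brL (0, w) (proj (parity x)) = - brL (proj x) (0, w) := by
    rw [brL_skew_odd, neg_neg, proj_parity]
  have h0 : toG0 (0, w) = 0 := by ext i j; simp [toG0]
  have h1 : indHom V (indHom V (1 ⊗ₜ v) (0, w)) x = indHom V (1 ⊗ₜ v) (brL x (proj (0, w)))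
      + toUNeg (0, w) • indHom V (1 ⊗ₜ v) (parity x) := by
    rw [indHom_one v (0, w), e, h0, zero_lie, TensorProduct.tmul_zero, add_zero, indHom_odd]
  have h2 : indHom V (indHom V (1 ⊗ₜ v) (parity x)) (0, w) =
      -indHom V (1 ⊗ₜ v) (brL (proj x) (0, w))
      + toUNeg x • indHom V (1 ⊗ₜ v) (0, w) + indHom V (1 ⊗ₜ ⁅toG0 x, v⁆) (0, w) := by
    rw [indHom_one v (parity x), map_add, e, LinearMap.add_apply, indHom_toUNeg_smul, parity_odd,
      hs, map_neg, map_neg, toG0_parity, ← toUNeg_even_add_odd x, parity_snd, parity_fst, add_smul,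
      show ((0, -x.2) : L) = -(0, x.2) by simp, map_neg, smul_neg, neg_smul, neg_neg, add_assoc]
    simp only [add_assoc]
  rw [h1, h2, indHom_brL_one x (0, w), indHom_one v (parity x), indHom_one v (0, w),
    indHom_one _ (0, w), h0]
  simp only [smul_add, TensorProduct.smul_tmul', smul_eq_mul, toUNeg_odd x w, mul_one, lie_zero,
    zero_lie, TensorProduct.tmul_zero, add_zero, TensorProduct.add_tmul, toG0_parity]
  abel

/-- The relations of `U(L)` hold on `U(L₋) ⊗ V`. They hold on `1 ⊗ V`, and by the Jacobi identity
they are inherited under multiplication by elements of `L₋`. -/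
theorem indHom_indHom (t : Ind V) :
    (∀ x Y, indHom V (indHom V t (Y, 0)) x =
      indHom V t (brL x (Y, 0)) + indHom V (indHom V t x) (Y, 0)) ∧
    (∀ x w, indHom V (indHom V t (0, w)) x =
      indHom V t (brL x (0, w)) + indHom V (indHom V t (parity x)) (0, w)) := by
  induction t using Ind.induction with
  | h1 v => exact ⟨fun x Y => indHom_even_one x Y v, fun x w => indHom_odd_one x w v⟩
  | hadd s t hs ht =>
    simp only [map_add, LinearMap.add_apply, hs.1, hs.2, ht.1, ht.2]
    exact ⟨fun x Y => by abel, fun x w => by abel⟩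
  | hs c t ht =>
    simp only [map_smul, LinearMap.smul_apply, ht.1, ht.2, smul_add]
    exact ⟨fun x Y => trivial, fun x w => trivial⟩
  | he Z t ht =>
    obtain ⟨IHe, IHo⟩ := ht
    obtain ⟨Z', hz⟩ : ∃ Z', proj (Z, 0) = (Z', 0) := ⟨_, proj_even Z⟩
    simp only [indHom_even, hz]
    refine ⟨fun x Y => ?_, fun x w => ?_⟩
    · have h1 : brL (Y, 0) (Z', 0) = (brEE Y Z', 0) := brL_ee _ _
      simp only [map_add, LinearMap.add_apply, indHom_even, hz, IHe,
        brL_jacobi_even x (Y, 0) Z', h1, smul_add]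
      abel
    · have h1 : brL (0, w) (Z', 0) = (0, -brEO Z' w) := by rw [brL_oe]; simp
      have h2 : parity (brL x (Z', 0)) = brL (parity x) (Z', 0) := by
        rw [parity_brL, parity_even]
      simp only [map_add, LinearMap.add_apply, indHom_even, hz, IHo,
        brL_jacobi_even x (0, w) Z', h1, h2, smul_add]
      abel
  | ho u t ht =>
    obtain ⟨IHe, IHo⟩ := ht
    obtain ⟨u', hz⟩ : ∃ u', proj (0, u) = (0, u') := ⟨_, proj_odd u⟩
    simp only [indHom_odd, hz]
    refine ⟨fun x Y => ?_, fun x w => ?_⟩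
    · have h1 : brL (Y, 0) (0, u') = (0, brEO Y u') := brL_eo _ _
      have h2 : parity (brL x (Y, 0)) = brL (parity x) (Y, 0) := by rw [parity_brL, parity_even]
      simp only [map_add, LinearMap.add_apply, indHom_odd, hz, IHe, IHo,
        brL_jacobi_odd x (Y, 0) u', h1, h2, smul_add, parity_even]
      abel
    · have h1 : brL (0, w) (0, u') = (brOO w u', 0) := brL_oo _ _
      have h2 : parity (brL x (0, w)) = -brL (parity x) (0, w) := by
        rw [parity_brL, parity_odd, map_neg]
      have h3 : parity (brL x (0, u')) = -brL (parity x) (0, u') := by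
        rw [parity_brL, parity_odd, map_neg]
      simp only [map_add, map_neg, LinearMap.add_apply, LinearMap.neg_apply, indHom_odd, hz, IHe,
        IHo, brL_jacobi_odd x (0, w) u', h1, h2, h3, smul_add, parity_odd, parity_parity, smul_neg]
      abel

end InducedModule

/-! ### Morphisms between the modules `M(V)` -/

section VermaModule

variable {V : Type} [AddCommGroup V] [Module ℂ V] [LieRingModule sl5 V]

/-- The quotient map onto `U(L)`. -/
def U.mk : TensorAlgebra ℂ L →ₐ[ℂ] U := RingQuot.mkAlgHom ℂ EnvRel

theorem U.mk_ι (x : L) : U.mk (TensorAlgebra.ι ℂ x) = toU x := rfl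

theorem U.mk_eq {s t : TensorAlgebra ℂ L} (h : EnvRel s t) : U.mk s = U.mk t :=
  RingQuot.mkAlgHom_rel ℂ h

theorem toU_eo (X : S5) (w : Omega2cl) :
    toU (X, 0) * toU (0, w) = toU (0, w) * toU (X, 0) + toU (brL (X, 0) (0, w)) := by
  have h := U.mk_eq (EnvRel.eo X w)
  simp only [map_sub, map_mul, U.mk_ι] at h
  rw [brL_eo, ← h]
  abel

theorem toU_oo (v w : Omega2cl) :
    toU (0, v) * toU (0, w) = -(toU (0, w) * toU (0, v)) + toU (brL (0, v) (0, w)) := by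
  have h := U.mk_eq (EnvRel.oo v w)
  simp only [map_add, map_mul, U.mk_ι] at h
  rw [brL_oo, ← h]
  abel

variable (V) in
/-- The map `(u, v) ↦ u ⊗ v` to `M(V)` as a bilinear map. -/
def tensHom : U →ₗ[ℂ] V →ₗ[ℂ] Verma V :=
  (TensorProduct.mk ℂ U V).compr₂ ((vermaRel V).mkQ.restrictScalars ℂ)

theorem tensHom_apply (u : U) (v : V) : tensHom V u v = tens u v := rfl

theorem smul_tens (u u' : U) (v : V) : u • tens u' v = tens (u * u') v := rfl

theorem tens_mul_toU (u : U) (x : L) (hx : proj x = 0) (v : V) :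
    tens (u * toU x) v = tens u ⁅toG0 x, v⁆ := by
  have h : tens (toU x) v - tens 1 ⁅toG0 x, v⁆ = 0 :=
    (Submodule.Quotient.mk_eq_zero _).2 (Submodule.subset_span ⟨x, (mem_L0_iff x).2 hx, v, rfl⟩)
  have h' := congrArg (u • ·) h
  simp only [smul_sub, smul_tens, smul_zero, mul_one] at h'
  exact sub_eq_zero.1 h'

theorem tens_toU (x : L) (hx : proj x = 0) (v : V) : tens (toU x) v = tens 1 ⁅toG0 x, v⁆ := by
  have h := tens_mul_toU 1 x hx v
  rwa [one_mul] at h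

theorem d_eq (i j : Fin 5) : d i j = (0, (d i j).2) := rfl

theorem toG0_odd (w : Omega2cl) : toG0 (0, w) = 0 := by
  ext i j; simp [toG0]

/-- The action of `𝔤₀` on `𝔤₋₁`: in `M(V)`, the components of positive degree of the bracket do not
contribute. -/
theorem tens_brL_d (X : S5) (i j : Fin 5) (v : V) :
    tens (toU (brL (X, 0) (d i j))) v =
      ∑ a, ((toG0 (X, 0)).1 a i • tens (toU (d a j)) v +
        (toG0 (X, 0)).1 a j • tens (toU (d i a)) v) := by
  set y : Omega2cl := brEO X (d i j).2 -
    ∑ a, ((toG0 (X, 0)).1 a i • (d a j).2 + (toG0 (X, 0)).1 a j • (d i a).2) with hy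
  have hp : proj (0, y) = 0 := by
    refine (proj_eq_zero_iff _).2 ⟨fun _ => by simp, fun b c => ?_⟩
    have e : y.1 b c = lieDeriv X.1 (d i j).2.1 b c -
        ∑ a, ((toG0 (X, 0)).1 a i • (d a j).2.1 b c + (toG0 (X, 0)).1 a j • (d i a).2.1 b c) := by
      simp [hy, brEO]
    change MvPowerSeries.constantCoeff (y.1 b c) = 0
    rw [e]
    simp only [toG0_apply, d]
    simp [lieDeriv, pd, ite_and, Finset.sum_add_distrib, mul_sub, Finset.sum_sub_distrib]
    ring
  have h := tens_toU (0, y) hp v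
  rw [toG0_odd, zero_lie] at h
  have e : brL (X, 0) (d i j) = (0, y) +
      ∑ a, ((toG0 (X, 0)).1 a i • d a j + (toG0 (X, 0)).1 a j • d i a) := by
    rw [d_eq, brL_eo]
    refine Prod.ext ?_ ?_
    · simp [Prod.fst_sum, d]
    · simp [Prod.snd_sum, hy]
  rw [e, map_add, map_sum]
  simp only [← tensHom_apply] at h ⊢
  simp only [map_add, map_sum, map_smul, LinearMap.add_apply, h, map_zero, zero_add,
    LinearMap.sum_apply, LinearMap.smul_apply]

/-- The existence of a morphism `∑ dᵢⱼ ⊗ θᵢⱼ`. The elements `∑ dᵢⱼ ⊗ θᵢⱼ v` have to transform under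
`L₀` in the same way as the vectors `1 ⊗ v`: the hypothesis `h0` is the equivariance under the even
part, and `h1` says that the odd elements of `L₀`, which have positive degree, act by zero. -/
theorem exists_isNabla (θ : Fin 5 → Fin 5 → V →ₗ[ℂ] V)
    (h0 : ∀ (A : sl5) i j v, ⁅A, θ i j v⁆ =
      θ i j ⁅A, v⁆ - ∑ a, (A.1 i a • θ a j v + A.1 j a • θ i a v))
    (h1 : ∀ w : Omega2cl, proj (0, w) = 0 → ∀ v,
      ∑ i, ∑ j, ⁅toG0 (brL (0, w) (d i j)), θ i j v⁆ = 0) :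
    ∃ φ : Verma V →ₗ[U] Verma V, IsNabla θ φ := by
  set F : V →ₗ[ℂ] Verma V := ∑ i, ∑ j, tensHom V (toU (d i j)) ∘ₗ θ i j with hF
  have hFv : ∀ v, F v = ∑ i, ∑ j, tens (toU (d i j)) (θ i j v) := fun v => by
    simp [hF, LinearMap.sum_apply, tensHom_apply]
  have he : ∀ X : S5, proj (X, 0) = 0 → ∀ v, toU (X, 0) • F v = F ⁅toG0 (X, 0), v⁆ := by
    intro X hX v
    rw [hFv, hFv, Finset.smul_sum]
    simp only [Finset.smul_sum, smul_tens]
    have e : ∀ i j, tens (toU (X, 0) * toU (d i j)) (θ i j v) =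
        tens (toU (d i j)) (θ i j ⁅toG0 (X, 0), v⁆)
        - ∑ a, ((toG0 (X, 0)).1 i a • tens (toU (d i j)) (θ a j v)
          + (toG0 (X, 0)).1 j a • tens (toU (d i j)) (θ i a v))
        + ∑ a, ((toG0 (X, 0)).1 a i • tens (toU (d a j)) (θ i j v) +
          (toG0 (X, 0)).1 a j • tens (toU (d i a)) (θ i j v)) := by
      intro i j
      rw [← tens_brL_d, d_eq, toU_eo, ← tensHom_apply, map_add, LinearMap.add_apply,
        tensHom_apply, tens_mul_toU _ _ hX, h0]
      simp only [← tensHom_apply, map_sub, map_sum, map_add, map_smul]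
    simp only [e, Finset.sum_add_distrib, Finset.sum_sub_distrib]
    have s1 : ∑ i, ∑ j, ∑ a, (toG0 (X, 0)).1 a i • tens (toU (d a j)) (θ i j v) =
        ∑ i, ∑ j, ∑ a, (toG0 (X, 0)).1 i a • tens (toU (d i j)) (θ a j v) := by
      rw [Finset.sum_comm]
      refine Eq.trans (Finset.sum_congr rfl fun j _ => Finset.sum_comm) Finset.sum_comm
    have s2 : ∑ i, ∑ j, ∑ a, (toG0 (X, 0)).1 a j • tens (toU (d i a)) (θ i j v) =
        ∑ i, ∑ j, ∑ a, (toG0 (X, 0)).1 j a • tens (toU (d i j)) (θ i a v) :=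
      Finset.sum_congr rfl fun i _ => Finset.sum_comm
    rw [s1, s2]
    abel
  have ho : ∀ w : Omega2cl, proj (0, w) = 0 → ∀ v, toU (0, w) • F v = 0 := by
    intro w hw v
    rw [hFv, Finset.smul_sum]
    simp only [Finset.smul_sum, smul_tens]
    have e : ∀ i j, tens (toU (0, w) * toU (d i j)) (θ i j v) =
        tens 1 ⁅toG0 (brL (0, w) (d i j)), θ i j v⁆ := by
      intro i j
      have hp : proj (brL (0, w) (d i j)) = 0 := by
        rw [d_eq, brL_oo]
        refine (proj_eq_zero_iff _).2 ⟨fun k => ?_, fun _ _ => by simp⟩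
        have hw' := ((proj_eq_zero_iff _).1 hw).2
        change MvPowerSeries.constantCoeff (wedge _ _ k) = 0
        simp only at hw'
        simp [wedge_apply, hw']
      rw [d_eq, toU_oo, ← tensHom_apply, map_add, LinearMap.add_apply, map_neg, LinearMap.neg_apply,
        tensHom_apply, tensHom_apply, tens_mul_toU _ _ hw, toG0_odd, zero_lie, ← d_eq,
        tens_toU _ hp, ← tensHom_apply, map_zero, neg_zero, zero_add]
    simp only [e]
    simp only [← tensHom_apply, ← map_sum]
    rw [h1 w hw, map_zero]
  set G : U ⊗[ℂ] V →ₗ[U] Verma V :=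
    TensorProduct.AlgebraTensorModule.lift (LinearMap.toSpanSingleton U (V →ₗ[ℂ] Verma V) F) with hG
  have hGt : ∀ u v, G (u ⊗ₜ v) = u • F v := fun u v => rfl
  refine ⟨(vermaRel V).liftQ G (Submodule.span_le.2 ?_), fun v => ?_⟩
  · rintro _ ⟨x, hx, v, rfl⟩
    rw [mem_L0_iff] at hx
    have hx' := (proj_eq_zero_iff x).1 hx
    have hxe : proj (x.1, 0) = 0 := (proj_eq_zero_iff _).2 ⟨hx'.1, fun _ _ => by simp⟩
    have hxo : proj (0, x.2) = 0 := (proj_eq_zero_iff _).2 ⟨fun _ => by simp, hx'.2⟩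
    change G _ = 0
    rw [map_sub, hGt, hGt, one_smul, L_eq_add x, map_add, add_smul, he _ hxe, ho _ hxo, map_add,
      toG0_odd, add_zero, add_zero, sub_self]
  · change G (1 ⊗ₜ v) = _
    rw [hGt, one_smul, hFv]

theorem d_mem_gr (i j : Fin 5) : d i j ∈ gr (-1) := by
  refine ⟨fun k n h => absurd rfl h, fun a b n h => ?_⟩
  simp only [d, MvPowerSeries.coeff_C] at h
  rw [(ite_ne_right_iff.1 h).1]
  simp

theorem hasDegree_of_isNabla (θ : Fin 5 → Fin 5 → V →ₗ[ℂ] V) (φ : Verma V →ₗ[U] Verma V)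
    (h : IsNabla θ φ) {W : Type} [AddCommGroup W] [Module ℂ W] [LieRingModule sl5 W]
    (f : W →ₗ⁅ℂ, sl5⁆ V) :
    HasDegree (φ ∘ₗ Verma.map f) 1 := by
  have h25 : Fin 25 ≃ Fin 5 × Fin 5 := (finProdFinEquiv (m := 5) (n := 5)).symm
  refine ⟨25, fun r => toU (d (h25 r).1 (h25 r).2), fun r => θ (h25 r).1 (h25 r).2 ∘ₗ f,
    fun r => ?_, fun w => ?_⟩
  · refine Submodule.subset_span ⟨[(1, d (h25 r).1 (h25 r).2)], ?_, rfl, by simp⟩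
    simpa using d_mem_gr _ _
  · change φ (tens 1 (f w)) = _
    rw [h, ← Fintype.sum_prod_type', ← Equiv.sum_comp h25]
    rfl

end VermaModule

/-! ### Detection of zero -/

section InducedModule

variable {V : Type} [AddCommGroup V] [Module ℂ V] [LieRingModule sl5 V] [LieModule ℂ sl5 V]

variable (V) in
/-- The `U(L)`-module structure of `U(L₋) ⊗ V`. -/
def indRep : U →ₐ[ℂ] Module.End ℂ (Ind V) :=
  RingQuot.liftAlgHom ℂ ⟨TensorAlgebra.lift ℂ (indHom V).flip, fun a b h => by
    refine LinearMap.ext fun t => ?_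
    cases h with
    | ee X Y =>
      have h := (indHom_indHom t).1 (X, 0) Y
      rw [brL_ee] at h
      simp [h]
    | eo X w =>
      have h := (indHom_indHom t).2 (X, 0) w
      rw [brL_eo, parity_even] at h
      simp [h]
    | oo v w =>
      have h := (indHom_indHom t).2 (0, v) w
      rw [brL_oo, parity_odd, map_neg, map_neg, LinearMap.neg_apply] at h
      simp [h]⟩

theorem indRep_toU (x : L) (t : Ind V) : indRep V (toU x) t = indHom V t x := by
  have h : indRep V (toU x) = (indHom V).flip x := by
    change RingQuot.liftAlgHom ℂ _ (RingQuot.mkAlgHom ℂ EnvRel (TensorAlgebra.ι ℂ x)) = _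
    rw [RingQuot.liftAlgHom_mkAlgHom_apply, TensorAlgebra.lift_ι_apply]
  rw [h]; rfl

variable (V) in
/-- The map `u ⊗ v ↦ u (1 ⊗ v)` to the induced module. -/
def toInd : U ⊗[ℂ] V →ₗ[ℂ] Ind V :=
  TensorProduct.lift (LinearMap.mk₂ ℂ (fun u v => indRep V u (1 ⊗ₜ v))
    (fun u u' v => by rw [map_add, LinearMap.add_apply])
    (fun c u v => by rw [map_smul, LinearMap.smul_apply])
    (fun u v v' => by rw [TensorProduct.tmul_add, map_add])
    (fun c u v => by rw [TensorProduct.tmul_smul, map_smul]))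

theorem toInd_smul (u : U) (t : U ⊗[ℂ] V) : toInd V (u • t) = indRep V u (toInd V t) := by
  induction t using TensorProduct.induction_on with
  | zero => simp
  | tmul u' v =>
    change indRep V (u * u') _ = indRep V u (indRep V u' _)
    rw [map_mul]; rfl
  | add s t hs ht => rw [smul_add, map_add, map_add, map_add, hs, ht]

theorem toInd_toU (x : L) (v : V) :
    toInd V (toU x ⊗ₜ v) = toUNeg x ⊗ₜ v + 1 ⊗ₜ ⁅toG0 x, v⁆ := by
  change indRep V (toU x) _ = _
  rw [indRep_toU, indHom_one]

theorem toInd_vermaRel (t : U ⊗[ℂ] V) (ht : t ∈ vermaRel V) : toInd V t = 0 := by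
  induction ht using Submodule.span_induction with
  | mem t ht =>
    obtain ⟨x, hx, v, rfl⟩ := ht
    have h1 : toInd V (1 ⊗ₜ ⁅toG0 x, v⁆) = 1 ⊗ₜ ⁅toG0 x, v⁆ := by
      change indRep V 1 _ = _
      rw [map_one]; rfl
    rw [map_sub, toInd_toU, h1, ← toUNeg_proj, (mem_L0_iff x).1 hx, map_zero,
      TensorProduct.zero_tmul, zero_add, sub_self]
  | zero => exact map_zero _
  | add s t _ _ hs ht => rw [map_add, hs, ht, add_zero]
  | smul u t _ ht => rw [toInd_smul, ht, map_zero]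

/-- The algebra homomorphism from `U(L₋)` to the dual numbers which maps an odd element to `ε` times
its `(i, j)` coefficient and kills `𝔤₋₂`. -/
def UNeg.coeffHom (i j : Fin 5) : UNeg →ₐ[ℂ] DualNumber ℂ :=
  UNeg.lift
    { toFun := fun x => TrivSqZeroExt.inr (MvPowerSeries.constantCoeff (x.2.1 i j))
      map_add' := fun x y => TrivSqZeroExt.ext (by simp) (by simp)
      map_smul' := fun c x => TrivSqZeroExt.ext (by simp) (by simp) }
    (fun x => by simp [proj])
    (fun x Y => by simp [brL_apply, brEO, lieDeriv, proj, pd])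
    (fun x w => by simp [brL_apply, brEO, lieDeriv, proj, pd])

theorem UNeg.coeffHom_toUNeg (i j : Fin 5) (x : L) : UNeg.coeffHom i j (toUNeg x) =
    TrivSqZeroExt.inr (MvPowerSeries.constantCoeff (x.2.1 i j)) := UNeg.lift_apply _ _ _ _ _

/-- The elements `dᵢⱼ ⊗ v`, `i < j`, of `M(V)` satisfy no relations besides those coming from `V`.
They are separated by the maps `M(V) → U(L₋) ⊗ V → V`, the last one given by the coefficients of
`dᵢⱼ`. The statement accounts for `dⱼᵢ = -dᵢⱼ`. -/
theorem eq_of_sum_tens_eq_zero (v : Fin 5 → Fin 5 → V)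
    (h : ∑ i, ∑ j, tens (toU (d i j)) (v i j) = 0) (i j : Fin 5) : v i j = v j i := by
  have h1 : ∑ i, ∑ j, toU (d i j) ⊗ₜ[ℂ] v i j ∈ vermaRel V := by
    rw [← Submodule.Quotient.mk_eq_zero, ← Submodule.mkQ_apply]
    rw [map_sum]
    simp only [map_sum]
    exact h
  have h2 := toInd_vermaRel _ h1
  have h0 : ∀ i j, toG0 (d i j) = 0 := fun i j => by ext; simp [toG0, d]
  simp only [map_sum, toInd_toU, h0, zero_lie, TensorProduct.tmul_zero, add_zero] at h2
  have h3 := congrArg ((TensorProduct.lid ℂ V).toLinearMap ∘ₗ TensorProduct.map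
    (TrivSqZeroExt.sndHom ℂ ℂ ∘ₗ (UNeg.coeffHom i j).toLinearMap) LinearMap.id) h2
  have h4 : ∀ i' j', MvPowerSeries.constantCoeff ((d i' j').2.1 i j) =
      (if i = i' ∧ j = j' then 1 else 0) - (if i = j' ∧ j = i' then 1 else 0 : ℂ) := by
    intro i' j'; simp [d]
  simp only [map_sum, map_zero, LinearMap.comp_apply, TensorProduct.map_tmul,
    AlgHom.toLinearMap_apply, UNeg.coeffHom_toUNeg, h4, TrivSqZeroExt.sndHom_apply,
    TrivSqZeroExt.snd_inr, LinearEquiv.coe_coe, TensorProduct.lid_tmul, LinearMap.id_apply] at h3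
  simp [sub_smul, ite_and, Finset.sum_sub_distrib] at h3
  exact sub_eq_zero.1 h3

/-- The morphism `∑ dᵢⱼ ⊗ θᵢⱼ` vanishes on `M(N)` if and only if all the operators vanish on `N`. -/
theorem isNabla_comp_eq_zero_iff (θ : Fin 5 → Fin 5 → V →ₗ[ℂ] V) (φ : Verma V →ₗ[U] Verma V)
    (h : IsNabla θ φ) (hθ : ∀ i j v, θ j i v = - θ i j v) (N : LieSubmodule ℂ sl5 V) :
    φ ∘ₗ Verma.map N.incl = 0 ↔ ∀ i j, ∀ v ∈ N, θ i j v = 0 := by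
  have h1 : ∀ v : N, (φ ∘ₗ Verma.map N.incl) (tens 1 v) =
    ∑ i, ∑ j, tens (toU (d i j)) (θ i j (v : V)) := fun v => h v
  constructor
  · intro h0 i j v hv
    have h2 := h1 ⟨v, hv⟩
    rw [h0, LinearMap.zero_apply] at h2
    have h3 := eq_of_sum_tens_eq_zero _ h2.symm i j
    dsimp only at h3
    rw [hθ i j, eq_neg_iff_add_eq_zero, ← two_smul ℂ] at h3
    exact (smul_eq_zero.1 h3).resolve_left two_ne_zero
  · intro h0
    refine Submodule.linearMap_qext _ (TensorProduct.AlgebraTensorModule.curry_injective ?_)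
    refine LinearMap.ext fun u => LinearMap.ext fun v => ?_
    change (φ ∘ₗ Verma.map N.incl) (tens u v) = 0
    have h2 : (tens u v : Verma N) = u • tens 1 v := by rw [smul_tens, mul_one]
    rw [h2, map_smul, h1]
    simp only [h0 _ _ _ v.2, ← tensHom_apply, map_zero, Finset.sum_const_zero, smul_zero]

end InducedModule

open MvPolynomial

/-! ### The Fischer inner product -/

section Fischer

open ComplexConjugate

variable {ι : Type}

/-- The product of the factorials of the exponents. -/
def multiFactorial (k : ι →₀ ℕ) : ℕ := k.prod fun _ a => a.factorial

theorem multiFactorial_pos (k : ι →₀ ℕ) : 0 < multiFactorial k :=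
  Finset.prod_pos fun _ _ => Nat.factorial_pos _

theorem multiFactorial_add_single (k : ι →₀ ℕ) (s : ι) :
    multiFactorial (k + Finsupp.single s 1) = (k s + 1) * multiFactorial k := by
  classical
  have h : ∀ k : ι →₀ ℕ, k.support ⊆ insert s k.support := fun k => Finset.subset_insert _ _
  have e : ∀ k' : ι →₀ ℕ, k'.support ⊆ insert s k.support → multiFactorial k' =
      (k' s).factorial * ∏ i ∈ k.support.erase s, (k' i).factorial := by
    intro k' hk'
    have hk'' : k'.support ⊆ insert s (k.support.erase s) := fun i hi => by
      have := hk' hi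
      simp only [Finset.mem_insert, Finset.mem_erase] at this ⊢
      tauto
    rw [multiFactorial, Finsupp.prod_of_support_subset _ hk'' _ (fun _ _ => rfl)]
    rw [Finset.prod_insert (Finset.notMem_erase _ _)]
  rw [e k (h k), e (k + Finsupp.single s 1)]
  · rw [← mul_assoc]
    congr 1
    · simp [Nat.factorial_succ]
    · refine Finset.prod_congr rfl fun i hi => ?_
      simp [(Finset.ne_of_mem_erase hi).symm]
  · intro i hi
    by_cases his : i = s
    · simp [his]
    · simp only [Finsupp.mem_support_iff, Finsupp.add_apply, Finsupp.single_apply,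
        if_neg (Ne.symm his), add_zero] at hi
      exact Finset.mem_insert_of_mem (Finsupp.mem_support_iff.2 hi)

/-- The Fischer inner product on polynomials: the monomials are orthogonal and the norm square of
`Xᵏ` is `k!`. Multiplication by a variable is adjoint to the partial derivative. -/
def fischer (f g : MvPolynomial ι ℂ) : ℂ :=
  ∑ k ∈ f.support, (multiFactorial k : ℂ) * conj (coeff k f) * coeff k g

theorem fischer_eq_sum {f : MvPolynomial ι ℂ} {s : Finset (ι →₀ ℕ)} (h : f.support ⊆ s)
    (g : MvPolynomial ι ℂ) :
    fischer f g = ∑ k ∈ s, (multiFactorial k : ℂ) * conj (coeff k f) * coeff k g := by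
  refine Finset.sum_subset h fun k _ hk => ?_
  rw [notMem_support_iff.1 hk, map_zero, mul_zero, zero_mul]

theorem fischer_eq_sum' {g : MvPolynomial ι ℂ} {s : Finset (ι →₀ ℕ)} (h : g.support ⊆ s)
    (f : MvPolynomial ι ℂ) :
    fischer f g = ∑ k ∈ s, (multiFactorial k : ℂ) * conj (coeff k f) * coeff k g := by
  classical
  rw [fischer_eq_sum (Finset.subset_union_left : f.support ⊆ f.support ∪ s)]
  refine (Finset.sum_subset Finset.subset_union_right fun k _ hk => ?_).symm
  rw [notMem_support_iff.1 (fun h' => hk (h h')), mul_zero]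

theorem fischer_add_right (f g g' : MvPolynomial ι ℂ) :
    fischer f (g + g') = fischer f g + fischer f g' := by
  simp only [fischer, coeff_add, mul_add, Finset.sum_add_distrib]

theorem fischer_smul_right (c : ℂ) (f g : MvPolynomial ι ℂ) :
    fischer f (c • g) = c * fischer f g := by
  simp only [fischer, coeff_smul, smul_eq_mul, Finset.mul_sum]
  exact Finset.sum_congr rfl fun _ _ => by ring

theorem fischer_symm (f g : MvPolynomial ι ℂ) : conj (fischer f g) = fischer g f := by
  rw [fischer_eq_sum' (subset_refl f.support) g, fischer, map_sum]
  refine Finset.sum_congr rfl fun k _ => ?_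
  simp only [map_mul, Complex.conj_conj, map_natCast]
  ring

theorem fischer_add_left (f f' g : MvPolynomial ι ℂ) :
    fischer (f + f') g = fischer f g + fischer f' g := by
  rw [← fischer_symm, fischer_add_right, map_add, fischer_symm, fischer_symm]

theorem fischer_smul_left (c : ℂ) (f g : MvPolynomial ι ℂ) :
    fischer (c • f) g = conj c * fischer f g := by
  rw [← fischer_symm, fischer_smul_right, map_mul, fischer_symm]

theorem fischer_zero_left (g : MvPolynomial ι ℂ) : fischer 0 g = 0 := by simp [fischer]

theorem fischer_zero_right (g : MvPolynomial ι ℂ) : fischer g 0 = 0 := by simp [fischer]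

theorem fischer_eq_zero_symm {f g : MvPolynomial ι ℂ} : fischer f g = 0 ↔ fischer g f = 0 := by
  rw [← fischer_symm, map_eq_zero]

theorem fischer_self (f : MvPolynomial ι ℂ) : fischer f f =
    ((∑ k ∈ f.support, (multiFactorial k : ℝ) * Complex.normSq (coeff k f) : ℝ) : ℂ) := by
  rw [fischer, Complex.ofReal_sum]
  refine Finset.sum_congr rfl fun k _ => ?_
  rw [Complex.ofReal_mul, Complex.normSq_eq_conj_mul_self, mul_assoc]
  simp

theorem eq_zero_of_fischer_self (f : MvPolynomial ι ℂ) (h : fischer f f = 0) : f = 0 := by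
  rw [fischer_self, Complex.ofReal_eq_zero, Finset.sum_eq_zero_iff_of_nonneg fun k _ =>
    mul_nonneg (Nat.cast_nonneg _) (Complex.normSq_nonneg _)] at h
  ext k
  by_contra hk
  have h1 := h k (mem_support_iff.2 hk)
  rw [mul_eq_zero, Complex.normSq_eq_zero, Nat.cast_eq_zero] at h1
  rcases h1 with h1 | h1
  · exact (multiFactorial_pos k).ne' h1
  · exact hk h1

theorem fischer_monomial (k : ι →₀ ℕ) (g : MvPolynomial ι ℂ) :
    fischer (monomial k 1) g = multiFactorial k * coeff k g := by
  classical
  rw [fischer_eq_sum (s := {k}) support_monomial_subset]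
  simp

theorem fischer_X_mul (s : ι) (f g : MvPolynomial ι ℂ) :
    fischer (X s * f) g = fischer f (pderiv s g) := by
  rw [fischer, support_X_mul, Finset.sum_map, fischer]
  refine Finset.sum_congr rfl fun k _ => ?_
  rw [addLeftEmbedding_apply, coeff_X_mul, coeff_pderiv, add_comm (Finsupp.single s 1),
    multiFactorial_add_single]
  push_cast
  ring

theorem fischer_pderiv (s : ι) (f g : MvPolynomial ι ℂ) :
    fischer (pderiv s f) g = fischer f (X s * g) := by
  rw [← fischer_symm, ← fischer_X_mul, fischer_symm]

theorem fischer_X_mul_pderiv (s t : ι) (f g : MvPolynomial ι ℂ) :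
    fischer (X s * pderiv t f) g = fischer f (X t * pderiv s g) := by
  rw [fischer_X_mul, fischer_pderiv]

/-- The Fischer inner product as an inner product in the sense of Mathlib. -/
@[reducible] def fischerCore (ι : Type) : InnerProductSpace.Core ℂ (MvPolynomial ι ℂ) where
  inner := fischer
  conj_inner_symm f g := fischer_symm g f
  re_inner_nonneg f := by
    rw [fischer_self]
    exact Finset.sum_nonneg fun k _ => mul_nonneg (Nat.cast_nonneg _) (Complex.normSq_nonneg _)
  add_left := fischer_add_left
  smul_left f g c := fischer_smul_left c f g
  definite := eq_zero_of_fischer_self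

/-- Orthogonal projection to a finite-dimensional subspace. -/
theorem exists_fischer_decomp (H : Submodule ℂ (MvPolynomial ι ℂ)) [FiniteDimensional ℂ H]
    (f : MvPolynomial ι ℂ) : ∃ h ∈ H, ∀ h' ∈ H, fischer h' (f - h) = 0 := by
  let := (fischerCore ι).toNormedAddCommGroup
  let := InnerProductSpace.ofCore (fischerCore ι).toCore
  obtain ⟨y, hy, z, hz, rfl⟩ := H.exists_add_mem_mem_orthogonal f
  refine ⟨y, hy, fun h' hh => ?_⟩
  rw [add_sub_cancel_left]
  exact hz h' hh

end Fischer

/-! ### Bidegrees -/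

section Bihom

variable {σ τ : Type}

/-- The bidegree of a monomial in two groups of variables. -/
def bideg : (σ ⊕ τ →₀ ℕ) →+ ℕ × ℕ :=
  Finsupp.weight (Sum.elim (fun _ => ((1 : ℕ), (0 : ℕ))) (fun _ => ((0 : ℕ), (1 : ℕ))))

theorem mem_bihom {m n : ℕ} {f : MvPolynomial (σ ⊕ τ) ℂ} :
    f ∈ bihom m n ↔ ∀ k, coeff k f ≠ 0 → bideg k = (m, n) := Iff.rfl

theorem bideg_single (s : σ ⊕ τ) (a : ℕ) : bideg (Finsupp.single s a) =
    a • Sum.elim (fun _ => ((1 : ℕ), (0 : ℕ))) (fun _ => ((0 : ℕ), (1 : ℕ))) s := by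
  rw [bideg, Finsupp.weight_single]

theorem bideg_apply [Fintype σ] [Fintype τ] (k : σ ⊕ τ →₀ ℕ) :
    bideg k = (∑ s, k (Sum.inl s), ∑ t, k (Sum.inr t)) := by
  rw [bideg, Finsupp.weight_apply, Finsupp.sum_fintype _ _ (by simp),
    Fintype.sum_sum_type]
  ext <;> simp [Prod.fst_sum, Prod.snd_sum]

theorem X_mul_pderiv_mem_bihom {m n : ℕ} {f : MvPolynomial (σ ⊕ τ) ℂ} (hf : f ∈ bihom m n)
    (s t : σ ⊕ τ) (h : bideg (Finsupp.single s 1) = bideg (Finsupp.single t 1)) :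
    X s * pderiv t f ∈ bihom m n := by
  classical
  rw [mem_bihom] at *
  intro k hk
  rw [coeff_X_mul'] at hk
  split_ifs at hk with hs
  · rw [coeff_pderiv] at hk
    rw [← hf _ (left_ne_zero_of_mul hk), map_add, ← h, ← map_add, tsub_add_cancel_of_le]
    rw [Finsupp.single_le_iff]
    exact Nat.one_le_iff_ne_zero.2 (Finsupp.mem_support_iff.1 hs)
  · exact absurd rfl hk

theorem fischer_bihom {m n m' n' : ℕ} {f g : MvPolynomial (σ ⊕ τ) ℂ} (hf : f ∈ bihom m n)
    (hg : g ∈ bihom m' n') (h : (m, n) ≠ (m', n')) : fischer f g = 0 := by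
  refine Finset.sum_eq_zero fun k hk => ?_
  have h1 := hf (mem_support_iff.1 hk)
  by_contra h0
  exact h (h1.symm.trans (hg (right_ne_zero_of_mul h0)))

/-- The component of bidegree `p` of a polynomial. -/
def bicomp (p : ℕ × ℕ) : MvPolynomial (σ ⊕ τ) ℂ →ₗ[ℂ] MvPolynomial (σ ⊕ τ) ℂ :=
  weightedHomogeneousComponent
    (Sum.elim (fun _ => ((1 : ℕ), (0 : ℕ))) (fun _ => ((0 : ℕ), (1 : ℕ)))) p

theorem coeff_bicomp (p : ℕ × ℕ) (f : MvPolynomial (σ ⊕ τ) ℂ) (k : σ ⊕ τ →₀ ℕ) :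
    coeff k (bicomp p f) = if bideg k = p then coeff k f else 0 :=
  coeff_weightedHomogeneousComponent _ _ _

theorem bicomp_of_mem {m n : ℕ} {f : MvPolynomial (σ ⊕ τ) ℂ} (hf : f ∈ bihom m n) (p : ℕ × ℕ) :
    bicomp p f = if p = (m, n) then f else 0 := by
  ext k
  rw [coeff_bicomp]
  by_cases hk : coeff k f = 0
  · split_ifs <;> simp [hk]
  · rw [mem_bihom.1 hf k hk]
    split_ifs with h1 h2 h2
    · rfl
    · exact absurd h1.symm h2
    · exact absurd h2.symm h1
    · simp

theorem fischer_bicomp {m n : ℕ} {h : MvPolynomial (σ ⊕ τ) ℂ} (hh : h ∈ bihom m n) (p : ℕ × ℕ)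
    (f : MvPolynomial (σ ⊕ τ) ℂ) :
    fischer h (bicomp p f) = if p = (m, n) then fischer h f else 0 := by
  split_ifs with hp
  · refine Finset.sum_congr rfl fun k hk => ?_
    rw [coeff_bicomp, if_pos ((mem_bihom.1 hh k (mem_support_iff.1 hk)).trans hp.symm)]
  · refine Finset.sum_eq_zero fun k hk => ?_
    rw [coeff_bicomp, if_neg fun h => hp (h.symm.trans (mem_bihom.1 hh k (mem_support_iff.1 hk))),
      mul_zero]

instance bihom_finite [Finite σ] [Finite τ] (m n : ℕ) :
    FiniteDimensional ℂ (bihom m n : Submodule ℂ (MvPolynomial (σ ⊕ τ) ℂ)) := by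
  have := Fintype.ofFinite σ
  have := Fintype.ofFinite τ
  have h := weightedHomogeneousSubmodule_fg (R := ℂ) (σ := σ ⊕ τ) (fun _ => 1)
    (fun _ => one_ne_zero) (m + n)
  have : FiniteDimensional ℂ (weightedHomogeneousSubmodule ℂ (fun _ : σ ⊕ τ => 1) (m + n)) :=
    Module.Finite.iff_fg.2 h
  refine Submodule.finiteDimensional_of_le (fun f hf => ?_ :
    _ ≤ weightedHomogeneousSubmodule ℂ (fun _ : σ ⊕ τ => 1) (m + n))
  intro k hk
  have h1 := mem_bihom.1 hf k hk
  rw [bideg_apply, Prod.mk.injEq] at h1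
  rw [Finsupp.weight_apply, Finsupp.sum_fintype _ _ (by simp),
    Fintype.sum_sum_type, ← h1.1, ← h1.2]
  simp

end Bihom

/-! ### Highest components and their complements -/

section Highest

variable {σ τ : Type}

/-- The exponent of the highest monomial `X_{s₀}ᵐ X_{t₀}ⁿ`. -/
def topExp (s₀ : σ) (t₀ : τ) (m n : ℕ) : σ ⊕ τ →₀ ℕ :=
  Finsupp.single (Sum.inl s₀) m + Finsupp.single (Sum.inr t₀) n

theorem bideg_topExp (s₀ : σ) (t₀ : τ) (m n : ℕ) : bideg (topExp s₀ t₀ m n) = (m, n) := by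
  rw [topExp, map_add, bideg_single, bideg_single]
  simp

theorem monomial_topExp (s₀ : σ) (t₀ : τ) (m n : ℕ) :
    (monomial (topExp s₀ t₀ m n) 1 : MvPolynomial (σ ⊕ τ) ℂ) =
      X (Sum.inl s₀) ^ m * X (Sum.inr t₀) ^ n := by
  rw [topExp, X_pow_eq_monomial, X_pow_eq_monomial, monomial_mul, mul_one]

section

variable [LieRingModule sl5 (MvPolynomial (σ ⊕ τ) ℂ)]

/-- The submodule generated by the highest monomial `X_{s₀}ᵐ X_{t₀}ⁿ`. -/
def high (s₀ : σ) (t₀ : τ) (m n : ℕ) : LieSubmodule ℂ sl5 (MvPolynomial (σ ⊕ τ) ℂ) :=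
  LieSubmodule.lieSpan ℂ sl5 {X (Sum.inl s₀) ^ m * X (Sum.inr t₀) ^ n}

theorem monomial_mem_high (s₀ : σ) (t₀ : τ) (m n : ℕ) :
    monomial (topExp s₀ t₀ m n) 1 ∈ high s₀ t₀ m n := by
  rw [monomial_topExp]
  exact LieSubmodule.subset_lieSpan rfl

theorem high_le_iSup {s₀ : σ} {t₀ : τ} (m n : ℕ) : high s₀ t₀ m n ≤ ⨆ m, ⨆ n, high s₀ t₀ m n :=
  le_iSup_of_le m (le_iSup (fun n => high s₀ t₀ m n) n)

theorem high_le_of_mem {s₀ : σ} {t₀ : τ} {m n : ℕ} {N : LieSubmodule ℂ sl5 (MvPolynomial (σ ⊕ τ) ℂ)}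
    (hN : monomial (topExp s₀ t₀ m n) 1 ∈ N) : high s₀ t₀ m n ≤ N := by
  rw [monomial_topExp] at hN
  exact LieSubmodule.lieSpan_le.2 (Set.singleton_subset_iff.2 hN)

end

variable [Fintype σ] [Fintype τ]

/-- Among the monomials of bidegree `(m, n)`, the highest monomial is determined by its weight. -/
theorem eq_topExp (s₀ : σ) (t₀ : τ) (c : σ ⊕ τ → ℤ)
    (hs : ∀ s, s ≠ s₀ → c (Sum.inl s) < c (Sum.inl s₀))
    (ht : ∀ t, t ≠ t₀ → c (Sum.inr t) < c (Sum.inr t₀)) (m n : ℕ) (k : σ ⊕ τ →₀ ℕ)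
    (hk : bideg k = (m, n))
    (hc : ∑ i, (k i : ℤ) * c i = ∑ i, (topExp s₀ t₀ m n i : ℤ) * c i) : k = topExp s₀ t₀ m n := by
  classical
  rw [bideg_apply, Prod.mk.injEq] at hk
  have h1 : ∑ i, (topExp s₀ t₀ m n i : ℤ) * c i = m * c (Sum.inl s₀) + n * c (Sum.inr t₀) := by
    simp [topExp, Fintype.sum_sum_type, Finsupp.single_apply]
  rw [h1, Fintype.sum_sum_type] at hc
  have h2 : ∑ s, (k (Sum.inl s) : ℤ) * (c (Sum.inl s₀) - c (Sum.inl s)) +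
      ∑ t, (k (Sum.inr t) : ℤ) * (c (Sum.inr t₀) - c (Sum.inr t)) = 0 := by
    simp only [mul_sub, Finset.sum_sub_distrib, ← Finset.sum_mul]
    have e1 : ∑ s, (k (Sum.inl s) : ℤ) = m := by exact_mod_cast hk.1
    have e2 : ∑ t, (k (Sum.inr t) : ℤ) = n := by exact_mod_cast hk.2
    rw [e1, e2]
    linarith
  have p1 : ∀ s ∈ Finset.univ, 0 ≤ (k (Sum.inl s) : ℤ) * (c (Sum.inl s₀) - c (Sum.inl s)) := by
    intro s _
    rcases eq_or_ne s s₀ with rfl | h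
    · simp
    · exact mul_nonneg (Nat.cast_nonneg _) (sub_nonneg.2 (hs s h).le)
  have p2 : ∀ t ∈ Finset.univ, 0 ≤ (k (Sum.inr t) : ℤ) * (c (Sum.inr t₀) - c (Sum.inr t)) := by
    intro t _
    rcases eq_or_ne t t₀ with rfl | h
    · simp
    · exact mul_nonneg (Nat.cast_nonneg _) (sub_nonneg.2 (ht t h).le)
  obtain ⟨z1, z2⟩ := (add_eq_zero_iff_of_nonneg (Finset.sum_nonneg p1) (Finset.sum_nonneg p2)).1 h2
  rw [Finset.sum_eq_zero_iff_of_nonneg p1] at z1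
  rw [Finset.sum_eq_zero_iff_of_nonneg p2] at z2
  have k1 : ∀ s, s ≠ s₀ → k (Sum.inl s) = 0 := fun s h => by
    have := (mul_eq_zero.1 (z1 s (Finset.mem_univ _))).resolve_right (sub_pos.2 (hs s h)).ne'
    exact_mod_cast this
  have k2 : ∀ t, t ≠ t₀ → k (Sum.inr t) = 0 := fun t h => by
    have := (mul_eq_zero.1 (z2 t (Finset.mem_univ _))).resolve_right (sub_pos.2 (ht t h)).ne'
    exact_mod_cast this
  rw [Finset.sum_eq_single s₀ (fun s _ h => k1 s h) (by simp),
    Finset.sum_eq_single t₀ (fun t _ h => k2 t h) (by simp)] at hk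
  ext i
  rcases i with s | t
  · rcases eq_or_ne s s₀ with rfl | h
    · simp [topExp, hk.1]
    · simp [topExp, k1 s h, h.symm]
  · rcases eq_or_ne t t₀ with rfl | h
    · simp [topExp, hk.2]
    · simp [topExp, k2 t h, h.symm]

variable [LieRingModule sl5 (MvPolynomial (σ ⊕ τ) ℂ)]

/-- What the arguments below use about the action of `sl₅` on the polynomials in two groups of
variables: it preserves bidegrees, it is unitary for the Fischer inner product up to an involution
of `sl₅`, and some element of the Cartan subalgebra acts by a weight which is largest, in each group
of variables, for exactly one variable. -/
structure UnitaryAction (σ τ : Type) [Fintype σ] [Fintype τ]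
    [LieRingModule sl5 (MvPolynomial (σ ⊕ τ) ℂ)] (s₀ : σ) (t₀ : τ) : Prop where
  lie_mem_bihom : ∀ (A : sl5) (m n : ℕ) (f : MvPolynomial (σ ⊕ τ) ℂ), f ∈ bihom m n →
    ⁅A, f⁆ ∈ bihom m n
  exists_adjoint : ∀ A : sl5, ∃ B : sl5, ∀ f g : MvPolynomial (σ ⊕ τ) ℂ,
    fischer ⁅A, f⁆ g = fischer f ⁅B, g⁆
  exists_weight : ∃ (D : sl5) (c : σ ⊕ τ → ℤ),
    (∀ f : MvPolynomial (σ ⊕ τ) ℂ, ⁅D, f⁆ = ∑ i, (c i : ℂ) • (X i * pderiv i f)) ∧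
    (∀ s, s ≠ s₀ → c (Sum.inl s) < c (Sum.inl s₀)) ∧ ∀ t, t ≠ t₀ → c (Sum.inr t) < c (Sum.inr t₀)

namespace UnitaryAction

variable {s₀ : σ} {t₀ : τ}

theorem high_le_bihom (h : UnitaryAction σ τ s₀ t₀) (m n : ℕ) :
    (high s₀ t₀ m n).toSubmodule ≤ bihom m n := by
  let B : LieSubmodule ℂ sl5 (MvPolynomial (σ ⊕ τ) ℂ) :=
    { bihom m n with lie_mem := fun {A f} hf => h.lie_mem_bihom A m n f hf }
  exact high_le_of_mem (N := B) (isWeightedHomogeneous_monomial _ _ _ (bideg_topExp s₀ t₀ m n))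

/-- The orthogonal complement of a submodule. -/
def orth (h : UnitaryAction σ τ s₀ t₀) (N : LieSubmodule ℂ sl5 (MvPolynomial (σ ⊕ τ) ℂ)) :
    LieSubmodule ℂ sl5 (MvPolynomial (σ ⊕ τ) ℂ) where
  carrier := {f | ∀ g ∈ N, fischer g f = 0}
  add_mem' {a b} ha hb g hg := by rw [fischer_add_right, ha g hg, hb g hg, add_zero]
  zero_mem' g _ := fischer_zero_right g
  smul_mem' c f hf g hg := by rw [fischer_smul_right, hf g hg, mul_zero]
  lie_mem {A f} hf g hg := by
    obtain ⟨B, hB⟩ := h.exists_adjoint A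
    rw [fischer_eq_zero_symm, hB, fischer_eq_zero_symm]
    exact hf _ (N.lie_mem hg)

/-- A submodule in bidegree `(m, n)` contains the highest monomial if this monomial occurs in one of
its elements, because the monomial has a weight of multiplicity one. -/
theorem monomial_mem_of_coeff_ne_zero (h : UnitaryAction σ τ s₀ t₀) {m n : ℕ}
    {N : LieSubmodule ℂ sl5 (MvPolynomial (σ ⊕ τ) ℂ)} (hN : N.toSubmodule ≤ bihom m n)
    {f : MvPolynomial (σ ⊕ τ) ℂ} (hf : f ∈ N) (hc : coeff (topExp s₀ t₀ m n) f ≠ 0) :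
    monomial (topExp s₀ t₀ m n) 1 ∈ N := by
  classical
  obtain ⟨D, c, hD, hs, ht⟩ := h.exists_weight
  have hDc : ∀ f k, coeff k ⁅D, f⁆ = ((∑ i, (k i : ℤ) * c i : ℤ) : ℂ) * coeff k f := by
    intro f k
    have e : ∀ i, coeff k (X i * pderiv i f) = k i * coeff k f := by
      intro i
      induction f using MvPolynomial.induction_on' with
      | monomial k' a =>
        rw [X_mul_pderiv_monomial, coeff_smul, nsmul_eq_mul, coeff_monomial]
        split_ifs with hk
        · rw [hk]
        · simp
      | add p q hp hq => rw [map_add, mul_add, coeff_add, hp, hq, coeff_add, mul_add]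
    simp only [hD, coeff_sum, coeff_smul, e, smul_eq_mul]
    push_cast
    rw [Finset.sum_mul]
    exact Finset.sum_congr rfl fun i _ => by ring
  -- if another monomial occurs in `f`, apply `D - μ` for its eigenvalue `μ`: this shrinks the
  -- support and keeps the highest monomial, whose eigenvalue is different
  induction hr : f.support.card using Nat.strong_induction_on generalizing f with
  | _ r IH =>
    by_cases h1 : ∃ k ∈ f.support, k ≠ topExp s₀ t₀ m n
    · obtain ⟨k, hk, hne⟩ := h1
      set μ : ℂ := ((∑ i, (k i : ℤ) * c i : ℤ) : ℂ) with hμ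
      have hg : ⁅D, f⁆ - μ • f ∈ N := N.sub_mem (N.lie_mem hf) (N.smul_mem _ hf)
      have hcg : ∀ k', coeff k' (⁅D, f⁆ - μ • f) =
          (((∑ i, (k' i : ℤ) * c i : ℤ) : ℂ) - μ) * coeff k' f := by
        intro k'
        rw [coeff_sub, hDc, coeff_smul, smul_eq_mul, sub_mul]
      refine IH _ ?_ hg ?_ rfl
      · rw [← hr]
        refine Finset.card_lt_card ⟨fun k' hk' => ?_, fun hsub => ?_⟩
        · rw [mem_support_iff, hcg] at hk'
          exact mem_support_iff.2 (right_ne_zero_of_mul hk')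
        · have := mem_support_iff.1 (hsub hk)
          rw [hcg, hμ, sub_self, zero_mul] at this
          exact this rfl
      · rw [hcg]
        refine mul_ne_zero (fun h0 => hne ?_) hc
        rw [sub_eq_zero, hμ, Int.cast_inj] at h0
        exact eq_topExp s₀ t₀ c hs ht m n k (mem_bihom.1 (hN hf) k (mem_support_iff.1 hk)) h0.symm
    · push Not at h1
      have : f = coeff (topExp s₀ t₀ m n) f • monomial (topExp s₀ t₀ m n) 1 := by
        ext k
        rw [coeff_smul, coeff_monomial]
        split_ifs with hk
        · rw [hk]; simp
        · rw [smul_zero]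
          by_contra h0
          exact hk (h1 k (mem_support_iff.2 h0)).symm
      have h2 := N.smul_mem (coeff (topExp s₀ t₀ m n) f)⁻¹ hf
      rwa [this, coeff_smul, smul_smul, coeff_monomial, if_pos rfl, smul_eq_mul, mul_one,
        inv_mul_cancel₀ hc, one_smul] at h2

/-- A submodule in bidegree `(m, n)` contains the highest component or is orthogonal to it. -/
theorem high_le_or_le_orth (h : UnitaryAction σ τ s₀ t₀) {m n : ℕ}
    {N : LieSubmodule ℂ sl5 (MvPolynomial (σ ⊕ τ) ℂ)} (hN : N.toSubmodule ≤ bihom m n) :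
    high s₀ t₀ m n ≤ N ∨ N ≤ h.orth (high s₀ t₀ m n) := by
  by_cases h1 : ∃ f ∈ N, coeff (topExp s₀ t₀ m n) f ≠ 0
  · obtain ⟨f, hf, hc⟩ := h1
    exact Or.inl (high_le_of_mem (h.monomial_mem_of_coeff_ne_zero hN hf hc))
  · push Not at h1
    right
    have h2 : high s₀ t₀ m n ≤ h.orth N := high_le_of_mem fun g hg => by
      rw [fischer_eq_zero_symm, fischer_monomial, h1 g hg, mul_zero]
    exact fun f hf g hg => fischer_eq_zero_symm.1 (h2 hg f hf)

theorem disjoint_orth (h : UnitaryAction σ τ s₀ t₀)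
    (N : LieSubmodule ℂ sl5 (MvPolynomial (σ ⊕ τ) ℂ)) {f : MvPolynomial (σ ⊕ τ) ℂ}
    (hf : f ∈ N) (hf' : f ∈ h.orth N) : f = 0 := eq_zero_of_fischer_self f (hf' f hf)

/-- The complement of the highest component is its orthogonal complement in bidegree `(m, n)`. -/
theorem mem_lowPart (h : UnitaryAction σ τ s₀ t₀) {m n : ℕ} {f : MvPolynomial (σ ⊕ τ) ℂ} :
    f ∈ lowPart m n (high s₀ t₀ m n) ↔ f ∈ bihom m n ∧ f ∈ h.orth (high s₀ t₀ m n) := by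
  let B : LieSubmodule ℂ sl5 (MvPolynomial (σ ⊕ τ) ℂ) :=
    { bihom m n with lie_mem := fun {A f} hf => h.lie_mem_bihom A m n f hf }
  have hB : lowPart m n (high s₀ t₀ m n) = B ⊓ h.orth (high s₀ t₀ m n) := by
    refine le_antisymm (sSup_le fun N hN => le_inf hN.1 ?_) (le_sSup ⟨inf_le_left, ?_⟩)
    · refine (h.high_le_or_le_orth hN.1).resolve_left fun hle => ?_
      have h1 := monomial_mem_high s₀ t₀ m n
      have h2 := (LieSubmodule.disjoint_toSubmodule.2 hN.2).le_bot ⟨hle h1, h1⟩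
      exact one_ne_zero (monomial_eq_zero.1 ((Submodule.mem_bot ℂ).1 h2))
    · rw [disjoint_iff, eq_bot_iff]
      exact fun f hf => (LieSubmodule.mem_bot _).2 (h.disjoint_orth _ hf.2 hf.1.2)
  rw [hB]
  rfl

/-- The sum of the submodules `high m n` and their complements is everything. -/
theorem exists_high_add_low (h : UnitaryAction σ τ s₀ t₀) (f : MvPolynomial (σ ⊕ τ) ℂ) :
    f ∈ (⨆ m, ⨆ n, high s₀ t₀ m n) ⊔ ⨆ m, ⨆ n, lowPart m n (high s₀ t₀ m n) := by
  induction f using MvPolynomial.induction_on' with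
  | add p q hp hq => exact add_mem hp hq
  | monomial k a =>
    obtain ⟨m, n, hk⟩ : ∃ m n, bideg k = (m, n) := ⟨_, _, rfl⟩
    have hb : (monomial k a : MvPolynomial (σ ⊕ τ) ℂ) ∈ bihom m n :=
      isWeightedHomogeneous_monomial _ _ _ hk
    have : FiniteDimensional ℂ (high s₀ t₀ m n).toSubmodule :=
      Submodule.finiteDimensional_of_le (h.high_le_bihom m n)
    obtain ⟨g, hg, hg'⟩ := exists_fischer_decomp (high s₀ t₀ m n).toSubmodule (monomial k a)
    rw [← add_sub_cancel g (monomial k a)]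
    refine add_mem (LieSubmodule.mem_sup_left ?_) (LieSubmodule.mem_sup_right ?_)
    · exact high_le_iSup m n hg
    · exact LieSubmodule.mem_iSup_of_mem m (LieSubmodule.mem_iSup_of_mem n
        (h.mem_lowPart.2 ⟨sub_mem hb (h.high_le_bihom m n hg), hg'⟩))

/-- The sum of the complements is the orthogonal complement of the sum of the highest components. -/
theorem mem_low (h : UnitaryAction σ τ s₀ t₀) {f : MvPolynomial (σ ⊕ τ) ℂ} :
    f ∈ (⨆ m, ⨆ n, lowPart m n (high s₀ t₀ m n)) ↔ ∀ m n, f ∈ h.orth (high s₀ t₀ m n) := by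
  have h1 : (⨆ m, ⨆ n, lowPart m n (high s₀ t₀ m n)) ≤ ⨅ m, ⨅ n, h.orth (high s₀ t₀ m n) := by
    refine iSup_le fun m => iSup_le fun n => le_iInf fun m' => le_iInf fun n' => fun f hf => ?_
    rw [h.mem_lowPart] at hf
    by_cases hmn : (m', n') = (m, n)
    · rw [Prod.mk.injEq] at hmn
      rw [hmn.1, hmn.2]
      exact hf.2
    · exact fun g hg => fischer_bihom (h.high_le_bihom _ _ hg) hf.1 hmn
  refine ⟨fun hf m n => ?_, fun hf => ?_⟩
  · exact (LieSubmodule.mem_iInf _).1 ((LieSubmodule.mem_iInf _).1 (h1 hf) m) n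
  · obtain ⟨g, hg, l, hl, rfl⟩ := (LieSubmodule.mem_sup _ _ _).1 (h.exists_high_add_low f)
    have hg0 : g = 0 := by
      have hgl : ∀ m n, g ∈ h.orth (high s₀ t₀ m n) := fun m n => by
        have h3 := (LieSubmodule.mem_iInf _).1 ((LieSubmodule.mem_iInf _).1 (h1 hl) m) n
        simpa using sub_mem (hf m n) h3
      refine h.disjoint_orth (LieSubmodule.lieSpan ℂ sl5 {g}) (LieSubmodule.subset_lieSpan rfl) ?_
      -- orthogonality is symmetric, so it passes from the summands to their sum
      have h2 : (⨆ m, ⨆ n, high s₀ t₀ m n) ≤ h.orth (LieSubmodule.lieSpan ℂ sl5 {g}) := by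
        refine iSup_le fun m => iSup_le fun n => fun f hf k hk => ?_
        have h3 : LieSubmodule.lieSpan ℂ sl5 {g} ≤ h.orth (high s₀ t₀ m n) :=
          LieSubmodule.lieSpan_le.2 (Set.singleton_subset_iff.2 (hgl m n))
        exact fischer_eq_zero_symm.1 (h3 hk f hf)
      exact h2 hg
    rwa [hg0, zero_add]

/-- The highest component meets the sum of the complements trivially. -/
theorem eq_zero_of_mem_low (h : UnitaryAction σ τ s₀ t₀) {m n : ℕ} {f : MvPolynomial (σ ⊕ τ) ℂ}
    (hf : f ∈ high s₀ t₀ m n) (hl : f ∈ ⨆ m, ⨆ n, lowPart m n (high s₀ t₀ m n)) : f = 0 :=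
  h.disjoint_orth _ hf (h.mem_low.1 hl m n)

theorem bicomp_mem_low (h : UnitaryAction σ τ s₀ t₀) (p : ℕ × ℕ) {f : MvPolynomial (σ ⊕ τ) ℂ}
    (hf : f ∈ ⨆ m, ⨆ n, lowPart m n (high s₀ t₀ m n)) :
    bicomp p f ∈ ⨆ m, ⨆ n, lowPart m n (high s₀ t₀ m n) := by
  rw [h.mem_low] at hf ⊢
  intro m n g hg
  rw [fischer_bicomp (h.high_le_bihom m n hg)]
  split_ifs
  · exact hf m n g hg
  · rfl

/-- A submodule of the highest component is all of it or orthogonal to it. -/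
theorem isIrreducible_high [LieModule ℂ sl5 (MvPolynomial (σ ⊕ τ) ℂ)]
    (h : UnitaryAction σ τ s₀ t₀) (m n : ℕ) :
    LieModule.IsIrreducible ℂ sl5 (high s₀ t₀ m n) := by
  have hmem := monomial_mem_high s₀ t₀ m n
  have : Nontrivial (high s₀ t₀ m n) := ⟨⟨⟨_, hmem⟩, 0, fun h0 => by
    have := congrArg Subtype.val h0
    exact one_ne_zero (monomial_eq_zero.1 this)⟩⟩
  refine LieModule.IsIrreducible.mk fun N hN => ?_
  have hle : N.map (high s₀ t₀ m n).incl ≤ high s₀ t₀ m n := by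
    rw [LieSubmodule.map_le_iff_le_comap]
    exact fun x _ => x.2
  rcases h.high_le_or_le_orth (N := N.map (high s₀ t₀ m n).incl)
    (fun f hf => h.high_le_bihom m n (hle hf)) with h1 | h1
  · rw [eq_top_iff]
    intro x _
    obtain ⟨y, hy, hyx⟩ := (LieSubmodule.mem_map _).1 (h1 x.2)
    rwa [← Subtype.ext hyx]
  · refine absurd ((LieSubmodule.eq_bot_iff _).2 fun x hx => ?_) hN
    exact Subtype.ext (h.disjoint_orth _ x.2 (h1 ((LieSubmodule.mem_map _).2 ⟨x, hx, rfl⟩)))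

/-- The highest component is the irreducible module whose highest weight is the weight of the
highest monomial. -/
theorem isF_high [LieModule ℂ sl5 (MvPolynomial (σ ⊕ τ) ℂ)]
    (h : UnitaryAction σ τ s₀ t₀) {m n : ℕ} {w : Fin 4 → ℕ}
    (h0 : ∀ (i j : Fin 5) (hij : i < j), ⁅LieAlgebra.SpecialLinear.single i j hij.ne (1 : ℂ),
      (X (Sum.inl s₀) ^ m * X (Sum.inr t₀) ^ n : MvPolynomial (σ ⊕ τ) ℂ)⁆ = 0)
    (hw : ∀ i : Fin 4, ⁅LieAlgebra.SpecialLinear.singleSubSingle i.castSucc i.succ (1 : ℂ),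
      (X (Sum.inl s₀) ^ m * X (Sum.inr t₀) ^ n : MvPolynomial (σ ⊕ τ) ℂ)⁆ =
        (w i : ℂ) • (X (Sum.inl s₀) ^ m * X (Sum.inr t₀) ^ n)) :
    IsF (high s₀ t₀ m n) w where
  finite := Submodule.finiteDimensional_of_le (h.high_le_bihom m n)
  irreducible := h.isIrreducible_high m n
  highest := by
    refine ⟨⟨_, LieSubmodule.subset_lieSpan rfl⟩, fun h1 => ?_, fun i j hij => Subtype.ext ?_,
      fun i => Subtype.ext ?_⟩
    · have := (monomial_topExp s₀ t₀ m n).trans (congrArg Subtype.val h1)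
      exact one_ne_zero (monomial_eq_zero.1 this)
    · exact h0 i j hij
    · exact hw i

end UnitaryAction
end Highest

/-! ### Direct sum decompositions -/

theorem IsF.of_equiv {V W : Type} [AddCommGroup V] [Module ℂ V] [LieRingModule sl5 V]
    [LieModule ℂ sl5 V] [AddCommGroup W] [Module ℂ W] [LieRingModule sl5 W] [LieModule ℂ sl5 W]
    {n : Fin 4 → ℕ} (hV : IsF V n) (e : V ≃ₗ⁅ℂ, sl5⁆ W) : IsF W n where
  finite := by
    have := hV.finite
    exact LinearEquiv.finiteDimensional e.toLinearEquiv
  irreducible := (OrderIso.isSimpleOrder_iff (LieSubmodule.orderIsoMapComap e)).1 hV.irreducible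
  highest := by
    obtain ⟨v, hv, h1, h2⟩ := hV.highest
    refine ⟨e v, fun h0 => hv (e.injective (h0.trans (map_zero e.toLieModuleHom).symm)),
      fun i j hij => ?_, fun i => ?_⟩
    · exact (LieModuleHom.map_lie e.toLieModuleHom _ v).symm.trans
        ((congrArg e (h1 i j hij)).trans (map_zero e.toLieModuleHom))
    · exact (LieModuleHom.map_lie e.toLieModuleHom _ v).symm.trans
        ((congrArg e (h2 i)).trans (map_smul e.toLieModuleHom _ _))

/-- A family of submodules is independent if it is separated by linear maps. -/
theorem isInternal_of_separating {κ V W : Type} [DecidableEq κ] [AddCommGroup V] [Module ℂ V]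
    [LieRingModule sl5 V] [AddCommGroup W] [Module ℂ W] (P : κ → LieSubmodule ℂ sl5 V)
    (π : κ → V →ₗ[ℂ] W) (h1 : ∀ p, ∀ x ∈ P p, π p x = 0 → x = 0)
    (h0 : ∀ p q, q ≠ p → ∀ x ∈ P q, π p x = 0) (htop : ∀ x, x ∈ ⨆ p, P p) :
    DirectSum.IsInternal P := by
  refine DirectSum.isInternal_submodule_of_iSupIndep_of_iSup_eq_top
    (A := fun p => (P p).toSubmodule) (fun p => ?_) ?_
  · rw [Submodule.disjoint_def]
    intro x hx hx'
    refine h1 p x hx ?_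
    have : ⨆ q, ⨆ (_ : q ≠ p), (P q).toSubmodule ≤ LinearMap.ker (π p) :=
      iSup_le fun q => iSup_le fun hq y hy => LinearMap.mem_ker.2 (h0 p q hq y hy)
    exact LinearMap.mem_ker.1 (this hx')
  · rw [LieSubmodule.iSup_toSubmodule_eq_top, eq_top_iff]
    exact fun x _ => htop x

section Parts

variable {σ τ : Type} [Fintype σ] [Fintype τ] [LieRingModule sl5 (MvPolynomial (σ ⊕ τ) ℂ)]
  {s₀ : σ} {t₀ : τ}

/-- The sum of the highest components is direct, because they have different bidegrees. -/
theorem UnitaryAction.isInternal_sub (h : UnitaryAction σ τ s₀ t₀) :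
    DirectSum.IsInternal fun p : ℕ × ℕ =>
      (high s₀ t₀ p.1 p.2).comap (⨆ m, ⨆ n, high s₀ t₀ m n).incl := by
  refine isInternal_of_separating _
    (fun p => bicomp p ∘ₗ (⨆ m, ⨆ n, high s₀ t₀ m n).toSubmodule.subtype)
    (fun p x hx h0 => ?_) (fun p q hq x hx => ?_) fun x => ?_
  · have h1 : bicomp p x.1 = x.1 :=
      (bicomp_of_mem (h.high_le_bihom _ _ hx) p).trans (if_pos rfl)
    exact Subtype.ext (h1.symm.trans h0)
  · exact (bicomp_of_mem (h.high_le_bihom _ _ hx) p).trans (if_neg fun h' => hq h'.symm)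
  · obtain ⟨x, hx⟩ := x
    have h2 : (⨆ m, ⨆ n, high s₀ t₀ m n) ≤
        (⨆ p : ℕ × ℕ, (high s₀ t₀ p.1 p.2).comap (⨆ m, ⨆ n, high s₀ t₀ m n).incl).map
          (⨆ m, ⨆ n, high s₀ t₀ m n).incl := by
      refine iSup_le fun m => iSup_le fun n y hy => (LieSubmodule.mem_map _).2
        ⟨⟨y, high_le_iSup m n hy⟩, ?_, rfl⟩
      exact LieSubmodule.mem_iSup_of_mem (m, n) hy
    obtain ⟨y, hy, hyx⟩ := (LieSubmodule.mem_map _).1 (h2 hx)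
    have : y = ⟨x, hx⟩ := Subtype.ext hyx
    exact this ▸ hy

variable [LieModule ℂ sl5 (MvPolynomial (σ ⊕ τ) ℂ)]

/-- The quotient by the complements is the direct sum of the images of the highest components. -/
theorem UnitaryAction.isInternal_quot (h : UnitaryAction σ τ s₀ t₀) :
    DirectSum.IsInternal fun p : ℕ × ℕ => (high s₀ t₀ p.1 p.2).map
      (LieSubmodule.Quotient.mk' (⨆ m, ⨆ n, lowPart m n (high s₀ t₀ m n))) := by
  refine isInternal_of_separating _ (fun p => Submodule.mapQ
    (⨆ m, ⨆ n, lowPart m n (high s₀ t₀ m n)).toSubmodule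
    (⨆ m, ⨆ n, lowPart m n (high s₀ t₀ m n)).toSubmodule (bicomp p)
    (fun f hf => h.bicomp_mem_low p hf)) (fun p x hx h0 => ?_) (fun p q hq x hx => ?_) fun x => ?_
  · obtain ⟨y, hy, rfl⟩ := (LieSubmodule.mem_map _).1 hx
    rw [← h0]
    refine congrArg (LieSubmodule.Quotient.mk' _) (Eq.symm ?_)
    rw [bicomp_of_mem (h.high_le_bihom _ _ hy), if_pos rfl]
  · obtain ⟨y, hy, rfl⟩ := (LieSubmodule.mem_map _).1 hx
    refine (congrArg (LieSubmodule.Quotient.mk' _) (?_ : bicomp p y = 0)).trans (map_zero _)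
    rw [bicomp_of_mem (h.high_le_bihom _ _ hy), if_neg fun h' => hq h'.symm]
  · obtain ⟨f, rfl⟩ := LieSubmodule.Quotient.surjective_mk' _ x
    obtain ⟨g, hg, l, hl, rfl⟩ := (LieSubmodule.mem_sup _ _ _).1 (h.exists_high_add_low f)
    rw [map_add, (LieSubmodule.Quotient.mk_eq_zero _).2 hl, add_zero]
    have h2 : (⨆ m, ⨆ n, high s₀ t₀ m n) ≤ (⨆ p : ℕ × ℕ, (high s₀ t₀ p.1 p.2).map
        (LieSubmodule.Quotient.mk' (⨆ m, ⨆ n, lowPart m n (high s₀ t₀ m n)))).comap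
        (LieSubmodule.Quotient.mk' (⨆ m, ⨆ n, lowPart m n (high s₀ t₀ m n))) :=
      iSup_le fun m => iSup_le fun n y hy =>
        LieSubmodule.mem_iSup_of_mem (m, n) ((LieSubmodule.mem_map _).2 ⟨y, hy, rfl⟩)
    exact h2 hg

/-- The summands of the sum of the highest components, as modules. -/
def highEquivSub (s₀ : σ) (t₀ : τ) (m n : ℕ) : high s₀ t₀ m n ≃ₗ⁅ℂ, sl5⁆
    ((high s₀ t₀ m n).comap (⨆ m, ⨆ n, high s₀ t₀ m n).incl) where
  toFun x := ⟨⟨x.1, high_le_iSup m n x.2⟩, x.2⟩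
  invFun x := ⟨x.1.1, x.2⟩
  map_add' _ _ := rfl
  map_smul' _ _ := rfl
  map_lie' := rfl
  left_inv _ := rfl
  right_inv _ := rfl

/-- The highest components embed into the quotient by the complements. -/
def UnitaryAction.highEquivQuot (h : UnitaryAction σ τ s₀ t₀) (m n : ℕ) :
    high s₀ t₀ m n ≃ₗ⁅ℂ, sl5⁆ ((high s₀ t₀ m n).map
      (LieSubmodule.Quotient.mk' (⨆ m, ⨆ n, lowPart m n (high s₀ t₀ m n)))) :=
  { LinearEquiv.ofBijective (M := high s₀ t₀ m n)
      (M₂ := (high s₀ t₀ m n).map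
        (LieSubmodule.Quotient.mk' (⨆ m, ⨆ n, lowPart m n (high s₀ t₀ m n))))
      { toFun := fun x => ⟨LieSubmodule.Quotient.mk' _ x.1,
          (LieSubmodule.mem_map _).2 ⟨x.1, x.2, rfl⟩⟩
        map_add' := fun _ _ => rfl
        map_smul' := fun _ _ => rfl }
      ⟨(injective_iff_map_eq_zero _).2 fun x hx => Subtype.ext (h.eq_zero_of_mem_low x.2
          ((LieSubmodule.Quotient.mk_eq_zero _).1 (congrArg Subtype.val hx))), fun y => by
        obtain ⟨x, hx, hxy⟩ := (LieSubmodule.mem_map _).1 y.2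
        exact ⟨⟨x, hx⟩, Subtype.ext hxy⟩⟩ with
    map_lie' := rfl }

end Parts

/-! ### Operators on polynomial rings -/

section Operators

variable {ι : Type}

theorem derivation_sum_apply {κ : Type} (s : Finset κ)
    (D : κ → Derivation ℂ (MvPolynomial ι ℂ) (MvPolynomial ι ℂ)) (f : MvPolynomial ι ℂ) :
    (∑ i ∈ s, D i) f = ∑ i ∈ s, D i f := by
  classical
  induction s using Finset.induction_on with
  | empty => rfl
  | insert a s ha ih =>
    rw [Finset.sum_insert ha, Finset.sum_insert ha, Derivation.add_apply, ih]

/-- The derivation of a polynomial ring by which a matrix acts, as on a basis of `ℂ⁵`, on the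
variables `zₖ`. -/
def act1Op (z : Fin 5 → ι) (M : Matrix (Fin 5) (Fin 5) ℂ) :
    Derivation ℂ (MvPolynomial ι ℂ) (MvPolynomial ι ℂ) :=
  ∑ a, ∑ k, M a k • (X (z a) : MvPolynomial ι ℂ) • pderiv (z k)

/-- The skew-symmetric family of variables `xₖₗ`. -/
def skewX (e : Pair → ι) (k l : Fin 5) : MvPolynomial ι ℂ := skew (fun p => X (e p)) k l

/-- The skew-symmetric family of partial derivatives `∂ / ∂xₖₗ`. -/
def skewD (e : Pair → ι) (k l : Fin 5) : Derivation ℂ (MvPolynomial ι ℂ) (MvPolynomial ι ℂ) :=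
  skew (fun p => pderiv (e p)) k l

/-- The derivation by which a matrix acts, as on a basis of `Λ²ℂ⁵`, on the variables `xₖₗ`. -/
def act2Op (e : Pair → ι) (M : Matrix (Fin 5) (Fin 5) ℂ) :
    Derivation ℂ (MvPolynomial ι ℂ) (MvPolynomial ι ℂ) :=
  ∑ a, ∑ k, M a k • ∑ b, skewX e a b • skewD e k b

theorem act1Op_apply (z : Fin 5 → ι) (M : Matrix (Fin 5) (Fin 5) ℂ) (f : MvPolynomial ι ℂ) :
    act1Op z M f = ∑ a, ∑ k, M a k • (X (z a) * pderiv (z k) f) := by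
  simp [act1Op, derivation_sum_apply]

theorem act2Op_apply (e : Pair → ι) (M : Matrix (Fin 5) (Fin 5) ℂ) (f : MvPolynomial ι ℂ) :
    act2Op e M f = ∑ a, ∑ k, M a k • ∑ b, skewX e a b * skewD e k b f := by
  simp [act2Op, derivation_sum_apply]

theorem skew_of_lt {M : Type*} [AddCommGroup M] (f : Pair → M) (p : Pair) :
    skew f p.1.1 p.1.2 = f p := dif_pos p.2

theorem skewX_symm (e : Pair → ι) (k l : Fin 5) : skewX e k l = -skewX e l k := skew_symm _ _ _

theorem skewD_symm (e : Pair → ι) (k l : Fin 5) : skewD e k l = -skewD e l k := skew_symm _ _ _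

/-- A family which is determined by skew-symmetry agrees with `skew`. -/
theorem skew_cases {P : Fin 5 → Fin 5 → Prop} (h0 : ∀ p : Pair, P p.1.1 p.1.2)
    (h1 : ∀ i, P i i) (h2 : ∀ i j, P i j → P j i) (i j : Fin 5) : P i j := by
  rcases lt_trichotomy i j with h | rfl | h
  · exact h0 ⟨(i, j), h⟩
  · exact h1 i
  · exact h2 j i (h0 ⟨(j, i), h⟩)

theorem skewX_self (e : Pair → ι) (k : Fin 5) : skewX e k k = 0 := by simp [skewX, skew]

theorem skewD_self (e : Pair → ι) (k : Fin 5) : skewD e k k = 0 := by simp [skewD, skew]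

theorem skewX_pair (e : Pair → ι) (p : Pair) : skewX e p.1.1 p.1.2 = X (e p) := skew_of_lt _ p

theorem skewD_pair (e : Pair → ι) (p : Pair) : skewD e p.1.1 p.1.2 = pderiv (e p) := skew_of_lt _ p

theorem skewD_apply_symm (e : Pair → ι) (k l : Fin 5) (f : MvPolynomial ι ℂ) :
    skewD e k l f = -skewD e l k f := by rw [skewD_symm, Derivation.neg_apply]

theorem skewD_skewX {e : Pair → ι} (he : Function.Injective e) (i j k l : Fin 5) :
    skewD e i j (skewX e k l) = C ((if i = k ∧ j = l then 1 else 0) -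
      (if i = l ∧ j = k then 1 else 0)) := by
  classical
  revert i j
  refine skew_cases (fun p => ?_) (fun i => ?_) (fun i j h => ?_)
  · revert k l
    refine skew_cases (fun q => ?_) (fun k => ?_) (fun k l h => ?_)
    · rw [skewX_pair, skewD_pair, pderiv_X, Pi.single_apply]
      have h1 : (e q = e p) ↔ (p.1.1 = q.1.1 ∧ p.1.2 = q.1.2) := by
        rw [he.eq_iff, eq_comm, Subtype.ext_iff, Prod.ext_iff]
      have h2 : ¬ (p.1.1 = q.1.2 ∧ p.1.2 = q.1.1) := fun h => by
        have := p.2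
        rw [h.1, h.2] at this
        exact this.not_gt q.2
      rw [if_congr h1 rfl rfl, if_neg h2, sub_zero]
      split_ifs <;> simp
    · rw [skewX_self, map_zero, sub_self, C_0]
    · rw [skewX_symm, map_neg, h, ← C_neg, neg_sub]
  · rw [skewD_self, Derivation.zero_apply]
    simp only [and_comm, sub_self, C_0]
  · rw [skewD_symm, Derivation.neg_apply, h, ← C_neg, neg_sub]
    simp only [and_comm]

theorem pderiv_skewX {e : Pair → ι} {s : ι} (hs : ∀ p, e p ≠ s) (k l : Fin 5) :
    pderiv s (skewX e k l) = 0 := by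
  classical
  revert k l
  refine skew_cases (fun q => ?_) (fun k => ?_) (fun k l h => ?_)
  · rw [skewX_pair, pderiv_X, Pi.single_apply, if_neg (hs q)]
  · rw [skewX_self, map_zero]
  · rw [skewX_symm, map_neg, h, neg_zero]

theorem skewD_X {e : Pair → ι} {s : ι} (hs : ∀ p, e p ≠ s) (k l : Fin 5) :
    skewD e k l (X s) = 0 := by
  classical
  revert k l
  refine skew_cases (fun q => ?_) (fun k => ?_) (fun k l h => ?_)
  · rw [skewD_pair, pderiv_X, Pi.single_apply, if_neg (hs q).symm]
  · rw [skewD_self, Derivation.zero_apply]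
  · rw [skewD_apply_symm, h, neg_zero]

theorem fischer_neg_left (f g : MvPolynomial ι ℂ) : fischer (-f) g = -fischer f g := by
  rw [← neg_one_smul ℂ f, fischer_smul_left]; simp

theorem fischer_neg_right (f g : MvPolynomial ι ℂ) : fischer f (-g) = -fischer f g := by
  rw [← neg_one_smul ℂ g, fischer_smul_right]; simp

theorem fischer_sum_left {κ : Type} (s : Finset κ) (f : κ → MvPolynomial ι ℂ)
    (g : MvPolynomial ι ℂ) : fischer (∑ i ∈ s, f i) g = ∑ i ∈ s, fischer (f i) g := by
  classical
  induction s using Finset.induction_on with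
  | empty => simp [fischer_zero_left]
  | insert a s ha ih => rw [Finset.sum_insert ha, Finset.sum_insert ha, fischer_add_left, ih]

theorem fischer_sum_right {κ : Type} (s : Finset κ) (f : MvPolynomial ι ℂ)
    (g : κ → MvPolynomial ι ℂ) : fischer f (∑ i ∈ s, g i) = ∑ i ∈ s, fischer f (g i) := by
  rw [← fischer_symm, fischer_sum_left, map_sum]
  exact Finset.sum_congr rfl fun i _ => fischer_symm _ _

theorem fischer_skewX_mul (e : Pair → ι) (i j : Fin 5) (f g : MvPolynomial ι ℂ) :
    fischer (skewX e i j * f) g = fischer f (skewD e i j g) := by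
  revert i j
  refine skew_cases (fun q => ?_) (fun k => ?_) (fun k l h => ?_)
  · rw [skewX_pair, skewD_pair, fischer_X_mul]
  · rw [skewX_self, skewD_self, zero_mul, fischer_zero_left, Derivation.zero_apply,
      fischer_zero_right]
  · rw [skewX_symm, skewD_apply_symm, neg_mul, fischer_neg_left, fischer_neg_right, h]

theorem fischer_skewD (e : Pair → ι) (i j : Fin 5) (f g : MvPolynomial ι ℂ) :
    fischer (skewD e i j f) g = fischer f (skewX e i j * g) := by
  rw [← fischer_symm, ← fischer_skewX_mul, fischer_symm]

/-- The adjoint of the action of a matrix is the action of its conjugate transpose. -/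
theorem fischer_act1Op (z : Fin 5 → ι) (M : Matrix (Fin 5) (Fin 5) ℂ) (f g : MvPolynomial ι ℂ) :
    fischer (act1Op z M f) g = fischer f (act1Op z M.conjTranspose g) := by
  simp only [act1Op_apply, fischer_sum_left, fischer_sum_right, fischer_smul_left,
    fischer_smul_right, fischer_X_mul_pderiv, Matrix.conjTranspose_apply]
  exact Finset.sum_comm

theorem fischer_act2Op (e : Pair → ι) (M : Matrix (Fin 5) (Fin 5) ℂ) (f g : MvPolynomial ι ℂ) :
    fischer (act2Op e M f) g = fischer f (act2Op e M.conjTranspose g) := by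
  simp only [act2Op_apply, fischer_sum_left, fischer_sum_right, fischer_smul_left,
    fischer_smul_right, fischer_skewX_mul, fischer_skewD, Matrix.conjTranspose_apply]
  exact Finset.sum_comm

theorem act1Op_X {z : Fin 5 → ι} (hz : Function.Injective z) (M : Matrix (Fin 5) (Fin 5) ℂ)
    (k : Fin 5) : act1Op z M (X (z k)) = act1 (fun i => X (z i)) M k := by
  classical
  rw [act1Op_apply, act1]
  refine Finset.sum_congr rfl fun a _ => ?_
  rw [Finset.sum_eq_single k]
  · simp
  · intro b _ hb
    rw [pderiv_X_of_ne fun h => hb (hz h).symm, mul_zero, smul_zero]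
  · simp

theorem act1Op_X_of_ne {z : Fin 5 → ι} {s : ι} (hs : ∀ k, z k ≠ s)
    (M : Matrix (Fin 5) (Fin 5) ℂ) : act1Op z M (X s) = 0 := by
  rw [act1Op_apply]
  refine Finset.sum_eq_zero fun a _ => Finset.sum_eq_zero fun k _ => ?_
  rw [pderiv_X_of_ne (hs k).symm, mul_zero, smul_zero]

theorem act2Op_X_of_ne {e : Pair → ι} {s : ι} (hs : ∀ p, e p ≠ s)
    (M : Matrix (Fin 5) (Fin 5) ℂ) : act2Op e M (X s) = 0 := by
  simp [act2Op_apply, skewD_X hs]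

theorem act2Op_skewX {e : Pair → ι} (he : Function.Injective e) (M : Matrix (Fin 5) (Fin 5) ℂ)
    (k l : Fin 5) : act2Op e M (skewX e k l) = act2 (skewX e) M k l := by
  rw [act2Op_apply, act2]
  refine Finset.sum_congr rfl fun a _ => ?_
  simp only [skewD_skewX he, mul_comm _ (C _), ← smul_eq_C_mul, sub_smul, Finset.sum_sub_distrib,
    ite_and, ite_smul, one_smul, zero_smul, smul_sub]
  simp [skewX_symm e k a, sub_eq_add_neg]

theorem act1Op_skewX {z : Fin 5 → ι} {e : Pair → ι} (hez : ∀ p k, e p ≠ z k)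
    (M : Matrix (Fin 5) (Fin 5) ℂ) (k l : Fin 5) : act1Op z M (skewX e k l) = 0 := by
  simp [act1Op_apply, pderiv_skewX fun p => hez p _]

theorem pderiv_comm (s t : ι) (f : MvPolynomial ι ℂ) :
    pderiv s (pderiv t f) = pderiv t (pderiv s f) := by
  classical
  have : ⁅(pderiv s : Derivation ℂ (MvPolynomial ι ℂ) (MvPolynomial ι ℂ)), pderiv t⁆ = 0 :=
    derivation_ext fun i => by
      rw [Derivation.commutator_apply, pderiv_X, pderiv_X]
      simp [Pi.single_apply, apply_ite]
  have h2 := congrArg (fun D => D f) this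
  rw [Derivation.commutator_apply] at h2
  exact sub_eq_zero.1 h2

/-- The dual action on partial derivatives. -/
theorem act1Op_pderiv {z : Fin 5 → ι} (hz : Function.Injective z) (M : Matrix (Fin 5) (Fin 5) ℂ)
    (j : Fin 5) (f : MvPolynomial ι ℂ) :
    act1Op z M (pderiv (z j) f) = pderiv (z j) (act1Op z M f) - ∑ a, M j a • pderiv (z a) f := by
  classical
  have e : ∀ a : Fin 5, pderiv (z j) (X (z a)) = (if a = j then 1 else 0 : MvPolynomial ι ℂ) :=
    fun a => by rw [pderiv_X, Pi.single_apply]; simp only [hz.eq_iff]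
  simp only [act1Op_apply, map_sum, Derivation.map_smul, Derivation.leibniz, smul_eq_mul, e,
    smul_add, Finset.sum_add_distrib, pderiv_comm (z j), mul_ite, mul_one, mul_zero]
  rw [add_sub_assoc, eq_comm, add_eq_left, sub_eq_zero, Finset.sum_eq_single j]
  · simp
  · intro b _ hb
    simp [hb]
  · simp

/-- The dual action on the derivatives `∂ / ∂xᵢⱼ`. -/
theorem act2Op_skewD {e : Pair → ι} (he : Function.Injective e) (M : Matrix (Fin 5) (Fin 5) ℂ)
    (i j : Fin 5) (f : MvPolynomial ι ℂ) :
    act2Op e M (skewD e i j f) = skewD e i j (act2Op e M f) -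
      ∑ a, (M i a • skewD e a j f + M j a • skewD e i a f) := by
  classical
  have hD : ⁅act2Op e M, skewD e i j⁆ = - ∑ a, (M i a • skewD e a j + M j a • skewD e i a) := by
    refine derivation_ext fun s => ?_
    rw [Derivation.commutator_apply, Derivation.neg_apply, derivation_sum_apply]
    simp only [Derivation.add_apply, Derivation.smul_apply]
    by_cases hs : ∃ p, e p = s
    · obtain ⟨p, rfl⟩ := hs
      rw [← skewX_pair, skewD_skewX he, act2Op_skewX he, act2]
      generalize p.1.1 = k
      generalize p.1.2 = l
      rw [derivation_C, zero_sub]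
      have hC : ∀ i j k l, skewD e i j (skewX e k l) =
          (if i = k then if j = l then 1 else 0 else 0) -
          (if i = l then if j = k then 1 else 0 else 0) := fun i j k l => by
        rw [skewD_skewX he, C_sub]
        congr 1 <;> simp only [← ite_and] <;> split_ifs <;> simp
      simp only [map_sum (skewD e i j), map_add (skewD e i j), Derivation.map_smul, hC]
      simp only [smul_sub, smul_ite, smul_zero, Finset.sum_add_distrib, Finset.sum_sub_distrib]
      simp [eq_comm]
      abel
    · push Not at hs
      simp [skewD_X hs, act2Op_X_of_ne hs]
  have h2 := congrArg (fun D => D f) hD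
  simp only [Derivation.commutator_apply, Derivation.neg_apply, derivation_sum_apply,
    Derivation.add_apply, Derivation.smul_apply] at h2
  rw [sub_eq_iff_eq_add] at h2
  rw [h2]
  ring

theorem act1Op_skewD {z : Fin 5 → ι} {e : Pair → ι} (he : Function.Injective e)
    (hez : ∀ p k, e p ≠ z k) (M : Matrix (Fin 5) (Fin 5) ℂ) (i j : Fin 5) (f : MvPolynomial ι ℂ) :
    act1Op z M (skewD e i j f) = skewD e i j (act1Op z M f) := by
  classical
  have hD : ⁅act1Op z M, skewD e i j⁆ = 0 := by
    refine derivation_ext fun s => ?_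
    rw [Derivation.commutator_apply, Derivation.zero_apply]
    by_cases hs : ∃ p, e p = s
    · obtain ⟨p, rfl⟩ := hs
      rw [act1Op_X_of_ne fun k => (hez p k).symm, ← skewX_pair, skewD_skewX he, derivation_C,
        map_zero, sub_zero]
    · push Not at hs
      rw [skewD_X hs, map_zero, zero_sub, neg_eq_zero, act1Op_apply, map_sum]
      refine Finset.sum_eq_zero fun a _ => ?_
      rw [map_sum]
      refine Finset.sum_eq_zero fun k _ => ?_
      rw [Derivation.map_smul, Derivation.leibniz, skewD_X fun p => hez p a, pderiv_X,
        Pi.single_apply]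
      split_ifs <;> simp
  have h2 := congrArg (fun D => D f) hD
  rw [Derivation.commutator_apply, Derivation.zero_apply] at h2
  exact sub_eq_zero.1 h2

end Operators

section Bidegrees

variable {σ τ : Type}

theorem act1Op_mem_bihom {z : Fin 5 → σ ⊕ τ}
    (hz : ∀ a k, bideg (Finsupp.single (z a) 1) = bideg (Finsupp.single (z k) 1))
    (M : Matrix (Fin 5) (Fin 5) ℂ) {m n : ℕ} {f : MvPolynomial (σ ⊕ τ) ℂ} (hf : f ∈ bihom m n) :
    act1Op z M f ∈ bihom m n := by
  rw [act1Op_apply]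
  exact sum_mem fun a _ => sum_mem fun k _ => Submodule.smul_mem _ _
    (X_mul_pderiv_mem_bihom hf _ _ (hz a k))

theorem act2Op_mem_bihom {e : Pair → σ ⊕ τ}
    (he : ∀ a k, bideg (Finsupp.single (e a) 1) = bideg (Finsupp.single (e k) 1))
    (M : Matrix (Fin 5) (Fin 5) ℂ) {m n : ℕ} {f : MvPolynomial (σ ⊕ τ) ℂ} (hf : f ∈ bihom m n) :
    act2Op e M f ∈ bihom m n := by
  rw [act2Op_apply]
  refine sum_mem fun a _ => sum_mem fun k _ => Submodule.smul_mem _ _ (sum_mem fun b _ => ?_)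
  have key : ∀ a b c d, skewX e a b * skewD e c d f ∈ (bihom m n : Submodule ℂ _) := by
    intro a b
    refine skew_cases (fun p => ?_) (fun _ => ?_) (fun c d h => ?_)
    · revert a b
      refine skew_cases (fun q => ?_) (fun _ => ?_) (fun c d h => ?_)
      · rw [skewX_pair, skewD_pair]
        exact X_mul_pderiv_mem_bihom hf _ _ (he _ _)
      · rw [skewX_self, zero_mul]; exact zero_mem _
      · rw [skewX_symm, neg_mul]; exact neg_mem h
    · rw [skewD_self, Derivation.zero_apply, mul_zero]; exact zero_mem _
    · rw [skewD_apply_symm, mul_neg]; exact neg_mem h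
  exact key _ _ _ _

end Bidegrees

/-! ### The modules `S_A`, `S_B`, `S_C` -/

section Actions

theorem act1Op_add_act2Op_X {ι : Type} {z : Fin 5 → ι} {e : Pair → ι} (hz : Function.Injective z)
    (hez : ∀ p k, e p ≠ z k) (M : Matrix (Fin 5) (Fin 5) ℂ) (k : Fin 5) :
    (act1Op z M + act2Op e M) (X (z k)) = act1 (fun i => X (z i)) M k := by
  rw [Derivation.add_apply, act1Op_X hz, act2Op_X_of_ne fun p => hez p k, add_zero]

theorem act1Op_add_act2Op_skewX {ι : Type} {z : Fin 5 → ι} {e : Pair → ι}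
    (he : Function.Injective e) (hez : ∀ p k, e p ≠ z k) (M : Matrix (Fin 5) (Fin 5) ℂ)
    (k l : Fin 5) : (act1Op z M + act2Op e M) (skewX e k l) = act2 (skewX e) M k l := by
  rw [Derivation.add_apply, act1Op_skewX hez, act2Op_skewX he, zero_add]

theorem act1Op_add_act1Op_X_left {ι : Type} {z z' : Fin 5 → ι} (hz : Function.Injective z)
    (hzz : ∀ k l, z k ≠ z' l) (M M' : Matrix (Fin 5) (Fin 5) ℂ) (k : Fin 5) :
    (act1Op z M + act1Op z' M') (X (z k)) = act1 (fun i => X (z i)) M k := by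
  rw [Derivation.add_apply, act1Op_X hz, act1Op_X_of_ne fun p => (hzz k p).symm, add_zero]

theorem act1Op_add_act1Op_X_right {ι : Type} {z z' : Fin 5 → ι} (hz : Function.Injective z')
    (hzz : ∀ k l, z k ≠ z' l) (M M' : Matrix (Fin 5) (Fin 5) ℂ) (k : Fin 5) :
    (act1Op z M + act1Op z' M') (X (z' k)) = act1 (fun i => X (z' i)) M' k := by
  rw [Derivation.add_apply, act1Op_X hz, act1Op_X_of_ne fun p => (hzz p k), zero_add]

/-- The action of a matrix on `S_A`. -/
abbrev derA (M : Matrix (Fin 5) (Fin 5) ℂ) : Derivation ℂ SA SA :=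
  act1Op Sum.inl M + act2Op Sum.inr M

/-- The action of a matrix on `S_B`. -/
abbrev derB (M : Matrix (Fin 5) (Fin 5) ℂ) : Derivation ℂ SB SB :=
  act1Op Sum.inl M + act1Op Sum.inr (-M.transpose)

/-- The action of a matrix on `S_C`, up to the passage from `M` to `-Mᵀ`. -/
abbrev derC (M : Matrix (Fin 5) (Fin 5) ℂ) : Derivation ℂ SC SC :=
  act1Op Sum.inr M + act2Op Sum.inl M

theorem derA_z (M : Matrix (Fin 5) (Fin 5) ℂ) (k : Fin 5) :
    derA M (X (Sum.inl k)) = act1 (fun i => X (Sum.inl i)) M k :=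
  act1Op_add_act2Op_X Sum.inl_injective (fun _ _ => Sum.inr_ne_inl) M k

theorem derA_x (M : Matrix (Fin 5) (Fin 5) ℂ) (k l : Fin 5) :
    derA M (skewX Sum.inr k l) = act2 (skewX Sum.inr) M k l :=
  act1Op_add_act2Op_skewX Sum.inr_injective (fun _ _ => Sum.inr_ne_inl) M k l

theorem derB_z (M : Matrix (Fin 5) (Fin 5) ℂ) (k : Fin 5) :
    derB M (X (Sum.inl k)) = act1 (fun i => X (Sum.inl i)) M k :=
  act1Op_add_act1Op_X_left Sum.inl_injective (fun _ _ => Sum.inl_ne_inr) M _ k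

theorem derB_z' (M : Matrix (Fin 5) (Fin 5) ℂ) (k : Fin 5) :
    derB M (X (Sum.inr k)) = act1 (fun i => X (Sum.inr i)) (-M.transpose) k :=
  act1Op_add_act1Op_X_right Sum.inr_injective (fun _ _ => Sum.inl_ne_inr) M _ k

theorem derC_z (M : Matrix (Fin 5) (Fin 5) ℂ) (k : Fin 5) :
    derC M (X (Sum.inr k)) = act1 (fun i => X (Sum.inr i)) M k :=
  act1Op_add_act2Op_X Sum.inr_injective (fun _ _ => Sum.inl_ne_inr) M k

theorem derC_x (M : Matrix (Fin 5) (Fin 5) ℂ) (k l : Fin 5) :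
    derC M (skewX Sum.inl k l) = act2 (skewX Sum.inl) M k l :=
  act1Op_add_act2Op_skewX Sum.inl_injective (fun _ _ => Sum.inl_ne_inr) M k l

theorem lie_SA (A : sl5) (f : SA) : ⁅A, f⁆ = derA A.1 f := by
  have h : mkDerivation ℂ (genA A) = derA A.1 := by
    refine derivation_ext fun s => ?_
    rw [mkDerivation_X]
    rcases s with k | p
    · exact (derA_z A.1 k).symm
    · rw [← skewX_pair Sum.inr p, derA_x]; rfl
  exact congrArg (fun D : Derivation ℂ SA SA => D f) h

theorem lie_SB (A : sl5) (f : SB) : ⁅A, f⁆ = derB A.1 f := by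
  have h : mkDerivation ℂ (genB A) = derB A.1 := by
    refine derivation_ext fun s => ?_
    rw [mkDerivation_X]
    rcases s with k | k
    · exact (derB_z A.1 k).symm
    · exact (derB_z' A.1 k).symm
  exact congrArg (fun D : Derivation ℂ SB SB => D f) h

theorem lie_SC (A : sl5) (f : SC) : ⁅A, f⁆ = derC (-A.1.transpose) f := by
  have h : mkDerivation ℂ (genC A) = derC (-A.1.transpose) := by
    refine derivation_ext fun s => ?_
    rw [mkDerivation_X]
    rcases s with p | k
    · rw [← skewX_pair Sum.inl p, derC_x]; rfl
    · exact (derC_z _ k).symm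
  exact congrArg (fun D : Derivation ℂ SC SC => D f) h

/-- The adjoint of `A` for the standard hermitian form of `ℂ⁵`. -/
def sl5Adjoint (A : sl5) : sl5 := ⟨A.1.conjTranspose, by
  have h : Matrix.trace A.1 = 0 := A.2
  change Matrix.trace A.1.conjTranspose = 0
  rw [Matrix.trace_conjTranspose, h, star_zero]⟩

/-- The traceless diagonal matrix with the given integers as entries. -/
def diagSl (δ : Fin 5 → ℤ) (h : ∑ i, δ i = 0) : sl5 :=
  ⟨Matrix.diagonal fun i => (δ i : ℂ), by
    change Matrix.trace (Matrix.diagonal fun i => (δ i : ℂ)) = 0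
    rw [Matrix.trace_diagonal, ← Int.cast_sum, h, Int.cast_zero]⟩

theorem act1_diagonal {P : Type} [AddCommGroup P] [Module ℂ P] (z : Fin 5 → P) (c : Fin 5 → ℂ)
    (k : Fin 5) : act1 z (Matrix.diagonal c) k = c k • z k := by
  simp [act1, Matrix.diagonal_apply]

theorem act2_diagonal {P : Type} [AddCommGroup P] [Module ℂ P] (x : Fin 5 → Fin 5 → P)
    (c : Fin 5 → ℂ) (k l : Fin 5) : act2 x (Matrix.diagonal c) k l = (c k + c l) • x k l := by
  simp [act2, Matrix.diagonal_apply, Finset.sum_add_distrib, add_smul]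

/-- A derivation for which the variables are eigenvectors. -/
theorem derivation_eq_sum {ι : Type} [Fintype ι]
    (D : Derivation ℂ (MvPolynomial ι ℂ) (MvPolynomial ι ℂ)) (c : ι → ℤ)
    (h : ∀ i, D (X i) = (c i : ℂ) • X i) (f : MvPolynomial ι ℂ) :
    D f = ∑ i, (c i : ℂ) • (X i * pderiv i f) := by
  classical
  have : D = ∑ i, (c i : ℂ) • (X i : MvPolynomial ι ℂ) • pderiv i := by
    refine derivation_ext fun s => ?_
    rw [h, derivation_sum_apply]
    simp [Pi.single_apply]
  rw [this, derivation_sum_apply]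
  rfl

theorem diagSl_val (δ : Fin 5 → ℤ) (h : ∑ i, δ i = 0) :
    (diagSl δ h).1 = Matrix.diagonal fun i => (δ i : ℂ) := rfl

/-- The weight of `5 (2 E₁₁ + E₂₂) - 3 I` singles out `z₁` and `x₁₂`. -/
theorem unitaryA : UnitaryAction (Fin 5) Pair 0 ⟨(0, 1), by decide⟩ where
  lie_mem_bihom A m n f hf := by
    rw [lie_SA]
    exact add_mem (act1Op_mem_bihom (fun a k => by simp [bideg_single]) _ hf)
      (act2Op_mem_bihom (fun a k => by simp [bideg_single]) _ hf)
  exists_adjoint A := ⟨sl5Adjoint A, fun f g => by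
    rw [lie_SA, lie_SA, Derivation.add_apply, Derivation.add_apply, fischer_add_left,
      fischer_add_right, fischer_act1Op, fischer_act2Op]; rfl⟩
  exists_weight := by
    refine ⟨diagSl ![7, 2, -3, -3, -3] (by decide), Sum.elim ![7, 2, -3, -3, -3] fun p =>
      ![7, 2, -3, -3, -3] p.1.1 + ![7, 2, -3, -3, -3] p.1.2, fun f => ?_, by decide, by decide⟩
    rw [lie_SA, diagSl_val]
    refine derivation_eq_sum _ _ (fun s => ?_) f
    rcases s with k | p
    · rw [derA_z, act1_diagonal, Sum.elim_inl]
    · rw [← skewX_pair Sum.inr p, derA_x, act2_diagonal, Sum.elim_inr, Int.cast_add]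

/-- The weight of `E₁₁ - E₅₅` singles out `z₁` and `z₅*`. -/
theorem unitaryB : UnitaryAction (Fin 5) (Fin 5) 0 4 where
  lie_mem_bihom A m n f hf := by
    rw [lie_SB]
    exact add_mem (act1Op_mem_bihom (fun a k => by simp [bideg_single]) _ hf)
      (act1Op_mem_bihom (fun a k => by simp [bideg_single]) _ hf)
  exists_adjoint A := ⟨sl5Adjoint A, fun f g => by
    rw [lie_SB, lie_SB, Derivation.add_apply, Derivation.add_apply, fischer_add_left,
      fischer_add_right, fischer_act1Op, fischer_act1Op, Matrix.conjTranspose_neg]; rfl⟩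
  exists_weight := by
    refine ⟨diagSl ![1, 0, 0, 0, -1] (by decide), Sum.elim ![1, 0, 0, 0, -1]
      fun k => -![1, 0, 0, 0, -1] k, fun f => ?_, by decide, by decide⟩
    rw [lie_SB, diagSl_val]
    refine derivation_eq_sum _ _ (fun s => ?_) f
    rcases s with k | k
    · rw [derB_z, act1_diagonal, Sum.elim_inl]
    · rw [derB_z', Matrix.diagonal_transpose, Matrix.diagonal_neg, act1_diagonal, Sum.elim_inr,
        Int.cast_neg]

/-- The weight of `3 I - 5 (E₄₄ + 2 E₅₅)` singles out `x₄₅*` and `z₅*`. -/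
theorem unitaryC : UnitaryAction Pair (Fin 5) ⟨(3, 4), by decide⟩ 4 where
  lie_mem_bihom A m n f hf := by
    rw [lie_SC]
    exact add_mem (act1Op_mem_bihom (fun a k => by simp [bideg_single]) _ hf)
      (act2Op_mem_bihom (fun a k => by simp [bideg_single]) _ hf)
  exists_adjoint A := ⟨sl5Adjoint A, fun f g => by
    rw [lie_SC, lie_SC, Derivation.add_apply, Derivation.add_apply, fischer_add_left,
      fischer_add_right, fischer_act1Op, fischer_act2Op, Matrix.conjTranspose_neg]; rfl⟩
  exists_weight := by
    refine ⟨diagSl ![3, 3, 3, -2, -7] (by decide), Sum.elim (fun p =>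
      -![3, 3, 3, -2, -7] p.1.1 + -![3, 3, 3, -2, -7] p.1.2) (fun k => -![3, 3, 3, -2, -7] k),
      fun f => ?_, by decide, by decide⟩
    rw [lie_SC, diagSl_val, Matrix.diagonal_transpose, Matrix.diagonal_neg]
    refine derivation_eq_sum _ _ (fun s => ?_) f
    rcases s with p | k
    · rw [← skewX_pair Sum.inl p, derC_x, act2_diagonal, Sum.elim_inl, Int.cast_add, Int.cast_neg,
        Int.cast_neg]
    · rw [derC_z, act1_diagonal, Sum.elim_inr, Int.cast_neg]

/-- A derivation with eigenvectors `x` and `y`. -/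
theorem derivation_pow_mul_pow {ι : Type} (D : Derivation ℂ (MvPolynomial ι ℂ) (MvPolynomial ι ℂ))
    {x y : MvPolynomial ι ℂ} {a b : ℂ} (hx : D x = a • x) (hy : D y = b • y) (m n : ℕ) :
    D (x ^ m * y ^ n) = (m * a + n * b) • (x ^ m * y ^ n) := by
  have key : ∀ {x : MvPolynomial ι ℂ} {a : ℂ} (_ : D x = a • x) (m : ℕ),
      D (x ^ m) = (m * a) • x ^ m := by
    intro x a hx m
    induction m with
    | zero => simp
    | succ m ih =>
      rw [pow_succ, Derivation.leibniz, ih, hx, smul_eq_mul, smul_eq_mul, mul_smul_comm,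
        mul_smul_comm, mul_comm x, ← add_smul]
      congr 1
      push_cast
      ring
  rw [Derivation.leibniz, key hx, key hy, smul_eq_mul, smul_eq_mul, mul_smul_comm, mul_smul_comm,
    mul_comm (y ^ n), ← add_smul, add_comm]

theorem single_val {i j : Fin 5} (h : i ≠ j) :
    (LieAlgebra.SpecialLinear.single i j h (1 : ℂ) : sl5).1 = Matrix.single i j 1 := rfl

theorem act1_single {P : Type} [AddCommGroup P] [Module ℂ P] (z : Fin 5 → P) (i j k : Fin 5) :
    act1 z (Matrix.single i j 1) k = if j = k then z i else 0 := by
  simp [act1, Matrix.single_apply, ite_and]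

theorem act1_neg {P : Type} [AddCommGroup P] [Module ℂ P] (z : Fin 5 → P)
    (M : Matrix (Fin 5) (Fin 5) ℂ) (k : Fin 5) : act1 z (-M) k = -act1 z M k := by
  simp [act1]

theorem act2_neg {P : Type} [AddCommGroup P] [Module ℂ P] (x : Fin 5 → Fin 5 → P)
    (M : Matrix (Fin 5) (Fin 5) ℂ) (k l : Fin 5) : act2 x (-M) k l = -act2 x M k l := by
  simp only [act2, Matrix.neg_apply, neg_smul, ← Finset.sum_neg_distrib, neg_add]

theorem act2_single {P : Type} [AddCommGroup P] [Module ℂ P] (x : Fin 5 → Fin 5 → P)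
    (i j k l : Fin 5) : act2 x (Matrix.single i j 1) k l =
      (if j = k then x i l else 0) + if j = l then x k i else 0 := by
  simp [act2, Matrix.single_apply, ite_and, Finset.sum_add_distrib]

theorem singleSubSingle_val (i j : Fin 5) :
    (LieAlgebra.SpecialLinear.singleSubSingle i j (1 : ℂ) : sl5).1 =
      Matrix.diagonal fun k => (if k = i then 1 else 0) - if k = j then 1 else 0 := by
  change Matrix.single i i (1 : ℂ) - Matrix.single j j 1 = _
  ext a b
  simp only [Matrix.sub_apply, Matrix.single_apply, Matrix.diagonal_apply]
  by_cases hab : a = b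
  · subst hab; simp [eq_comm]
  · rw [if_neg hab, if_neg, if_neg, sub_zero] <;> rintro ⟨rfl, rfl⟩ <;> exact hab rfl

theorem isF_highA (m n : ℕ) : IsF (highA m n) ![m, n, 0, 0] := by
  have hx : X (Sum.inr ⟨(0, 1), by decide⟩) = (skewX Sum.inr 0 1 : SA) := rfl
  refine unitaryA.isF_high (fun i j hij => ?_) fun i => ?_
  · rw [lie_SA, single_val, derivation_pow_mul_pow _ (a := 0) (b := 0) ?_ ?_ m n, mul_zero,
      mul_zero, add_zero, zero_smul]
    · rw [derA_z, act1_single, if_neg (by omega), zero_smul]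
    · rw [hx, derA_x, act2_single, if_neg (by omega), zero_add, zero_smul]
      split_ifs with h1
      · rw [show i = 0 by omega, skewX_self]
      · rfl
  · rw [lie_SA, singleSubSingle_val, derivation_pow_mul_pow _ (derA_z _ _ |>.trans
      (act1_diagonal _ _ _)) (by rw [hx, derA_x, act2_diagonal]) m n]
    fin_cases i <;> simp

theorem isF_highB (m n : ℕ) : IsF (highB m n) ![m, 0, 0, n] := by
  refine unitaryB.isF_high (fun i j hij => ?_) fun i => ?_
  · rw [lie_SB, single_val, derivation_pow_mul_pow _ (a := 0) (b := 0) ?_ ?_ m n, mul_zero,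
      mul_zero, add_zero, zero_smul]
    · rw [derB_z, act1_single, if_neg (by omega), zero_smul]
    · rw [derB_z', Matrix.transpose_single, act1_neg, act1_single, if_neg (by omega), neg_zero,
        zero_smul]
  · rw [lie_SB, singleSubSingle_val, derivation_pow_mul_pow _ (derB_z _ _ |>.trans
      (act1_diagonal _ _ _)) (by rw [derB_z', Matrix.diagonal_transpose, Matrix.diagonal_neg,
        act1_diagonal]) m n]
    fin_cases i <;> simp

theorem isF_highC (m n : ℕ) : IsF (highC m n) ![0, 0, m, n] := by
  have hx : X (Sum.inl ⟨(3, 4), by decide⟩) = (skewX Sum.inl 3 4 : SC) := rfl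
  refine unitaryC.isF_high (fun i j hij => ?_) fun i => ?_
  · rw [lie_SC, single_val, Matrix.transpose_single, derivation_pow_mul_pow _ (a := 0) (b := 0)
      ?_ ?_ m n, mul_zero, mul_zero, add_zero, zero_smul]
    · rw [hx, derC_x, act2_neg, act2_single, if_neg (by omega : i ≠ 4), add_zero, zero_smul]
      split_ifs with h1
      · rw [show j = 4 by omega, skewX_self, neg_zero]
      · rw [neg_zero]
    · rw [derC_z, act1_neg, act1_single, if_neg (by omega), neg_zero, zero_smul]
  · rw [lie_SC, singleSubSingle_val, Matrix.diagonal_transpose, Matrix.diagonal_neg,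
      derivation_pow_mul_pow _ (by rw [hx, derC_x, act2_diagonal]) (derC_z _ _ |>.trans
      (act1_diagonal _ _ _)) m n]
    fin_cases i <;> simp

theorem isInternal_partA : DirectSum.IsInternal fun p : ℕ × ℕ => partA p.1 p.2 :=
  unitaryA.isInternal_sub

theorem isInternal_partB : DirectSum.IsInternal fun p : ℕ × ℕ => partB p.1 p.2 :=
  unitaryB.isInternal_quot

theorem isInternal_partC : DirectSum.IsInternal fun p : ℕ × ℕ => partC p.1 p.2 :=
  unitaryC.isInternal_quot

theorem isF_partA (m n : ℕ) : IsF (partA m n) ![m, n, 0, 0] :=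
  (isF_highA m n).of_equiv (highEquivSub _ _ m n)

theorem isF_partB (m n : ℕ) : IsF (partB m n) ![m, 0, 0, n] :=
  (isF_highB m n).of_equiv (unitaryB.highEquivQuot m n)

theorem isF_partC (m n : ℕ) : IsF (partC m n) ![0, 0, m, n] :=
  (isF_highC m n).of_equiv (unitaryC.highEquivQuot m n)

end Actions

/-! ### The action of the odd elements of positive degree -/

section OddRelation

theorem eps_swap_03 (k b c i j : Fin 5) : eps i b c k j = -eps k b c i j := by
  rw [eps_perm_sign k b c i j (Equiv.swap 0 3) i b c k j (by ext x; fin_cases x <;> rfl)]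
  simp [Equiv.Perm.sign_swap (show (0 : Fin 5) ≠ 3 by decide)]

theorem eps_swap_04 (k b c i j : Fin 5) : eps j b c i k = -eps k b c i j := by
  rw [eps_perm_sign k b c i j (Equiv.swap 0 4) j b c i k (by ext x; fin_cases x <;> rfl)]
  simp [Equiv.Perm.sign_swap (show (0 : Fin 5) ≠ 4 by decide)]

theorem eps_swap_34 (k b c i j : Fin 5) : eps k b c j i = -eps k b c i j := by
  rw [eps_perm_sign k b c i j (Equiv.swap 3 4) k b c j i (by ext x; fin_cases x <;> rfl)]
  simp [Equiv.Perm.sign_swap (show (3 : Fin 5) ≠ 4 by decide)]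

theorem eps_rotate_123 (k b c a j : Fin 5) : eps k c a b j = eps k b c a j :=
  eps_perm k b c a j (Equiv.swap 1 2 * Equiv.swap 2 3) (by decide) _ _ _ _ _
    (by ext x; fin_cases x <;> rfl)

theorem sum_eps_34 {P : Type} [AddCommGroup P] (b c : Fin 5) (F : Fin 5 → Fin 5 → Fin 5 → P) :
    ∑ k, ∑ i, ∑ j, eps k b c i j • F k j i = -∑ k, ∑ i, ∑ j, eps k b c i j • F k i j := by
  simp only [← Finset.sum_neg_distrib]
  refine Finset.sum_congr rfl fun k _ => ?_
  rw [Finset.sum_comm]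
  refine Finset.sum_congr rfl fun i _ => Finset.sum_congr rfl fun j _ => ?_
  rw [eps_swap_34, neg_smul]

variable {P : Type} [AddCommGroup P] [Module ℂ P]

theorem eq_zero_of_eq_neg_self {x : P} (h : x = -x) : x = 0 := by
  have h2 : (2 : ℂ) • x = 0 := by
    rw [two_smul]
    exact add_eq_zero_iff_eq_neg.2 h
  exact (smul_eq_zero.1 h2).resolve_left two_ne_zero

theorem sum_eps_03 (b c : Fin 5) (F : Fin 5 → Fin 5 → Fin 5 → P) (h : ∀ k i j, F i k j = F k i j) :
    ∑ k, ∑ i, ∑ j, eps k b c i j • F k i j = 0 := by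
  refine eq_zero_of_eq_neg_self ?_
  conv_lhs => rw [Finset.sum_comm]
  simp only [← Finset.sum_neg_distrib]
  refine Finset.sum_congr rfl fun k _ => Finset.sum_congr rfl fun i _ =>
    Finset.sum_congr rfl fun j _ => ?_
  rw [eps_swap_03, h, neg_smul]

theorem sum_eps_04 (b c : Fin 5) (F : Fin 5 → Fin 5 → Fin 5 → P) (h : ∀ k i j, F j i k = F k i j) :
    ∑ k, ∑ i, ∑ j, eps k b c i j • F k i j = 0 := by
  refine eq_zero_of_eq_neg_self ?_
  conv_lhs =>
    rw [Finset.sum_comm]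
    enter [2, i]
    rw [Finset.sum_comm]
  conv_lhs => rw [Finset.sum_comm]
  simp only [← Finset.sum_neg_distrib]
  refine Finset.sum_congr rfl fun k _ => Finset.sum_congr rfl fun i _ =>
    Finset.sum_congr rfl fun j _ => ?_
  rw [eps_swap_04, h, neg_smul]

/-- The linear part of the vector field `[w, dᵢⱼ]`, in terms of the linear part of `w`. -/
theorem toG0_brL_d (w : Omega2cl) (i j a k : Fin 5) : (toG0 (brL (0, w) (d i j))).1 a k =
    (1 / 2 : ℂ) * ∑ b, ∑ c, (eps k b c i j : ℂ) *
      MvPowerSeries.constantCoeff (pd a (w.1 b c)) := by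
  rw [toG0_apply, d_eq, brL_oo]
  change MvPowerSeries.constantCoeff (pd a ((1 / 4 : ℂ) • ∑ b, ∑ c, ∑ l, ∑ m, eps k b c l m •
    (w.1 b c * MvPowerSeries.C ((if l = i ∧ m = j then 1 else 0) -
      (if l = j ∧ m = i then 1 else 0) : ℂ)))) = _
  have e : ∀ (f : FPS) (c : ℂ), MvPowerSeries.constantCoeff (pd a (f * MvPowerSeries.C c)) =
      MvPowerSeries.constantCoeff (pd a f) * c := by
    intro f c
    rw [Derivation.leibniz]
    simp [pd, MvPowerSeries.pderiv_C, mul_comm]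
  have hs : ∀ (c : ℂ) (f : FPS), MvPowerSeries.constantCoeff (c • f) =
      c * MvPowerSeries.constantCoeff f := fun c f => by simp
  simp only [Derivation.map_smul, map_sum, map_zsmul, hs, e]
  have e2 : ∀ b c, ∑ l, ∑ m, eps k b c l m • (MvPowerSeries.constantCoeff (pd a (w.1 b c)) *
      ((if l = i ∧ m = j then 1 else 0) - (if l = j ∧ m = i then 1 else 0) : ℂ)) =
      2 * ((eps k b c i j : ℂ) * MvPowerSeries.constantCoeff (pd a (w.1 b c))) := by
    intro b c
    simp only [ite_and, mul_sub, mul_ite, mul_one, mul_zero, smul_sub, smul_ite, smul_zero,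
      Finset.sum_sub_distrib, Finset.sum_ite_eq', Finset.mem_univ, if_true, Finset.sum_ite_irrel,
      Finset.sum_const_zero, zsmul_eq_mul]
    rw [eps_swap_34 k b c i j]
    push_cast
    ring
  simp only [e2, ← Finset.mul_sum]
  ring

/-- The relation which is needed for the action of the odd elements of positive degree, when the
action of `A ∈ sl₅` is `∑ A_{ak} G_{ak}`: modulo `N`, the sums of `G_{ak} θᵢⱼ v` against
`ε_{kbcij}` have to be invariant under the cyclic permutations of `a`, `b`, `c`. Such sums cancel,
since the coefficients `∂ₐ w_{bc}` of a closed form have cyclic sum zero. -/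
theorem sum_lie_mem [LieRingModule sl5 P] (N : Submodule ℂ P) (G : Fin 5 → Fin 5 → P → P)
    (hG : ∀ (A : sl5) v, ⁅A, v⁆ = ∑ a, ∑ k, A.1 a k • G a k v)
    (T : Fin 5 → Fin 5 → P) (R : Fin 5 → Fin 5 → Fin 5 → P) (hR : ∀ a b c, R b c a = R a b c)
    (hT : ∀ a b c, ∑ k, ∑ i, ∑ j, eps k b c i j • G a k (T i j) - R a b c ∈ N) (w : Omega2cl) :
    ∑ i, ∑ j, ⁅toG0 (brL (0, w) (d i j)), T i j⁆ ∈ N := by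
  set W : Fin 5 → Fin 5 → Fin 5 → ℂ := fun a b c => MvPowerSeries.constantCoeff (pd a (w.1 b c))
    with hW
  have hcl : ∀ a b c, W a b c + W b c a + W c a b = 0 := fun a b c => by
    have := congrArg MvPowerSeries.constantCoeff (w.2.2 a b c)
    rwa [map_add, map_add, map_zero] at this
  have h1 : ∑ i, ∑ j, ⁅toG0 (brL (0, w) (d i j)), T i j⁆ =
      (1 / 2 : ℂ) • ∑ a, ∑ b, ∑ c, W a b c • ∑ k, ∑ i, ∑ j, eps k b c i j • G a k (T i j) := by
    simp only [hG, toG0_brL_d, mul_smul, Finset.sum_smul, Finset.smul_sum]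
    rw [Finset.sum_congr rfl fun i _ => Finset.sum_comm, Finset.sum_comm]
    refine Finset.sum_congr rfl fun a _ => ?_
    have e : ∀ (F : Fin 5 → Fin 5 → Fin 5 → Fin 5 → Fin 5 → P),
        ∑ i, ∑ j, ∑ k, ∑ b, ∑ c, F i j k b c = ∑ b, ∑ c, ∑ k, ∑ i, ∑ j, F i j k b c := by
      intro F
      simp only [← Fintype.sum_prod_type']
      exact Fintype.sum_equiv ⟨fun p => (p.2.2.2.1, p.2.2.2.2, p.2.2.1, p.1, p.2.1),
        fun p => (p.2.2.2.1, p.2.2.2.2, p.2.2.1, p.1, p.2.1), fun _ => rfl, fun _ => rfl⟩ _ _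
        fun _ => rfl
    rw [e]
    refine Finset.sum_congr rfl fun b _ => Finset.sum_congr rfl fun c _ =>
      Finset.sum_congr rfl fun k _ => Finset.sum_congr rfl fun i _ =>
      Finset.sum_congr rfl fun j _ => ?_
    rw [← Int.cast_smul_eq_zsmul ℂ, smul_comm (W a b c)]
  have h2 : ∑ a, ∑ b, ∑ c, W a b c • R a b c = 0 := by
    have r : ∀ F : Fin 5 → Fin 5 → Fin 5 → P,
        ∑ a, ∑ b, ∑ c, F b c a = ∑ a, ∑ b, ∑ c, F a b c := by
      intro F
      rw [Finset.sum_comm]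
      exact Finset.sum_congr rfl fun i _ => Finset.sum_comm
    have h3 : ∑ a, ∑ b, ∑ c, (W a b c • R a b c + W b c a • R b c a + W c a b • R c a b) = 0 := by
      refine Finset.sum_eq_zero fun a _ => Finset.sum_eq_zero fun b _ =>
        Finset.sum_eq_zero fun c _ => ?_
      rw [hR a b c, ← hR c a b, ← add_smul, ← add_smul, hcl, zero_smul]
    simp only [Finset.sum_add_distrib] at h3
    rw [r fun a b c => W a b c • R a b c, ← r fun a b c => W c a b • R c a b] at h3
    have h4 : (3 : ℂ) • ∑ a, ∑ b, ∑ c, W a b c • R a b c = 0 := by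
      rw [← h3]
      module
    exact (smul_eq_zero.1 h4).resolve_left (by norm_num)
  have h3 : ∑ a, ∑ b, ∑ c, W a b c • (∑ k, ∑ i, ∑ j, eps k b c i j • G a k (T i j) - R a b c) ∈
      N := sum_mem fun a _ => sum_mem fun b _ => sum_mem fun c _ => N.smul_mem _ (hT a b c)
  simp only [smul_sub, Finset.sum_sub_distrib] at h3
  rw [h2, sub_zero] at h3
  rw [h1]
  exact N.smul_mem _ h3

end OddRelation

/-! ### The Plücker relations -/

section Plucker

/-- The minors `pᵢ qⱼ - pⱼ qᵢ` of a `2 × 5` matrix of variables. -/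
def minor (i j : Fin 5) : MvPolynomial (Fin 5 ⊕ Fin 5) ℂ :=
  X (Sum.inl i) * X (Sum.inr j) - X (Sum.inl j) * X (Sum.inr i)

theorem minor_ne_zero {i j : Fin 5} (h : i ≠ j) : minor i j ≠ 0 := by
  classical
  intro h0
  have := congrArg (eval (Sum.elim (Pi.single i 1) (Pi.single j 1))) h0
  simp [minor, h.symm, h] at this

variable {ι : Type} {z : Fin 5 → ι} {e : Pair → ι}
  {φ : MvPolynomial ι ℂ →ₐ[ℂ] MvPolynomial (Fin 5 ⊕ Fin 5) ℂ}

theorem map_skewX (hφe : ∀ p : Pair, φ (X (e p)) = minor p.1.1 p.1.2) (i j : Fin 5) :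
    φ (skewX e i j) = minor i j := by
  revert i j
  refine skew_cases (fun p => ?_) (fun k => ?_) (fun k l h => ?_)
  · rw [skewX_pair, hφe]
  · rw [skewX_self, map_zero, minor, sub_self]
  · rw [skewX_symm, map_neg, h, minor, minor, neg_sub]

/-- The quadratic relations between the `zₖ` and the `xᵢⱼ` which express `p ∧ (p ∧ q) = 0`. -/
def pluckerZ (z : Fin 5 → ι) (e : Pair → ι) (b c : Fin 5) : MvPolynomial ι ℂ :=
  ∑ k, ∑ i, ∑ j, eps k b c i j • (X (z k) * skewX e i j)

/-- The quadratic relations between the `xᵢⱼ` which express that the product of `p ∧ q` with any of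
its contractions, a linear combination of `p` and `q`, is zero. -/
def pluckerX (e : Pair → ι) (b c l : Fin 5) : MvPolynomial ι ℂ :=
  ∑ k, ∑ i, ∑ j, eps k b c i j • (skewX e k l * skewX e i j)

theorem map_pluckerZ (hφz : ∀ k, φ (X (z k)) = X (Sum.inl k))
    (hφe : ∀ p : Pair, φ (X (e p)) = minor p.1.1 p.1.2) (b c : Fin 5) :
    φ (pluckerZ z e b c) = 0 := by
  simp only [pluckerZ, map_sum, map_zsmul, map_mul, hφz, map_skewX hφe, minor, mul_sub, smul_sub,
    Finset.sum_sub_distrib]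
  rw [sum_eps_34 b c (fun k i j => (X (Sum.inl k) * (X (Sum.inl i) * X (Sum.inr j)) :
    MvPolynomial (Fin 5 ⊕ Fin 5) ℂ)), sum_eps_03, neg_zero, sub_zero]
  intro k i j
  ring

theorem map_pluckerX (hφe : ∀ p : Pair, φ (X (e p)) = minor p.1.1 p.1.2) (b c l : Fin 5) :
    φ (pluckerX e b c l) = 0 := by
  simp only [pluckerX, map_sum, map_zsmul, map_mul, map_skewX hφe]
  have h : ∀ k i j : Fin 5, minor k l * minor i j =
      (minor k l * (X (Sum.inl i) * X (Sum.inr j)) - minor k l * (X (Sum.inl j) * X (Sum.inr i))) :=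
    fun k i j => by simp only [minor]; ring
  simp only [h, smul_sub, Finset.sum_sub_distrib]
  rw [sum_eps_34 b c (fun k i j => minor k l * (X (Sum.inl i) * X (Sum.inr j)))]
  have h2 : ∑ k, ∑ i, ∑ j, eps k b c i j • (minor k l * (X (Sum.inl i) * X (Sum.inr j))) = 0 := by
    have h3 : ∀ k i j : Fin 5, minor k l * (X (Sum.inl i) * X (Sum.inr j)) =
        X (Sum.inl k) * X (Sum.inl i) * X (Sum.inr j) * X (Sum.inr l) -
        X (Sum.inl l) * X (Sum.inl i) * X (Sum.inr j) * X (Sum.inr k) :=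
      fun k i j => by simp only [minor]; ring
    simp only [h3, smul_sub, Finset.sum_sub_distrib]
    rw [sum_eps_03, sum_eps_04, sub_zero] <;> intro k i j <;> ring
  rw [h2, neg_zero, sub_zero]

/-- The action of a matrix on the polynomials in the entries of a `2 × 5` matrix. -/
abbrev derPQ (M : Matrix (Fin 5) (Fin 5) ℂ) :
    Derivation ℂ (MvPolynomial (Fin 5 ⊕ Fin 5) ℂ) (MvPolynomial (Fin 5 ⊕ Fin 5) ℂ) :=
  act1Op Sum.inl M + act1Op Sum.inr M

/-- The substitution of the minors is equivariant. -/
theorem map_act (hz : Function.Injective z) (he : Function.Injective e)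
    (hez : ∀ p k, e p ≠ z k) (hcov : ∀ s, (∃ k, z k = s) ∨ ∃ p, e p = s)
    (hφz : ∀ k, φ (X (z k)) = X (Sum.inl k))
    (hφe : ∀ p : Pair, φ (X (e p)) = minor p.1.1 p.1.2) (M : Matrix (Fin 5) (Fin 5) ℂ)
    (f : MvPolynomial ι ℂ) : φ ((act1Op z M + act2Op e M) f) =
      derPQ M (φ f) := by
  induction f using MvPolynomial.induction_on with
  | C a => rw [derivation_C, map_zero, ← algebraMap_eq, AlgHom.commutes, Derivation.map_algebraMap]
  | add f g hf hg => rw [map_add, map_add, hf, hg, map_add, map_add]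
  | mul_X f s hf =>
    have hs : φ ((act1Op z M + act2Op e M) (X s)) =
        derPQ M (φ (X s)) := by
      have h1 : ∀ k, derPQ M (X (Sum.inl k)) =
          ∑ i, M i k • (X (Sum.inl i) : MvPolynomial (Fin 5 ⊕ Fin 5) ℂ) := fun k =>
        act1Op_add_act1Op_X_left Sum.inl_injective (fun _ _ => Sum.inl_ne_inr) _ _ k
      have h2 : ∀ k, derPQ M (X (Sum.inr k)) =
          ∑ i, M i k • (X (Sum.inr i) : MvPolynomial (Fin 5 ⊕ Fin 5) ℂ) := fun k =>
        act1Op_add_act1Op_X_right Sum.inr_injective (fun _ _ => Sum.inl_ne_inr) _ _ k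
      rcases hcov s with ⟨k, rfl⟩ | ⟨p, rfl⟩
      · rw [act1Op_add_act2Op_X hz hez, hφz, h1]
        simp only [act1, map_sum, map_smul, hφz]
      · rw [← skewX_pair, act1Op_add_act2Op_skewX he hez, map_skewX hφe]
        simp only [act2, map_sum, map_add, map_smul, map_skewX hφe]
        rw [minor, map_sub, Derivation.leibniz, Derivation.leibniz, h1, h1, h2, h2]
        simp only [smul_eq_mul, Finset.mul_sum, ← Finset.sum_add_distrib, ← Finset.sum_sub_distrib]
        refine Finset.sum_congr rfl fun i _ => ?_
        simp only [minor, Algebra.smul_def]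
        ring
    rw [Derivation.leibniz, map_mul, Derivation.leibniz, map_add, smul_eq_mul, smul_eq_mul,
      smul_eq_mul, smul_eq_mul, map_mul, map_mul, hf, hs]

end Plucker

/-! ### Elements of the complements -/

section LowElements

variable {σ τ : Type}

theorem skewX_mem_bihom {e : Pair → σ ⊕ τ} {m n : ℕ}
    (he : ∀ p, bideg (Finsupp.single (e p) 1) = (m, n)) (i j : Fin 5) :
    skewX e i j ∈ bihom m n := by
  revert i j
  refine skew_cases (fun p => ?_) (fun k => ?_) (fun k l h => ?_)
  · rw [skewX_pair]
    exact isWeightedHomogeneous_monomial _ _ _ (he p)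
  · rw [skewX_self]; exact zero_mem _
  · rw [skewX_symm]; exact neg_mem h

theorem mul_mem_bihom {m n m' n' : ℕ} {f g : MvPolynomial (σ ⊕ τ) ℂ} (hf : f ∈ bihom m n)
    (hg : g ∈ bihom m' n') : f * g ∈ bihom (m + m') (n + n') :=
  IsWeightedHomogeneous.mul hf hg

theorem pluckerZ_mem_bihom {z : Fin 5 → σ ⊕ τ} {e : Pair → σ ⊕ τ} {m n m' n' : ℕ}
    (hz : ∀ p, bideg (Finsupp.single (z p) 1) = (m, n))
    (he : ∀ p, bideg (Finsupp.single (e p) 1) = (m', n')) (b c : Fin 5) :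
    pluckerZ z e b c ∈ bihom (m + m') (n + n') :=
  sum_mem fun k _ => sum_mem fun _ _ => sum_mem fun _ _ => zsmul_mem (mul_mem_bihom
    (isWeightedHomogeneous_monomial _ _ _ (hz k)) (skewX_mem_bihom he _ _)) _

theorem pluckerX_mem_bihom {e : Pair → σ ⊕ τ} {m n : ℕ}
    (he : ∀ p, bideg (Finsupp.single (e p) 1) = (m, n)) (b c l : Fin 5) :
    pluckerX e b c l ∈ bihom (m + m) (n + n) :=
  sum_mem fun _ _ => sum_mem fun _ _ => sum_mem fun _ _ => zsmul_mem (mul_mem_bihom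
    (skewX_mem_bihom he _ _) (skewX_mem_bihom he _ _)) _

variable [Fintype σ] [Fintype τ] [LieRingModule sl5 (MvPolynomial (σ ⊕ τ) ℂ)] {s₀ : σ} {t₀ : τ}

namespace UnitaryAction

/-- A bihomogeneous element of a submodule which contains none of the highest monomials lies in the
complement of the highest component. -/
theorem mem_low_of_mem_bihom (h : UnitaryAction σ τ s₀ t₀)
    {N : LieSubmodule ℂ sl5 (MvPolynomial (σ ⊕ τ) ℂ)}
    (hN : ∀ m n, X (Sum.inl s₀) ^ m * X (Sum.inr t₀) ^ n ∉ N) {m n : ℕ}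
    {f : MvPolynomial (σ ⊕ τ) ℂ} (hf : f ∈ N) (hb : f ∈ bihom m n) :
    f ∈ ⨆ m, ⨆ n, lowPart m n (high s₀ t₀ m n) := by
  let B : LieSubmodule ℂ sl5 (MvPolynomial (σ ⊕ τ) ℂ) :=
    { bihom m n with lie_mem := fun {A f} hf => h.lie_mem_bihom A m n f hf }
  refine LieSubmodule.mem_iSup_of_mem m (LieSubmodule.mem_iSup_of_mem n (h.mem_lowPart.2 ⟨hb, ?_⟩))
  rcases h.high_le_or_le_orth (N := N ⊓ B) (fun g hg => hg.2) with h1 | h1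
  · exact absurd (h1 (LieSubmodule.subset_lieSpan rfl)).1 (hN m n)
  · exact h1 ⟨hf, hb⟩

/-- A bihomogeneous polynomial whose multiples lie in a submodule without highest monomials
generates an ideal in the sum of the complements. -/
theorem mul_mem_low (h : UnitaryAction σ τ s₀ t₀)
    {N : LieSubmodule ℂ sl5 (MvPolynomial (σ ⊕ τ) ℂ)}
    (hN : ∀ m n, X (Sum.inl s₀) ^ m * X (Sum.inr t₀) ^ n ∉ N) {m n : ℕ}
    {r : MvPolynomial (σ ⊕ τ) ℂ} (hr : ∀ g, r * g ∈ N) (hb : r ∈ bihom m n)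
    (g : MvPolynomial (σ ⊕ τ) ℂ) : r * g ∈ ⨆ m, ⨆ n, lowPart m n (high s₀ t₀ m n) := by
  induction g using MvPolynomial.induction_on' with
  | monomial k a => exact h.mem_low_of_mem_bihom hN (hr _) (mul_mem_bihom hb
      (isWeightedHomogeneous_monomial _ _ _ (rfl : bideg k = ((bideg k).1, (bideg k).2))))
  | add p q hp hq => rw [mul_add]; exact add_mem hp hq

theorem fischer_low (h : UnitaryAction σ τ s₀ t₀) {f g : MvPolynomial (σ ⊕ τ) ℂ}
    (hf : f ∈ ⨆ m, ⨆ n, high s₀ t₀ m n)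
    (hg : g ∈ ⨆ m, ⨆ n, lowPart m n (high s₀ t₀ m n)) : fischer f g = 0 := by
  have h1 : (⨆ m, ⨆ n, high s₀ t₀ m n) ≤ h.orth (⨆ m, ⨆ n, lowPart m n (high s₀ t₀ m n)) :=
    iSup_le fun m => iSup_le fun n => fun f hf g hg =>
      fischer_eq_zero_symm.1 (h.mem_low.1 hg m n f hf)
  exact fischer_eq_zero_symm.1 (h1 hf g hg)

theorem mem_low_of_fischer (h : UnitaryAction σ τ s₀ t₀) {g : MvPolynomial (σ ⊕ τ) ℂ}
    (hg : ∀ f ∈ ⨆ m, ⨆ n, high s₀ t₀ m n, fischer f g = 0) :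
    g ∈ ⨆ m, ⨆ n, lowPart m n (high s₀ t₀ m n) :=
  h.mem_low.2 fun m n f hf => hg f (high_le_iSup m n hf)

end UnitaryAction

end LowElements

/-! ### Morphisms for quotient modules -/

section General

variable {V : Type} [AddCommGroup V] [Module ℂ V] [LieRingModule sl5 V]

theorem hasDegree_self_of_isNabla (θ : Fin 5 → Fin 5 → V →ₗ[ℂ] V) (φ : Verma V →ₗ[U] Verma V)
    (h : IsNabla θ φ) : HasDegree φ 1 := by
  have h1 := hasDegree_of_isNabla θ φ h (LieModuleHom.id (R := ℂ) (L := sl5) (M := V))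
  obtain ⟨r, u, l, hu, hl⟩ := h1
  exact ⟨r, u, l, hu, fun v => hl v⟩

/-- The construction of the morphism for a quotient module `S / K`, from operators on `S` whose
properties hold modulo `K`. -/
theorem exists_isNabla_quot [LieModule ℂ sl5 V] (K : LieSubmodule ℂ sl5 V)
    (θ : Fin 5 → Fin 5 → V →ₗ[ℂ] V) (hK : ∀ i j, ∀ f ∈ K, θ i j f ∈ K)
    (h0 : ∀ (A : sl5) i j v, ⁅A, θ i j v⁆ =
      θ i j ⁅A, v⁆ - ∑ a, (A.1 i a • θ a j v + A.1 j a • θ i a v))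
    (h1 : ∀ (w : Omega2cl) v, ∑ i, ∑ j, ⁅toG0 (brL (0, w) (d i j)), θ i j v⁆ ∈ K)
    (hs : ∀ i j v, θ j i v = -θ i j v) :
    ∃ θ' : Fin 5 → Fin 5 → (V ⧸ K) →ₗ[ℂ] (V ⧸ K),
      (∀ i j f, θ' i j (LieSubmodule.Quotient.mk f) = LieSubmodule.Quotient.mk (θ i j f)) ∧
      ∃ φ : Verma (V ⧸ K) →ₗ[U] Verma (V ⧸ K), IsNabla θ' φ ∧ HasDegree φ 1 ∧
        (∀ N : LieSubmodule ℂ sl5 V,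
          φ ∘ₗ Verma.map (N.map (LieSubmodule.Quotient.mk' K)).incl = 0 ↔
            ∀ i j, ∀ v ∈ N, θ i j v ∈ K) ∧
        ∀ N : LieSubmodule ℂ sl5 (V ⧸ K), HasDegree (φ ∘ₗ Verma.map N.incl) 1 := by
  let θ' : Fin 5 → Fin 5 → (V ⧸ K) →ₗ[ℂ] (V ⧸ K) := fun i j =>
    Submodule.mapQ K.toSubmodule K.toSubmodule (θ i j) (fun f hf => hK i j f hf)
  have hθ : ∀ i j f, θ' i j (LieSubmodule.Quotient.mk' K f) =
      LieSubmodule.Quotient.mk' K (θ i j f) := fun i j f => rfl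
  have hsurj := LieSubmodule.Quotient.surjective_mk' K
  obtain ⟨φ, hφ⟩ := exists_isNabla θ' (fun A i j v => by
    obtain ⟨f, rfl⟩ := hsurj v
    simp only [hθ, ← LieModuleHom.map_lie, h0]
    simp only [map_sub, map_sum, map_add, map_smul]) (fun w _ v => by
    obtain ⟨f, rfl⟩ := hsurj v
    simp only [hθ, ← LieModuleHom.map_lie, ← map_sum]
    exact (LieSubmodule.Quotient.mk_eq_zero K).2 (h1 w f))
  have hs' : ∀ i j v, θ' j i v = -θ' i j v := fun i j v => by
    obtain ⟨f, rfl⟩ := hsurj v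
    rw [hθ, hθ, hs, map_neg]
  refine ⟨θ', fun i j f => rfl, φ, hφ, hasDegree_self_of_isNabla θ' φ hφ, fun N => ?_,
    fun N => hasDegree_of_isNabla θ' φ hφ N.incl⟩
  rw [isNabla_comp_eq_zero_iff θ' φ hφ hs']
  constructor
  · intro h i j v hv
    exact (LieSubmodule.Quotient.mk_eq_zero K).1
      (h i j _ ((LieSubmodule.mem_map _).2 ⟨v, hv, rfl⟩))
  · intro h i j v hv
    obtain ⟨f, hf, rfl⟩ := (LieSubmodule.mem_map _).1 hv
    exact (LieSubmodule.Quotient.mk_eq_zero K).2 (h i j f hf)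

theorem fischer_zsmul_left {ι : Type} (c : ℤ) (f g : MvPolynomial ι ℂ) :
    fischer (c • f) g = c * fischer f g := by
  rw [← Int.cast_smul_eq_zsmul ℂ, fischer_smul_left]
  simp

theorem fischer_zsmul_right {ι : Type} (c : ℤ) (f g : MvPolynomial ι ℂ) :
    fischer f (c • g) = c * fischer f g := by
  rw [← Int.cast_smul_eq_zsmul ℂ, fischer_smul_right]

theorem derivation_X_pow_mul_X_pow {ι : Type}
    (D : Derivation ℂ (MvPolynomial ι ℂ) (MvPolynomial ι ℂ)) (x y : MvPolynomial ι ℂ) (m n : ℕ) :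
    D (x ^ m * y ^ n) = (m : ℂ) • (x ^ (m - 1) * y ^ n * D x) +
      (n : ℂ) • (x ^ m * y ^ (n - 1) * D y) := by
  rw [Derivation.leibniz, Derivation.leibniz_pow, Derivation.leibniz_pow]
  simp only [smul_eq_mul, ← Nat.cast_smul_eq_nsmul ℂ, Algebra.smul_def]
  ring

theorem sum_rotate {P : Type} [AddCommMonoid P] (F : Fin 5 → Fin 5 → Fin 5 → Fin 5 → P) :
    ∑ k, ∑ i, ∑ j, ∑ l, F k i j l = ∑ l, ∑ k, ∑ i, ∑ j, F k i j l := by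
  simp only [← Fintype.sum_prod_type']
  exact Fintype.sum_equiv ⟨fun p => (p.2.2.2, p.1, p.2.1, p.2.2.1),
    fun p => (p.2.1, p.2.2.1, p.2.2.2, p.1), fun _ => rfl, fun _ => rfl⟩ _ _ fun _ => rfl

theorem X_pow_mul_X_pow_ne_zero {ι : Type} (s t : ι) (m n : ℕ) :
    (X s ^ m * X t ^ n : MvPolynomial ι ℂ) ≠ 0 :=
  mul_ne_zero (pow_ne_zero _ (X_ne_zero _)) (pow_ne_zero _ (X_ne_zero _))

end General

/-! ### The case `X = A` -/

section CaseA

/-- The substitution `zₖ ↦ pₖ`, `xₖₗ ↦ pₖ qₗ - pₗ qₖ`. -/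
def substA : SA →ₐ[ℂ] MvPolynomial (Fin 5 ⊕ Fin 5) ℂ :=
  aeval (Sum.elim (fun k => X (Sum.inl k)) fun p => minor p.1.1 p.1.2)

theorem substA_z (k : Fin 5) : substA (X (Sum.inl k)) = X (Sum.inl k) := aeval_X _ _

theorem substA_x (p : Pair) : substA (X (Sum.inr p)) = minor p.1.1 p.1.2 := aeval_X _ _

/-- The kernel of the substitution. It contains the quadratic relations but no highest monomial. -/
def kerA : LieSubmodule ℂ sl5 SA :=
  { LinearMap.ker substA.toLinearMap with
    lie_mem := fun {A f} hf => by
      have hf' : substA f = 0 := hf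
      change substA ⁅A, f⁆ = 0
      rw [lie_SA, map_act Sum.inl_injective Sum.inr_injective (fun _ _ => Sum.inr_ne_inl)
        (fun s => by rcases s with k | p; exacts [Or.inl ⟨k, rfl⟩, Or.inr ⟨p, rfl⟩])
        substA_z substA_x, hf', map_zero] }

theorem mem_kerA {f : SA} : f ∈ kerA ↔ substA f = 0 := Iff.rfl

theorem top_notMem_kerA (m n : ℕ) :
    (X (Sum.inl 0) ^ m * X (Sum.inr ⟨(0, 1), by decide⟩) ^ n : SA) ∉ kerA := by
  rw [mem_kerA, map_mul, map_pow, map_pow, substA_z, substA_x]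
  exact mul_ne_zero (pow_ne_zero _ (X_ne_zero _)) (pow_ne_zero _ (minor_ne_zero (by decide)))

theorem thetaA_apply (i j : Fin 5) (f : SA) : thetaA i j f = skewD Sum.inr i j f := by
  revert i j
  refine skew_cases (fun p => ?_) (fun k => ?_) (fun k l h => ?_)
  · rw [skewD_pair, thetaA, skew_of_lt]; rfl
  · rw [skewD_self, thetaA]; simp [skew]
  · rw [skewD_apply_symm, ← h, thetaA, skew_symm]; rfl

theorem lie_thetaA (A : sl5) (i j : Fin 5) (f : SA) : ⁅A, thetaA i j f⁆ =
    thetaA i j ⁅A, f⁆ - ∑ a, (A.1 i a • thetaA a j f + A.1 j a • thetaA i a f) := by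
  simp only [thetaA_apply, lie_SA, Derivation.add_apply, map_add]
  rw [act1Op_skewD Sum.inr_injective (fun _ _ => Sum.inr_ne_inl),
    act2Op_skewD Sum.inr_injective, add_sub_assoc]

theorem thetaA_top (i j : Fin 5) (m n : ℕ) :
    thetaA i j (X (Sum.inl 0) ^ m * X (Sum.inr ⟨(0, 1), by decide⟩) ^ n) =
      (n * ((if i = 0 ∧ j = 1 then 1 else 0) - if i = 1 ∧ j = 0 then 1 else 0) : ℂ) •
        (X (Sum.inl 0) ^ m * X (Sum.inr ⟨(0, 1), by decide⟩) ^ (n - 1)) := by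
  have hx : X (Sum.inr ⟨(0, 1), by decide⟩) = (skewX Sum.inr 0 1 : SA) := rfl
  rw [thetaA_apply, derivation_X_pow_mul_X_pow, skewD_X (fun _ => Sum.inr_ne_inl), mul_zero,
    smul_zero, zero_add, hx, skewD_skewX Sum.inr_injective, mul_comm _ (C _), C_mul', smul_smul]

/-- By equivariance of `θᴬ`, it suffices that the highest monomials are mapped to `V_A`. -/
theorem thetaA_mem_VA (i j : Fin 5) (f : SA) (hf : f ∈ VA) : thetaA i j f ∈ VA := by
  let N : LieSubmodule ℂ sl5 SA :=
    { carrier := {f | ∀ i j, thetaA i j f ∈ VA}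
      add_mem' := fun {f g} hf hg i j => by rw [map_add]; exact add_mem (hf i j) (hg i j)
      zero_mem' := fun i j => by rw [map_zero]; exact zero_mem _
      smul_mem' := fun c f hf i j => by rw [map_smul]; exact VA.smul_mem c (hf i j)
      lie_mem := fun {A f} hf i j => by
        have h := lie_thetaA A i j f
        rw [eq_sub_iff_add_eq] at h
        rw [← h]
        exact add_mem (VA.lie_mem (hf i j)) (sum_mem fun a _ =>
          add_mem (VA.smul_mem _ (hf a j)) (VA.smul_mem _ (hf i a))) }
  have h1 : VA ≤ N := iSup_le fun m => iSup_le fun n => by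
    refine LieSubmodule.lieSpan_le.2 (Set.singleton_subset_iff.2 fun i j => ?_)
    refine (thetaA_top i j m n).symm ▸ VA.smul_mem _ ?_
    exact high_le_iSup m (n - 1) (LieSubmodule.subset_lieSpan rfl)
  exact h1 hf i j

/-- The second-order operators adjoint to the quadratic relations kill `V_A`, because the multiples
of these relations are orthogonal to `V_A`. -/
theorem sum_pderiv_thetaA (b c : Fin 5) {f : SA} (hf : f ∈ VA) :
    ∑ k, ∑ i, ∑ j, eps k b c i j • pderiv (Sum.inl k) (skewD Sum.inr i j f) = 0 := by
  refine eq_zero_of_fischer_self _ ?_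
  generalize hg : ∑ k, ∑ i, ∑ j, eps k b c i j • pderiv (Sum.inl k) (skewD Sum.inr i j f) = g
  nth_rw 1 [← hg]
  have h1 := unitaryA.fischer_low hf (unitaryA.mul_mem_low top_notMem_kerA (fun g => by
    rw [mem_kerA, map_mul, map_pluckerZ substA_z substA_x, zero_mul])
    (pluckerZ_mem_bihom (z := Sum.inl) (e := Sum.inr) (m := 1) (n := 0) (m' := 0) (n' := 1)
      (fun p => by simp [bideg_single]) (fun p => by simp [bideg_single]) b c) g)
  rw [← h1, pluckerZ]
  simp only [Finset.sum_mul, fischer_sum_left, fischer_sum_right, smul_mul_assoc,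
    fischer_zsmul_left, fischer_zsmul_right, fischer_pderiv, fischer_skewD]
  refine Finset.sum_congr rfl fun k _ => Finset.sum_congr rfl fun i _ =>
    Finset.sum_congr rfl fun j _ => ?_
  congr 2
  ring

theorem sum_skewD_thetaA (b c l : Fin 5) {f : SA} (hf : f ∈ VA) :
    ∑ k, ∑ i, ∑ j, eps k b c i j • skewD Sum.inr k l (skewD Sum.inr i j f) = 0 := by
  refine eq_zero_of_fischer_self _ ?_
  generalize hg : ∑ k, ∑ i, ∑ j, eps k b c i j • skewD Sum.inr k l (skewD Sum.inr i j f) = g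
  nth_rw 1 [← hg]
  have h1 := unitaryA.fischer_low hf (unitaryA.mul_mem_low top_notMem_kerA (fun g => by
    rw [mem_kerA, map_mul, map_pluckerX substA_x, zero_mul])
    (pluckerX_mem_bihom (e := Sum.inr) (m := 0) (n := 1) (fun p => by simp [bideg_single]) b c l) g)
  rw [← h1, pluckerX]
  simp only [Finset.sum_mul, fischer_sum_left, fischer_sum_right, smul_mul_assoc,
    fischer_zsmul_left, fischer_zsmul_right, fischer_skewD]
  refine Finset.sum_congr rfl fun k _ => Finset.sum_congr rfl fun i _ =>
    Finset.sum_congr rfl fun j _ => ?_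
  congr 2
  ring

theorem sum_lie_thetaA (w : Omega2cl) {f : SA} (hf : f ∈ VA) :
    ∑ i, ∑ j, ⁅toG0 (brL (0, w) (d i j)), thetaA i j f⁆ = 0 := by
  refine (Submodule.mem_bot ℂ).1 (sum_lie_mem ⊥ (fun a k f => X (Sum.inl a) * pderiv (Sum.inl k) f +
    ∑ l, skewX Sum.inr a l * skewD Sum.inr k l f) (fun A f => ?_) (fun i j => thetaA i j f)
    (fun _ _ _ => 0) (fun _ _ _ => rfl) (fun a b c => ?_) w)
  · rw [lie_SA, Derivation.add_apply, act1Op_apply, act2Op_apply]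
    simp only [smul_add, Finset.sum_add_distrib]
  · rw [sub_zero, Submodule.mem_bot]
    have e1 : ∀ (x : SA) (F : Fin 5 → Fin 5 → Fin 5 → SA), ∑ k, ∑ i, ∑ j,
        eps k b c i j • (x * F k i j) = x * ∑ k, ∑ i, ∑ j, eps k b c i j • F k i j := by
      intro x F
      simp only [Finset.mul_sum, mul_smul_comm]
    have e2 : ∑ k, ∑ i, ∑ j, eps k b c i j • ∑ l, skewX Sum.inr a l *
        skewD Sum.inr k l (skewD Sum.inr i j f) = ∑ l, ∑ k, ∑ i, ∑ j, eps k b c i j •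
          (skewX Sum.inr a l * skewD Sum.inr k l (skewD Sum.inr i j f)) := by
      simp only [Finset.smul_sum]
      exact sum_rotate _
    simp only [thetaA_apply, smul_add, Finset.sum_add_distrib]
    rw [e1, sum_pderiv_thetaA b c hf, mul_zero, zero_add, e2]
    simp only [e1, sum_skewD_thetaA b c _ hf, mul_zero, Finset.sum_const_zero]

theorem thetaA_of_mem_bihom {m : ℕ} {f : SA} (hf : f ∈ bihom m 0) (i j : Fin 5) :
    thetaA i j f = 0 := by
  rw [thetaA_apply]
  revert i j
  refine skew_cases (fun p => ?_) (fun k => ?_) (fun k l h => ?_)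
  · rw [skewD_pair]
    ext k
    rw [coeff_pderiv, coeff_zero]
    by_contra h0
    have h1 := mem_bihom.1 hf _ (left_ne_zero_of_mul h0)
    rw [map_add, bideg_single] at h1
    have := congrArg Prod.snd h1
    simp at this
  · rw [skewD_self]; rfl
  · rw [skewD_apply_symm, h, neg_zero]

end CaseA

/-! ### The case `X = B` -/

section CaseB

theorem thetaB_apply (i j : Fin 5) (f : SB) : thetaB i j f =
    X (Sum.inr i) * pderiv (Sum.inl j) f - X (Sum.inr j) * pderiv (Sum.inl i) f := rfl

/-- The adjoint of `θᴮᵢⱼ`. -/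
def thetaBAdj (i j : Fin 5) : SB →ₗ[ℂ] SB :=
  LinearMap.mulLeft ℂ (X (Sum.inl j)) ∘ₗ (pderiv (Sum.inr i) : Derivation ℂ SB SB).toLinearMap -
    LinearMap.mulLeft ℂ (X (Sum.inl i)) ∘ₗ (pderiv (Sum.inr j) : Derivation ℂ SB SB).toLinearMap

theorem thetaBAdj_apply (i j : Fin 5) (f : SB) : thetaBAdj i j f =
    X (Sum.inl j) * pderiv (Sum.inr i) f - X (Sum.inl i) * pderiv (Sum.inr j) f := rfl

theorem fischer_thetaB (i j : Fin 5) (f g : SB) :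
    fischer (thetaBAdj i j f) g = fischer f (thetaB i j g) := by
  rw [thetaBAdj_apply, thetaB_apply, sub_eq_add_neg, sub_eq_add_neg, fischer_add_left,
    fischer_add_right, fischer_neg_left, fischer_neg_right, fischer_X_mul_pderiv,
    fischer_X_mul_pderiv]

theorem pderiv_act1Op_of_ne {ι : Type} {z : Fin 5 → ι} {s : ι} (hs : ∀ k, z k ≠ s)
    (M : Matrix (Fin 5) (Fin 5) ℂ) (f : MvPolynomial ι ℂ) :
    act1Op z M (pderiv s f) = pderiv s (act1Op z M f) := by
  classical
  have hD : ⁅act1Op z M, (pderiv s : Derivation ℂ (MvPolynomial ι ℂ) (MvPolynomial ι ℂ))⁆ = 0 := by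
    refine derivation_ext fun t => ?_
    rw [Derivation.commutator_apply, Derivation.zero_apply, pderiv_X, Pi.single_apply]
    have h1 : act1Op z M (if t = s then 1 else 0 : MvPolynomial ι ℂ) = 0 := by
      split_ifs <;> simp
    rw [h1, zero_sub, neg_eq_zero, act1Op_apply, map_sum]
    refine Finset.sum_eq_zero fun a _ => ?_
    rw [map_sum]
    refine Finset.sum_eq_zero fun k _ => ?_
    rw [Derivation.map_smul, Derivation.leibniz, pderiv_X_of_ne (hs a), pderiv_X, Pi.single_apply]
    split_ifs <;> simp
  have h2 := congrArg (fun D => D f) hD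
  rw [Derivation.commutator_apply, Derivation.zero_apply] at h2
  exact sub_eq_zero.1 h2

theorem derB_pderiv_z (M : Matrix (Fin 5) (Fin 5) ℂ) (j : Fin 5) (f : SB) :
    derB M (pderiv (Sum.inl j) f) =
      pderiv (Sum.inl j) (derB M f) - ∑ a, M j a • pderiv (Sum.inl a) f := by
  rw [Derivation.add_apply, Derivation.add_apply, act1Op_pderiv Sum.inl_injective,
    pderiv_act1Op_of_ne (fun _ => Sum.inr_ne_inl), map_add]
  ring

theorem derB_pderiv_z' (M : Matrix (Fin 5) (Fin 5) ℂ) (j : Fin 5) (f : SB) :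
    derB M (pderiv (Sum.inr j) f) =
      pderiv (Sum.inr j) (derB M f) + ∑ a, M a j • pderiv (Sum.inr a) f := by
  rw [Derivation.add_apply, Derivation.add_apply, act1Op_pderiv Sum.inr_injective,
    pderiv_act1Op_of_ne (fun _ => Sum.inl_ne_inr), map_add]
  simp only [Matrix.neg_apply, Matrix.transpose_apply, neg_smul, Finset.sum_neg_distrib]
  ring

theorem lie_thetaB (A : sl5) (i j : Fin 5) (f : SB) : ⁅A, thetaB i j f⁆ =
    thetaB i j ⁅A, f⁆ - ∑ a, (A.1 i a • thetaB a j f + A.1 j a • thetaB i a f) := by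
  simp only [thetaB_apply, lie_SB, map_sub (derB A.1), Derivation.leibniz (derB A.1),
    derB_pderiv_z, derB_z', smul_eq_mul]
  simp only [act1, Matrix.neg_apply, Matrix.transpose_apply, mul_sub, smul_sub,
    Finset.sum_add_distrib, Finset.sum_sub_distrib, Finset.mul_sum, neg_smul,
    Finset.sum_neg_distrib, mul_smul_comm, mul_neg]
  simp only [mul_comm (pderiv _ f)]
  ring

theorem lie_thetaBAdj (A : sl5) (i j : Fin 5) (f : SB) : ⁅A, thetaBAdj i j f⁆ =
    thetaBAdj i j ⁅A, f⁆ + ∑ a, (A.1 a i • thetaBAdj a j f + A.1 a j • thetaBAdj i a f) := by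
  simp only [thetaBAdj_apply, lie_SB, map_sub (derB A.1), Derivation.leibniz (derB A.1),
    derB_pderiv_z', derB_z, smul_eq_mul]
  simp only [act1, mul_add, smul_sub, Finset.sum_add_distrib, Finset.sum_sub_distrib,
    Finset.mul_sum, mul_smul_comm]
  simp only [mul_comm (pderiv _ f)]
  ring

/-- The adjoint of `θᴮᵢⱼ` maps highest monomials to the span of the highest components. -/
theorem thetaBAdj_top (i j : Fin 5) (m n : ℕ) :
    thetaBAdj i j (X (Sum.inl 0) ^ m * X (Sum.inr 4) ^ n) ∈ ⨆ m, ⨆ n, highB m n := by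
  set H : LieSubmodule ℂ sl5 SB := ⨆ m, ⨆ n, highB m n with hH
  have hd : ∀ i : Fin 5, pderiv (Sum.inr i) (X (Sum.inl 0) ^ m * X (Sum.inr 4) ^ n : SB) =
      if i = 4 then (n : ℂ) • (X (Sum.inl 0) ^ m * X (Sum.inr 4) ^ (n - 1)) else 0 := by
    intro i
    rw [derivation_X_pow_mul_X_pow, pderiv_X_of_ne Sum.inl_ne_inr, mul_zero, smul_zero, zero_add]
    split_ifs with h
    · rw [h, pderiv_X_self, mul_one]
    · rw [pderiv_X_of_ne fun h' => h (Sum.inr_injective h').symm, mul_zero, smul_zero]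
  -- `z_j z₁ᵐ z₅*ⁿ` is a multiple of the image of `z₁ᵐ⁺¹ z₅*ⁿ` under an elementary matrix
  have key : ∀ j : Fin 5, j ≠ 4 → ∀ n, (X (Sum.inl j) * (X (Sum.inl 0) ^ m * X (Sum.inr 4) ^ n) :
      SB) ∈ H := by
    intro j hj n
    have htop : (X (Sum.inl 0) ^ (m + 1) * X (Sum.inr 4) ^ n : SB) ∈ H :=
      high_le_iSup (m + 1) n (LieSubmodule.subset_lieSpan rfl)
    by_cases h0 : j = 0
    · rw [h0, ← mul_assoc, ← pow_succ']
      exact htop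
    · have h1 : ⁅LieAlgebra.SpecialLinear.single j 0 h0 (1 : ℂ), _⁆ ∈ H := H.lie_mem htop
      rw [lie_SB, single_val, derivation_X_pow_mul_X_pow, derB_z, derB_z', act1_single, if_pos rfl,
        Matrix.transpose_single, act1_neg, act1_single, if_neg hj, neg_zero, mul_zero, smul_zero,
        add_zero, Nat.add_sub_cancel] at h1
      have h2 := H.smul_mem ((m + 1 : ℕ) : ℂ)⁻¹ h1
      rwa [smul_smul, inv_mul_cancel₀ (Nat.cast_ne_zero.2 (Nat.succ_ne_zero m)), one_smul,
        mul_comm] at h2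
  rw [thetaBAdj_apply, hd, hd]
  by_cases hi : i = 4 <;> by_cases hj : j = 4
  · rw [hi, hj, sub_self]; exact zero_mem _
  · rw [if_pos hi, if_neg hj, mul_zero, sub_zero, mul_smul_comm]
    exact H.smul_mem _ (key j hj _)
  · rw [if_neg hi, if_pos hj, mul_zero, zero_sub, mul_smul_comm]
    exact neg_mem (H.smul_mem _ (key i hi _))
  · rw [if_neg hi, if_neg hj, mul_zero, mul_zero, sub_self]; exact zero_mem _

theorem thetaBAdj_mem (i j : Fin 5) (f : SB) (hf : f ∈ ⨆ m, ⨆ n, highB m n) :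
    thetaBAdj i j f ∈ ⨆ m, ⨆ n, highB m n := by
  set H : LieSubmodule ℂ sl5 SB := ⨆ m, ⨆ n, highB m n with hH
  let N : LieSubmodule ℂ sl5 SB :=
    { carrier := {f | ∀ i j, thetaBAdj i j f ∈ H}
      add_mem' := fun {f g} hf hg i j => by rw [map_add]; exact add_mem (hf i j) (hg i j)
      zero_mem' := fun i j => by rw [map_zero]; exact zero_mem _
      smul_mem' := fun c f hf i j => by rw [map_smul]; exact H.smul_mem c (hf i j)
      lie_mem := fun {A f} hf i j => by
        have h := lie_thetaBAdj A i j f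
        rw [← sub_eq_iff_eq_add] at h
        rw [← h]
        exact sub_mem (H.lie_mem (hf i j)) (sum_mem fun a _ =>
          add_mem (H.smul_mem _ (hf a j)) (H.smul_mem _ (hf i a))) }
  have h1 : H ≤ N := iSup_le fun m => iSup_le fun n =>
    LieSubmodule.lieSpan_le.2 (Set.singleton_subset_iff.2 fun i j => thetaBAdj_top i j m n)
  exact h1 hf i j

/-- The adjoint operators preserve the sum of the highest components, hence `θᴮ` preserves its
orthogonal complement. -/
theorem thetaB_mem_lowB (i j : Fin 5) (f : SB) (hf : f ∈ lowB) : thetaB i j f ∈ lowB :=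
  unitaryB.mem_low_of_fischer fun g hg => by
    rw [← fischer_thetaB]
    exact unitaryB.fischer_low (thetaBAdj_mem i j g hg) hf

/-- The odd relation holds in `S_B` itself, before passing to the quotient. -/
theorem sum_lie_thetaB (w : Omega2cl) (f : SB) :
    ∑ i, ∑ j, ⁅toG0 (brL (0, w) (d i j)), thetaB i j f⁆ = 0 := by
  refine (Submodule.mem_bot ℂ).1 (sum_lie_mem ⊥ (fun a k f => X (Sum.inl a) * pderiv (Sum.inl k) f -
    X (Sum.inr k) * pderiv (Sum.inr a) f) (fun A f => ?_) (fun i j => thetaB i j f)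
    (fun a b c => -(2 : ℂ) • ∑ k, ∑ j, eps k b c a j • (X (Sum.inr k) * pderiv (Sum.inl j) f))
    (fun a b c => ?_) (fun a b c => ?_) w)
  · rw [lie_SB, Derivation.add_apply, act1Op_apply, act1Op_apply]
    simp only [smul_sub, Finset.sum_sub_distrib, Matrix.neg_apply, Matrix.transpose_apply, neg_smul,
      Finset.sum_neg_distrib, ← sub_eq_add_neg]
    rw [Finset.sum_comm (f := fun a k => A.1 k a • (X (Sum.inr a) * pderiv (Sum.inr k) f))]
  · simp only [eps_rotate_123]
  · classical
    rw [Submodule.mem_bot, sub_eq_zero]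
    set F : Fin 5 → Fin 5 → Fin 5 → SB := fun k i j =>
      X (Sum.inl a) * (X (Sum.inr i) * pderiv (Sum.inl k) (pderiv (Sum.inl j) f)) -
      X (Sum.inr k) * (X (Sum.inr i) * pderiv (Sum.inr a) (pderiv (Sum.inl j) f)) -
      (if i = a then X (Sum.inr k) * pderiv (Sum.inl j) f else 0) with hF
    have e : ∀ k i j, X (Sum.inl a) * pderiv (Sum.inl k) (thetaB i j f) -
        X (Sum.inr k) * pderiv (Sum.inr a) (thetaB i j f) = F k i j - F k j i := by
      intro k i j
      have h1 : ∀ i : Fin 5, pderiv (Sum.inr a) (X (Sum.inr i) : SB) = if i = a then 1 else 0 := by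
        intro i
        rw [pderiv_X, Pi.single_apply]
        simp only [Sum.inr_injective.eq_iff]
      rw [thetaB_apply]
      simp only [hF, map_sub, Derivation.leibniz, smul_eq_mul, h1,
        pderiv_X_of_ne (Sum.inr_ne_inl : (Sum.inr _ : Fin 5 ⊕ Fin 5) ≠ Sum.inl _)]
      split_ifs <;> ring
    have s1 : ∑ k, ∑ i, ∑ j, eps k b c i j • F k i j =
        -∑ k, ∑ j, eps k b c a j • (X (Sum.inr k) * pderiv (Sum.inl j) f) := by
      simp only [hF, smul_sub, Finset.sum_sub_distrib]
      rw [sum_eps_04 b c (fun k i j => X (Sum.inl a) * (X (Sum.inr i) *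
          pderiv (Sum.inl k) (pderiv (Sum.inl j) f))),
        sum_eps_03 b c (fun k i j => X (Sum.inr k) * (X (Sum.inr i) *
          pderiv (Sum.inr a) (pderiv (Sum.inl j) f)))]
      · rw [sub_self, zero_sub]
        congr 1
        refine Finset.sum_congr rfl fun k _ => ?_
        rw [Finset.sum_eq_single a]
        · simp
        · intro i _ hi
          simp [hi]
        · simp
      · intro k i j; ring
      · intro k i j; rw [pderiv_comm]
    simp only [e, smul_sub, Finset.sum_sub_distrib]
    rw [sum_eps_34 b c F, s1]
    module

theorem thetaB_of_mem_bihom {n : ℕ} {f : SB} (hf : f ∈ bihom 0 n) (i j : Fin 5) :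
    thetaB i j f = 0 := by
  have h : ∀ j : Fin 5, pderiv (Sum.inl j) f = 0 := by
    intro j
    ext k
    rw [coeff_pderiv, coeff_zero]
    by_contra h0
    have h1 := mem_bihom.1 hf _ (left_ne_zero_of_mul h0)
    rw [map_add, bideg_single] at h1
    have := congrArg Prod.fst h1
    simp at this
  rw [thetaB_apply, h, h, mul_zero, mul_zero, sub_zero]

theorem thetaB_top (m n : ℕ) : thetaB 4 0 (X (Sum.inl 0) ^ m * X (Sum.inr 4) ^ n) =
    (m : ℂ) • (X (Sum.inl 0) ^ (m - 1) * X (Sum.inr 4) ^ (n + 1)) := by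
  rw [thetaB_apply, derivation_X_pow_mul_X_pow, derivation_X_pow_mul_X_pow, pderiv_X_self,
    pderiv_X_of_ne (Sum.inr_ne_inl : (Sum.inr _ : Fin 5 ⊕ Fin 5) ≠ Sum.inl _),
    pderiv_X_of_ne (Sum.inr_ne_inl : (Sum.inr _ : Fin 5 ⊕ Fin 5) ≠ Sum.inl _),
    pderiv_X_of_ne (fun h => absurd (Sum.inl_injective h) (by decide))]
  simp only [Algebra.smul_def, map_natCast]
  ring

end CaseB

/-! ### The case `X = C` -/

section CaseC

/-- The substitution `zₖ* ↦ pₖ`, `xₖₗ* ↦ pₖ qₗ - pₗ qₖ`. -/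
def substC : SC →ₐ[ℂ] MvPolynomial (Fin 5 ⊕ Fin 5) ℂ :=
  aeval (Sum.elim (fun p => minor p.1.1 p.1.2) fun k => X (Sum.inl k))

theorem substC_z (k : Fin 5) : substC (X (Sum.inr k)) = X (Sum.inl k) := aeval_X _ _

theorem substC_x (p : Pair) : substC (X (Sum.inl p)) = minor p.1.1 p.1.2 := aeval_X _ _

/-- The kernel of the substitution. It contains the quadratic relations but no highest monomial. -/
def kerC : LieSubmodule ℂ sl5 SC :=
  { LinearMap.ker substC.toLinearMap with
    lie_mem := fun {A f} hf => by
      have hf' : substC f = 0 := hf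
      change substC ⁅A, f⁆ = 0
      rw [lie_SC, map_act Sum.inr_injective Sum.inl_injective (fun _ _ => Sum.inl_ne_inr)
        (fun s => by rcases s with p | k; exacts [Or.inr ⟨p, rfl⟩, Or.inl ⟨k, rfl⟩])
        substC_z substC_x, hf', map_zero] }

theorem mem_kerC {f : SC} : f ∈ kerC ↔ substC f = 0 := Iff.rfl

theorem top_notMem_kerC (m n : ℕ) :
    (X (Sum.inl ⟨(3, 4), by decide⟩) ^ m * X (Sum.inr 4) ^ n : SC) ∉ kerC := by
  rw [mem_kerC, map_mul, map_pow, map_pow, substC_z, substC_x]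
  exact mul_ne_zero (pow_ne_zero _ (minor_ne_zero (by decide))) (pow_ne_zero _ (X_ne_zero _))

theorem thetaC_apply (i j : Fin 5) (f : SC) : thetaC i j f = skewX Sum.inl i j * f := rfl

theorem lie_thetaC (A : sl5) (i j : Fin 5) (f : SC) : ⁅A, thetaC i j f⁆ =
    thetaC i j ⁅A, f⁆ - ∑ a, (A.1 i a • thetaC a j f + A.1 j a • thetaC i a f) := by
  simp only [thetaC_apply, lie_SC, Derivation.leibniz, derC_x, act2_neg, smul_eq_mul]
  rw [act2, sub_eq_add_neg]
  congr 1
  rw [mul_neg, Finset.mul_sum]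
  congr 1
  refine Finset.sum_congr rfl fun a _ => ?_
  simp only [Matrix.transpose_apply, add_mul, smul_mul_assoc, mul_comm f]

theorem lie_skewD_C (A : sl5) (i j : Fin 5) (f : SC) : ⁅A, skewD Sum.inl i j f⁆ =
    skewD Sum.inl i j ⁅A, f⁆ +
      ∑ a, (A.1 a i • skewD Sum.inl a j f + A.1 a j • skewD Sum.inl i a f) := by
  simp only [lie_SC, Derivation.add_apply, map_add]
  rw [act1Op_skewD Sum.inl_injective (fun _ _ => Sum.inl_ne_inr),
    act2Op_skewD Sum.inl_injective, ← add_sub_assoc, sub_eq_add_neg, ← Finset.sum_neg_distrib]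
  congr 1
  refine Finset.sum_congr rfl fun a _ => ?_
  rw [Matrix.neg_apply, Matrix.neg_apply, Matrix.transpose_apply, Matrix.transpose_apply, neg_smul,
    neg_smul, ← neg_add, neg_neg]

theorem skewD_mem_highC (i j : Fin 5) (f : SC) (hf : f ∈ ⨆ m, ⨆ n, highC m n) :
    skewD Sum.inl i j f ∈ ⨆ m, ⨆ n, highC m n := by
  set H : LieSubmodule ℂ sl5 SC := ⨆ m, ⨆ n, highC m n with hH
  let N : LieSubmodule ℂ sl5 SC :=
    { carrier := {f | ∀ i j, skewD Sum.inl i j f ∈ H}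
      add_mem' := fun {f g} hf hg i j => by rw [map_add]; exact add_mem (hf i j) (hg i j)
      zero_mem' := fun i j => by rw [map_zero]; exact zero_mem _
      smul_mem' := fun c f hf i j => by
        rw [Derivation.map_smul]; exact H.smul_mem c (hf i j)
      lie_mem := fun {A f} hf i j => by
        have h := lie_skewD_C A i j f
        rw [← sub_eq_iff_eq_add] at h
        rw [← h]
        exact sub_mem (H.lie_mem (hf i j)) (sum_mem fun a _ =>
          add_mem (H.smul_mem _ (hf a j)) (H.smul_mem _ (hf i a))) }
  have h1 : H ≤ N := iSup_le fun m => iSup_le fun n => by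
    refine LieSubmodule.lieSpan_le.2 (Set.singleton_subset_iff.2 fun i j => ?_)
    have hx : xC 3 4 = skewX Sum.inl 3 4 := rfl
    rw [derivation_X_pow_mul_X_pow, skewD_X (fun _ => Sum.inl_ne_inr), mul_zero, smul_zero,
      add_zero, hx, skewD_skewX Sum.inl_injective, mul_comm _ (C _), C_mul', smul_smul]
    exact H.smul_mem _ (high_le_iSup (m - 1) n (LieSubmodule.subset_lieSpan rfl))
  exact h1 hf i j

/-- The adjoint operators, which are derivatives, preserve the sum of the highest components, hence
`θᶜ` preserves its orthogonal complement. -/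
theorem thetaC_mem_lowC (i j : Fin 5) (f : SC) (hf : f ∈ lowC) : thetaC i j f ∈ lowC :=
  unitaryC.mem_low_of_fischer fun g hg => by
    rw [thetaC_apply, ← fischer_skewD]
    exact unitaryC.fischer_low (skewD_mem_highC i j g hg) hf

theorem pluckerZ_mul_mem_lowC (b c : Fin 5) (g : SC) :
    pluckerZ Sum.inr Sum.inl b c * g ∈ lowC :=
  unitaryC.mul_mem_low top_notMem_kerC (fun g => by
    rw [mem_kerC, map_mul, map_pluckerZ substC_z substC_x, zero_mul])
    (pluckerZ_mem_bihom (z := Sum.inr) (e := Sum.inl) (m := 0) (n := 1) (m' := 1) (n' := 0)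
      (fun p => by simp [bideg_single]) (fun p => by simp [bideg_single]) b c) g

theorem pluckerX_mul_mem_lowC (b c l : Fin 5) (g : SC) :
    pluckerX Sum.inl b c l * g ∈ lowC :=
  unitaryC.mul_mem_low top_notMem_kerC (fun g => by
    rw [mem_kerC, map_mul, map_pluckerX substC_x, zero_mul])
    (pluckerX_mem_bihom (e := Sum.inl) (m := 1) (n := 0)
      (fun p => by simp [bideg_single]) b c l) g

/-- The odd relation holds modulo the quadratic relations. -/
theorem sum_lie_thetaC (w : Omega2cl) (f : SC) :
    ∑ i, ∑ j, ⁅toG0 (brL (0, w) (d i j)), thetaC i j f⁆ ∈ lowC := by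
  refine sum_lie_mem lowC.toSubmodule (fun a k f => -(X (Sum.inr k) * pderiv (Sum.inr a) f +
    ∑ l, skewX Sum.inl k l * skewD Sum.inl a l f)) (fun A f => ?_) (fun i j => thetaC i j f)
    (fun a b c => -(2 : ℂ) • ∑ k, ∑ j, eps k b c a j • (skewX Sum.inl k j * f))
    (fun a b c => ?_) (fun a b c => ?_) w
  · rw [lie_SC, Derivation.add_apply, act1Op_apply, act2Op_apply, Finset.sum_comm,
      Finset.sum_comm (f := fun a k => (-A.1.transpose) a k • ∑ b, _)]
    simp only [smul_neg, smul_add, Finset.sum_add_distrib, Matrix.neg_apply,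
      Matrix.transpose_apply, neg_smul, Finset.sum_neg_distrib, neg_add]
  · simp only [eps_rotate_123]
  · classical
    set F : Fin 5 → Fin 5 → Fin 5 → SC := fun k i j =>
      if i = a then skewX Sum.inl k j * f else 0 with hF
    have e : ∀ k i j, -(X (Sum.inr k) * pderiv (Sum.inr a) (thetaC i j f) +
        ∑ l, skewX Sum.inl k l * skewD Sum.inl a l (thetaC i j f)) =
        -(X (Sum.inr k) * skewX Sum.inl i j * pderiv (Sum.inr a) f) -
        ∑ l, skewX Sum.inl k l * skewX Sum.inl i j * skewD Sum.inl a l f - (F k i j - F k j i) := by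
      intro k i j
      have h1 : ∑ l, skewX Sum.inl k l * (f * skewD Sum.inl a l (skewX Sum.inl i j)) =
          F k i j - F k j i := by
        have h2 : ∀ l, f * skewD Sum.inl a l (skewX Sum.inl i j : SC) =
            (if a = i then if l = j then f else 0 else 0) -
              (if a = j then if l = i then f else 0 else 0) := by
          intro l
          rw [skewD_skewX Sum.inl_injective, C_sub, mul_sub]
          congr 1 <;> simp only [← ite_and] <;> split_ifs <;> simp
        simp only [h2, mul_sub, Finset.sum_sub_distrib, hF]
        congr 1
        · by_cases h : a = i
          · simp [h]
          · simp [h, Ne.symm h]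
        · by_cases h : a = j
          · simp [h]
          · simp [h, Ne.symm h]
      simp only [thetaC_apply, Derivation.leibniz, smul_eq_mul, mul_add, Finset.sum_add_distrib, h1,
        pderiv_skewX (fun _ => Sum.inl_ne_inr), mul_zero, add_zero, mul_assoc]
      ring
    have s1 : ∑ k, ∑ i, ∑ j, eps k b c i j • F k i j =
        ∑ k, ∑ j, eps k b c a j • (skewX Sum.inl k j * f) := by
      refine Finset.sum_congr rfl fun k _ => ?_
      rw [Finset.sum_eq_single a]
      · simp [hF]
      · intro i _ hi
        simp [hF, hi]
      · simp
    have s2 : ∑ k, ∑ i, ∑ j, eps k b c i j • ∑ l, skewX Sum.inl k l * skewX Sum.inl i j *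
        skewD Sum.inl a l f = ∑ l, pluckerX Sum.inl b c l * skewD Sum.inl a l f := by
      simp only [pluckerX, Finset.smul_sum, Finset.sum_mul, smul_mul_assoc]
      exact sum_rotate _
    have s3 : ∑ k, ∑ i, ∑ j, eps k b c i j • (X (Sum.inr k) * skewX Sum.inl i j *
        pderiv (Sum.inr a) f) = pluckerZ Sum.inr Sum.inl b c * pderiv (Sum.inr a) f := by
      simp only [pluckerZ, Finset.sum_mul, smul_mul_assoc]
    simp only [e, smul_sub, smul_neg, Finset.sum_sub_distrib, Finset.sum_neg_distrib]
    rw [sum_eps_34 b c F, s1, s2, s3]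
    have h3 : -(pluckerZ Sum.inr Sum.inl b c * pderiv (Sum.inr a) f) -
        ∑ l, pluckerX Sum.inl b c l * skewD Sum.inl a l f ∈ lowC :=
      sub_mem (neg_mem (pluckerZ_mul_mem_lowC _ _ _)) (sum_mem fun l _ =>
        pluckerX_mul_mem_lowC _ _ _ _)
    change _ ∈ lowC
    convert h3 using 1
    module

end CaseC

/-! ### The morphisms `∇_X` -/

section Morphisms

theorem exists_nablaA : ∃ θ : Fin 5 → Fin 5 → VA →ₗ[ℂ] VA,
    (∀ i j f, (θ i j f : SA) = thetaA i j f) ∧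
    ∃ φ : Verma VA →ₗ[U] Verma VA, IsNabla θ φ ∧ HasDegree φ 1 ∧
      (∀ m n, φ ∘ₗ Verma.map (partA m n).incl = 0 ↔ n = 0) ∧
      ∀ m n, HasDegree (φ ∘ₗ Verma.map (partA m n).incl) 1 := by
  let θ : Fin 5 → Fin 5 → VA →ₗ[ℂ] VA := fun i j =>
    LinearMap.restrict (p := VA.toSubmodule) (q := VA.toSubmodule) (thetaA i j)
      (fun f hf => thetaA_mem_VA i j f hf)
  have hθ : ∀ i j (f : VA), ((θ i j f : VA) : SA) = thetaA i j f := fun i j f => rfl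
  obtain ⟨φ, hφ⟩ := exists_isNabla θ (fun A i j v => Subtype.ext (by
    rw [LieSubmodule.coe_bracket, hθ, lie_thetaA, LieSubmodule.coe_sub, hθ,
      LieSubmodule.coe_bracket]
    refine congrArg (thetaA i j ⁅A, (v : SA)⁆ - ·) (Eq.symm ?_)
    change VA.incl (∑ a, (A.1 i a • θ a j v + A.1 j a • θ i a v)) = _
    rw [map_sum]
    rfl)) (fun w _ v => Subtype.ext (by
    change VA.incl (∑ i, ∑ j, ⁅toG0 (brL (0, w) (d i j)), θ i j v⁆) = _
    simp only [map_sum]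
    exact sum_lie_thetaA w v.2))
  have hs : ∀ i j v, θ j i v = -θ i j v := fun i j v => Subtype.ext (by
    change thetaA j i v = -thetaA i j v
    rw [thetaA_apply, thetaA_apply, skewD_apply_symm])
  refine ⟨θ, hθ, φ, hφ, hasDegree_self_of_isNabla θ φ hφ, fun m n => ?_,
    fun m n => hasDegree_of_isNabla θ φ hφ _⟩
  rw [isNabla_comp_eq_zero_iff θ φ hφ hs]
  constructor
  · intro h
    have hmem : (X (Sum.inl 0) ^ m * X (Sum.inr ⟨(0, 1), by decide⟩) ^ n : SA) ∈ highA m n :=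
      LieSubmodule.subset_lieSpan rfl
    have h1 := congrArg Subtype.val (h 0 1 ⟨_, high_le_iSup m n hmem⟩ hmem)
    have h2 := (thetaA_top 0 1 m n).symm.trans h1
    rcases smul_eq_zero.1 h2 with h3 | h3
    · simpa using h3
    · exact absurd h3 (X_pow_mul_X_pow_ne_zero _ _ _ _)
  · rintro rfl i j v hv
    exact Subtype.ext (thetaA_of_mem_bihom (unitaryA.high_le_bihom m 0 hv) i j)

theorem exists_nablaB : ∃ θ : Fin 5 → Fin 5 → VB →ₗ[ℂ] VB,
    (∀ i j f, θ i j (LieSubmodule.Quotient.mk f) = LieSubmodule.Quotient.mk (thetaB i j f)) ∧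
    ∃ φ : Verma VB →ₗ[U] Verma VB, IsNabla θ φ ∧ HasDegree φ 1 ∧
      (∀ m n, φ ∘ₗ Verma.map (partB m n).incl = 0 ↔ m = 0) ∧
      ∀ m n, HasDegree (φ ∘ₗ Verma.map (partB m n).incl) 1 := by
  obtain ⟨θ, hθ, φ, hφ, hd, h0, h1⟩ := exists_isNabla_quot lowB thetaB thetaB_mem_lowB lie_thetaB
    (fun w f => by rw [sum_lie_thetaB]; exact zero_mem _)
    (fun i j f => by rw [thetaB_apply, thetaB_apply, neg_sub])
  refine ⟨θ, hθ, φ, hφ, hd, fun m n => (h0 (highB m n)).trans ⟨fun h => ?_, ?_⟩,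
    fun m n => h1 _⟩
  · by_contra hm
    have h2 := h 4 0 _ (LieSubmodule.subset_lieSpan rfl)
    rw [thetaB_top] at h2
    -- the image is a multiple of another highest monomial
    have h3 := unitaryB.eq_zero_of_mem_low ((high 0 4 (m - 1) (n + 1)).smul_mem (m : ℂ)
      (LieSubmodule.subset_lieSpan rfl)) h2
    rcases smul_eq_zero.1 h3 with h4 | h4
    · exact hm (Nat.cast_eq_zero.1 h4)
    · exact X_pow_mul_X_pow_ne_zero _ _ _ _ h4
  · rintro rfl i j v hv
    rw [thetaB_of_mem_bihom (unitaryB.high_le_bihom 0 n hv)]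
    exact zero_mem _

theorem exists_nablaC : ∃ θ : Fin 5 → Fin 5 → VC →ₗ[ℂ] VC,
    (∀ i j f, θ i j (LieSubmodule.Quotient.mk f) = LieSubmodule.Quotient.mk (thetaC i j f)) ∧
    ∃ φ : Verma VC →ₗ[U] Verma VC, IsNabla θ φ ∧ HasDegree φ 1 ∧
      (∀ m n, φ ∘ₗ Verma.map (partC m n).incl ≠ 0) ∧
      ∀ m n, HasDegree (φ ∘ₗ Verma.map (partC m n).incl) 1 := by
  obtain ⟨θ, hθ, φ, hφ, hd, h0, h1⟩ := exists_isNabla_quot lowC thetaC thetaC_mem_lowC lie_thetaC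
    sum_lie_thetaC (fun i j f => by
      rw [thetaC_apply, thetaC_apply, skewX_symm, neg_mul])
  refine ⟨θ, hθ, φ, hφ, hd, fun m n h => ?_, fun m n => h1 _⟩
  have h2 := (h0 (highC m n)).1 h 3 4 _ (LieSubmodule.subset_lieSpan rfl)
  rw [thetaC_apply, ← mul_assoc, show skewX Sum.inl 3 4 = xC 3 4 from rfl, ← pow_succ'] at h2
  -- the image is again a highest monomial
  exact X_pow_mul_X_pow_ne_zero _ _ _ _ (unitaryC.eq_zero_of_mem_low (m := m + 1) (n := n)
    (LieSubmodule.subset_lieSpan rfl) h2)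

end Morphisms

end

end E510

theorem theorem4p1 :
    -- `V_X` is the direct sum of its summands, which are the stated irreducible modules
    ((DirectSum.IsInternal fun p : ℕ × ℕ => E510.partA p.1 p.2) ∧
      ∀ m n, E510.IsF (E510.partA m n) ![m, n, 0, 0]) ∧
    ((DirectSum.IsInternal fun p : ℕ × ℕ => E510.partB p.1 p.2) ∧
      ∀ m n, E510.IsF (E510.partB m n) ![m, 0, 0, n]) ∧
    ((DirectSum.IsInternal fun p : ℕ × ℕ => E510.partC p.1 p.2) ∧
      ∀ m n, E510.IsF (E510.partC m n) ![0, 0, m, n]) ∧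
    -- the morphism for `X = A`
    (∃ θ : Fin 5 → Fin 5 → E510.VA →ₗ[ℂ] E510.VA,
      (∀ i j f, (θ i j f : E510.SA) = E510.thetaA i j f) ∧
      ∃ φ : E510.Verma E510.VA →ₗ[E510.U] E510.Verma E510.VA,
        E510.IsNabla θ φ ∧ E510.HasDegree φ 1 ∧
        (∀ m n, φ ∘ₗ E510.Verma.map (E510.partA m n).incl = 0 ↔ n = 0) ∧
        ∀ m n, φ ∘ₗ E510.Verma.map (E510.partA m n).incl ≠ 0 →
          E510.HasDegree (φ ∘ₗ E510.Verma.map (E510.partA m n).incl) 1) ∧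
    -- the morphism for `X = B`
    (∃ θ : Fin 5 → Fin 5 → E510.VB →ₗ[ℂ] E510.VB,
      (∀ i j f, θ i j (LieSubmodule.Quotient.mk f) =
        LieSubmodule.Quotient.mk (E510.thetaB i j f)) ∧
      ∃ φ : E510.Verma E510.VB →ₗ[E510.U] E510.Verma E510.VB,
        E510.IsNabla θ φ ∧ E510.HasDegree φ 1 ∧
        (∀ m n, φ ∘ₗ E510.Verma.map (E510.partB m n).incl = 0 ↔ m = 0) ∧
        ∀ m n, φ ∘ₗ E510.Verma.map (E510.partB m n).incl ≠ 0 →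
          E510.HasDegree (φ ∘ₗ E510.Verma.map (E510.partB m n).incl) 1) ∧
    -- the morphism for `X = C`
    (∃ θ : Fin 5 → Fin 5 → E510.VC →ₗ[ℂ] E510.VC,
      (∀ i j f, θ i j (LieSubmodule.Quotient.mk f) =
        LieSubmodule.Quotient.mk (E510.thetaC i j f)) ∧
      ∃ φ : E510.Verma E510.VC →ₗ[E510.U] E510.Verma E510.VC,
        E510.IsNabla θ φ ∧ E510.HasDegree φ 1 ∧
        (∀ m n, φ ∘ₗ E510.Verma.map (E510.partC m n).incl ≠ 0) ∧
        ∀ m n, E510.HasDegree (φ ∘ₗ E510.Verma.map (E510.partC m n).incl) 1) := by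
  obtain ⟨θA, hA, φA, hφA, hdA, h0A, h1A⟩ := E510.exists_nablaA
  obtain ⟨θB, hB, φB, hφB, hdB, h0B, h1B⟩ := E510.exists_nablaB
  obtain ⟨θC, hC, φC, hφC, hdC, h0C, h1C⟩ := E510.exists_nablaC
  exact ⟨⟨E510.isInternal_partA, E510.isF_partA⟩, ⟨E510.isInternal_partB, E510.isF_partB⟩,
    ⟨E510.isInternal_partC, E510.isF_partC⟩,
    ⟨θA, hA, φA, hφA, hdA, h0A, fun m n _ => h1A m n⟩,
    ⟨θB, hB, φB, hφB, hdB, h0B, fun m n _ => h1B m n⟩,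
    ⟨θC, hC, φC, hφC, hdC, h0C, h1C⟩⟩
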